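/- **Setting.** Let $n\ge 2$ and $1\le p<\infty$. Cubes are open with sides parallel to the coordinate axes, $\ell(Q)$ is the side length of $Q$, and $2Q$ is the concentric cube of side length $2\ell(Q)$. A weight is a nonnegative locally Lebesgue-integrable function $w$ on $\mathbb R^n$, and $d\mu=w\,dx$. The weight $w$ is *$p$-admissible with constants $A,B$* if $0<\mu(Q)<\infty$ for every cube $Q$, $\mu$ is doubling, i.e. $\mu(2Q)\le A\,\mu(Q)$ for every cube $Q$, and $\mu$ satisfies the $p$-Poincaré inequality $$\frac1{\mu(Q)}\int_Q|u-u_Q|\,d\mu\le B\,(\operatorname{diam}Q)\Big(\frac1{\mu(Q)}\int_Q|\nabla u|^p\,d\mu\Big)^{1/p},\qquad u_Q:=\frac1{\mu(Q)}\int_Q u\,d\mu,$$ for every cube $Q$ and every bounded $u\in C^\infty(Q)$. For open $\Omega\subset\mathbb R^n$, $H^{1,p}(\Omega;\mu)$ is the space of $u\in L^p(\Omega;\mu)$ for which there are $v\in L^p(\Omega;\mu)^n$ and $\varphi_i\in C^\infty(\Omega)$ with $\varphi_i\to u$ in $L^p(\Omega;\mu)$ and $\nabla\varphi_i\to v$ in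 $L^p(\Omega;\mu)^n$; one writes $\nabla u:=v$ (under $p$-admissibility $v$ is determined by $u$ up to $\mu$-null sets). $H^{1,p}(\overline\Omega;\mu)$ is the subspace of those $u\in H^{1,p}(\Omega;\mu)$ that agree $\mu$-a.e. on $\Omega$ with some $\widetilde u\in H^{1,p}(\Omega';\mu)$ for some open $\Omega'\supset\overline\Omega$. For a cube $Q$ with centre $c$ and side length $\ell$ and for $\alpha\in(0,1)$, the ring of relative thickness $\alpha$ is $R=\{x\in Q:\ \max_i|x_i-c_i|>(1-\alpha)\ell/2\}$; put $\ell(R):=\alpha\ell$. **Theorem.** Given $n,p,A,B$ as above, there are constants $C_0>0$ and $C_1\ge 2$, depending only on $n,p,A,B$, such that the following holds for every weight $w$ on $\mathbb R^n$ that is $p$-admissible with constants $A,B$, every cube $Q$ and every $\alpha\in(0,1)$. Let $R$ be the ring of relative thickness $\alpha$ of $Q$, and let $m\ge 0$ be the integer with $2^m\ell(R)<\ell(Q)\le 2^{m+1}\ell(R)$. Then there is a linear operator $E\colon H^{1,p}(\overline R;\mu)\to H^{1,p}(Q;\mu)$ such that for every $u\in H^{1,p}(\overline R;\mu)$ one has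 $Eu=u$ $\mu$-a.e. on $R$ and $$\|Eu\|_{L^p(Q;\mu)}\le C_0C_1^m\|u\|_{L^p(R;\mu)},\qquad \|\nabla Eu\|_{L^p(Q;\mu)}\le C_0C_1^m\|\nabla u\|_{L^p(R;\mu)}.$$ Moreover $C_1^m<\alpha^{-\log_2C_1}\le C_1^{m+1}$. -/

import Mathlib

open MeasureTheory Filter Topology
open scoped ENNReal NNReal ContDiff

namespace WeightedSobolev

/-- Euclidean space `ℝⁿ`. -/
abbrev Eucl (n : ℕ) : Type := EuclideanSpace ℝ (Fin n)

/-- The open cube with sides parallel to the axes, centre `c` and side length `ℓ`. -/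
def cube {n : ℕ} (c : Eucl n) (ℓ : ℝ) : Set (Eucl n) :=
  {x | ∀ i, |x i - c i| < ℓ / 2}

/-- The ring of relative thickness `α` along the perimeter of `cube c ℓ`: the points `x` of the
cube with `(1 - α) ℓ / 2 < max_i |x i - c i|`. -/
def cubeRing {n : ℕ} (c : Eucl n) (ℓ α : ℝ) : Set (Eucl n) :=
  {x | x ∈ cube c ℓ ∧ ∃ i, (1 - α) * ℓ / 2 < |x i - c i|}

/-- The measure `dμ = w dx`. -/
noncomputable def weightMeasure {n : ℕ} (w : Eucl n → ℝ) : Measure (Eucl n) :=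
  (volume : Measure (Eucl n)).withDensity (fun x => ENNReal.ofReal (w x))

/-- `μ` is doubling, with doubling constant `A`. -/
def IsDoubling {n : ℕ} (μ : Measure (Eucl n)) (A : ℝ≥0) : Prop :=
  (∀ (c : Eucl n) (ℓ : ℝ), 0 < ℓ → μ (cube c (2 * ℓ)) ≤ A * μ (cube c ℓ)) ∧
  ∀ (c : Eucl n) (ℓ : ℝ), 0 < ℓ → 0 < μ (cube c ℓ) ∧ μ (cube c ℓ) < (⊤ : ℝ≥0∞)

/-- `μ` satisfies a `p`-Poincaré inequality, with constant `B`. The right-hand side may be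
infinite. -/
def SatisfiesPoincare {n : ℕ} (p : ℝ) (μ : Measure (Eucl n)) (B : ℝ≥0) : Prop :=
  (∀ (c : Eucl n) (ℓ : ℝ), 0 < ℓ → 0 < μ (cube c ℓ) ∧ μ (cube c ℓ) < (⊤ : ℝ≥0∞)) ∧
  ∀ (c : Eucl n) (ℓ : ℝ), 0 < ℓ → ∀ u : Eucl n → ℝ,
    ContDiffOn ℝ ∞ u (cube c ℓ) → (∃ M : ℝ, ∀ x ∈ cube c ℓ, |u x| ≤ M) →
      ⨍⁻ x in cube c ℓ, ‖u x - ⨍ y in cube c ℓ, u y ∂μ‖ₑ ∂μ ≤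
        B * ENNReal.ofReal (Metric.diam (cube c ℓ)) *
          (⨍⁻ x in cube c ℓ, ‖gradient u x‖ₑ ^ p ∂μ) ^ (1 / p)

/-- `w` is a `p`-admissible weight on `ℝⁿ`, with doubling constant `A` and Poincaré
constant `B`. -/
structure IsAdmissibleWeight {n : ℕ} (p : ℝ) (w : Eucl n → ℝ) (A B : ℝ≥0) : Prop where
  nonneg : ∀ x, 0 ≤ w x
  locallyIntegrable : LocallyIntegrable w volume
  doubling : IsDoubling (weightMeasure w) A
  poincare : SatisfiesPoincare p (weightMeasure w) B

/-- `u ∈ L^p(Ω; μ)` is a limit in `L^p(Ω; μ)` of functions `φ_i ∈ C^∞(Ω)` whose gradients converge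
to `v` in `L^p(Ω; μ)`; that is, `u` belongs to `H^{1,p}(Ω; μ)` and `v` is its gradient. -/
def HasSobolevGradient {n : ℕ} (p : ℝ) (μ : Measure (Eucl n)) (Ω : Set (Eucl n))
    (u : Eucl n → ℝ) (v : Eucl n → Eucl n) : Prop :=
  MemLp u (ENNReal.ofReal p) (μ.restrict Ω) ∧
  MemLp v (ENNReal.ofReal p) (μ.restrict Ω) ∧
  ∃ φ : ℕ → Eucl n → ℝ, (∀ i, ContDiffOn ℝ ∞ (φ i) Ω) ∧
    Tendsto (fun i => eLpNorm (fun x => φ i x - u x) (ENNReal.ofReal p) (μ.restrict Ω))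
      atTop (𝓝 0) ∧
    Tendsto (fun i => eLpNorm (fun x => gradient (φ i) x - v x) (ENNReal.ofReal p)
      (μ.restrict Ω)) atTop (𝓝 0)

theorem HasSobolevGradient.congr {n : ℕ} {p : ℝ} {μ : Measure (Eucl n)} {Ω : Set (Eucl n)}
    {u u' : Eucl n → ℝ} {v : Eucl n → Eucl n} (h : HasSobolevGradient p μ Ω u v)
    (hu : u =ᵐ[μ.restrict Ω] u') : HasSobolevGradient p μ Ω u' v := by
  obtain ⟨h1, h2, φ, hφ, ht, hd⟩ := h
  refine ⟨h1.ae_eq hu, h2, φ, hφ, ?_, hd⟩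
  refine ht.congr fun i => eLpNorm_congr_ae ?_
  filter_upwards [hu] with x hx
  rw [hx]

theorem HasSobolevGradient.mono {n : ℕ} {p : ℝ} {μ : Measure (Eucl n)} {Ω Ω' : Set (Eucl n)}
    {u : Eucl n → ℝ} {v : Eucl n → Eucl n} (h : HasSobolevGradient p μ Ω u v)
    (hs : Ω' ⊆ Ω) : HasSobolevGradient p μ Ω' u v := by
  obtain ⟨h1, h2, φ, hφ, ht, hd⟩ := h
  have hm := Measure.restrict_mono_set μ hs
  refine ⟨h1.mono_measure hm, h2.mono_measure hm, φ, fun i => (hφ i).mono hs, ?_, ?_⟩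
  · exact tendsto_of_tendsto_of_tendsto_of_le_of_le tendsto_const_nhds ht
      (fun _ => zero_le) fun _ => eLpNorm_mono_measure _ hm
  · exact tendsto_of_tendsto_of_tendsto_of_le_of_le tendsto_const_nhds hd
      (fun _ => zero_le) fun _ => eLpNorm_mono_measure _ hm

theorem hasSobolevGradient_zero {n : ℕ} (p : ℝ) (μ : Measure (Eucl n)) (Ω : Set (Eucl n)) :
    HasSobolevGradient p μ Ω (fun _ => 0) (fun _ => 0) := by
  refine ⟨MemLp.zero', MemLp.zero', fun _ _ => 0, fun _ => contDiffOn_const, ?_, ?_⟩ <;> simp [gradient]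

theorem HasSobolevGradient.const_smul {n : ℕ} {p : ℝ} {μ : Measure (Eucl n)} {Ω : Set (Eucl n)}
    (hΩ : IsOpen Ω) {u : Eucl n → ℝ} {v : Eucl n → Eucl n} (h : HasSobolevGradient p μ Ω u v)
    (a : ℝ) : HasSobolevGradient p μ Ω (fun x => a * u x) (fun x => a • v x) := by
  obtain ⟨h1, h2, φ, hφ, ht, hd⟩ := h
  refine ⟨h1.const_mul a, h2.const_smul a, fun i x => a * φ i x,
    fun i => contDiffOn_const.mul (hφ i), ?_, ?_⟩
  · have := ENNReal.Tendsto.const_mul (a := ‖a‖ₑ) ht (Or.inr enorm_ne_top)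
    rw [mul_zero] at this
    refine this.congr fun i => ?_
    rw [← eLpNorm_const_smul]
    congr 1
    ext x
    simp [mul_sub]
  · have := ENNReal.Tendsto.const_mul (a := ‖a‖ₑ) hd (Or.inr enorm_ne_top)
    rw [mul_zero] at this
    refine this.congr fun i => ?_
    rw [← eLpNorm_const_smul]
    refine eLpNorm_congr_ae ?_
    filter_upwards [ae_restrict_mem hΩ.measurableSet] with x hx
    have hdiff : DifferentiableAt ℝ (φ i) x :=
      ((hφ i).contDiffAt (hΩ.mem_nhds hx)).differentiableAt (by simp)
    simp only [gradient, fderiv_const_mul hdiff, map_smul, Pi.smul_apply, smul_sub]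

/-- Additivity of `L^p`-convergence, used for functions and for gradients. -/
theorem tendsto_eLpNorm_add {X F : Type*} [MeasurableSpace X] [NormedAddCommGroup F]
    {μ : Measure X} {q : ℝ≥0∞} (hq : 1 ≤ q) {f f' g : ℕ → X → F} {a a' : X → F}
    (hf : ∀ i, AEStronglyMeasurable (f i) μ) (hf' : ∀ i, AEStronglyMeasurable (f' i) μ)
    (ha : AEStronglyMeasurable a μ) (ha' : AEStronglyMeasurable a' μ)
    (hg : ∀ i, ∀ᵐ x ∂μ, g i x = f i x + f' i x)
    (h : Tendsto (fun i => eLpNorm (fun x => f i x - a x) q μ) atTop (𝓝 0))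
    (h' : Tendsto (fun i => eLpNorm (fun x => f' i x - a' x) q μ) atTop (𝓝 0)) :
    Tendsto (fun i => eLpNorm (fun x => g i x - (a x + a' x)) q μ) atTop (𝓝 0) := by
  have hs := h.add h'
  rw [add_zero] at hs
  refine tendsto_of_tendsto_of_tendsto_of_le_of_le tendsto_const_nhds hs
    (fun _ => zero_le) fun i => ?_
  refine le_trans (le_of_eq (eLpNorm_congr_ae ?_))
    (eLpNorm_add_le ((hf i).sub ha) ((hf' i).sub ha') hq)
  filter_upwards [hg i] with x hx
  simp only [Pi.add_apply, hx]
  abel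

theorem HasSobolevGradient.add {n : ℕ} {p : ℝ} (hp : 1 ≤ p) {μ : Measure (Eucl n)}
    {Ω : Set (Eucl n)} (hΩ : IsOpen Ω) {u u' : Eucl n → ℝ} {v v' : Eucl n → Eucl n}
    (h : HasSobolevGradient p μ Ω u v) (h' : HasSobolevGradient p μ Ω u' v') :
    HasSobolevGradient p μ Ω (fun x => u x + u' x) (fun x => v x + v' x) := by
  obtain ⟨h1, h2, φ, hφ, ht, hd⟩ := h
  obtain ⟨h1', h2', φ', hφ', ht', hd'⟩ := h'
  have hp' : (1 : ℝ≥0∞) ≤ ENNReal.ofReal p := by simpa using hp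
  have hms := hΩ.measurableSet
  have hc : ∀ {ψ : Eucl n → ℝ}, ContDiffOn ℝ ∞ ψ Ω →
      AEStronglyMeasurable ψ (μ.restrict Ω) := fun hψ =>
    hψ.continuousOn.aestronglyMeasurable hms
  have hc' : ∀ {ψ : Eucl n → ℝ}, ContDiffOn ℝ ∞ ψ Ω →
      AEStronglyMeasurable (fun x => gradient ψ x) (μ.restrict Ω) := fun hψ =>
    ((InnerProductSpace.toDual ℝ (Eucl n)).symm.continuous.comp_continuousOn
      (hψ.continuousOn_fderiv_of_isOpen hΩ (by simp))).aestronglyMeasurable hms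
  refine ⟨h1.add h1', h2.add h2', fun i x => φ i x + φ' i x,
    fun i => (hφ i).add (hφ' i), ?_, ?_⟩
  · exact tendsto_eLpNorm_add hp' (fun i => hc (hφ i)) (fun i => hc (hφ' i)) h1.1 h1'.1
      (fun i => Eventually.of_forall fun _ => rfl) ht ht'
  · refine tendsto_eLpNorm_add hp' (fun i => hc' (hφ i)) (fun i => hc' (hφ' i)) h2.1 h2'.1
      (fun i => ?_) hd hd'
    filter_upwards [ae_restrict_mem hms] with x hx
    have hdiff : ∀ {ψ : Eucl n → ℝ}, ContDiffOn ℝ ∞ ψ Ω → DifferentiableAt ℝ ψ x := fun hψ =>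
      (hψ.contDiffAt (hΩ.mem_nhds hx)).differentiableAt (by simp)
    simp only [gradient, fderiv_fun_add (hdiff (hφ i)) (hdiff (hφ' i)), map_add]

/-- The Sobolev space `H^{1,p}(Ω; μ)`, for `Ω` open, as a subspace of `L^p(Ω; μ)`. -/
noncomputable def H1p {n : ℕ} (p : ℝ) (hp : 1 ≤ p) (μ : Measure (Eucl n)) (Ω : Set (Eucl n))
    (hΩ : IsOpen Ω) : Submodule ℝ (Lp ℝ (ENNReal.ofReal p) (μ.restrict Ω)) where
  carrier := {u | ∃ v, HasSobolevGradient p μ Ω u v}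
  zero_mem' := ⟨_, (hasSobolevGradient_zero p μ Ω).congr (Lp.coeFn_zero _ _ _).symm⟩
  add_mem' := by
    rintro u u' ⟨v, h⟩ ⟨v', h'⟩
    exact ⟨_, (h.add hp hΩ h').congr (Lp.coeFn_add u u').symm⟩
  smul_mem' := by
    rintro a u ⟨v, h⟩
    exact ⟨_, (h.const_smul hΩ a).congr (Lp.coeFn_smul a u).symm⟩

/-- The subspace `H^{1,p}(closure Ω; μ)` of `H^{1,p}(Ω; μ)`: those `u` that agree `μ`-a.e. on `Ω`
with an element of `H^{1,p}(Ω'; μ)` for some open `Ω' ⊇ closure Ω`. -/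
noncomputable def H1pClosure {n : ℕ} (p : ℝ) (hp : 1 ≤ p) (μ : Measure (Eucl n))
    (Ω : Set (Eucl n)) (hΩ : IsOpen Ω) :
    Submodule ℝ (Lp ℝ (ENNReal.ofReal p) (μ.restrict Ω)) where
  carrier := {u | u ∈ H1p p hp μ Ω hΩ ∧
    ∃ (Ω' : Set (Eucl n)) (hΩ' : IsOpen Ω'), closure Ω ⊆ Ω' ∧
      ∃ u' ∈ H1p p hp μ Ω' hΩ', u =ᵐ[μ.restrict Ω] u'}
  zero_mem' := ⟨Submodule.zero_mem _, Set.univ, isOpen_univ, Set.subset_univ _, 0,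
    Submodule.zero_mem _, (Lp.coeFn_zero _ _ _).trans
      (EventuallyEq.symm (Filter.EventuallyEq.filter_mono (Lp.coeFn_zero _ _ _)
        (ae_mono (Measure.restrict_mono_set μ (Set.subset_univ Ω)))))⟩
  add_mem' := by
    rintro u₁ u₂ ⟨h₁, Ω₁, hΩ₁, hc₁, u₁', ⟨v₁, hv₁⟩, he₁⟩ ⟨h₂, Ω₂, hΩ₂, hc₂, u₂', ⟨v₂, hv₂⟩, he₂⟩
    have hadd := (hv₁.mono (Set.inter_subset_left (t := Ω₂))).add hp (hΩ₁.inter hΩ₂)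
      (hv₂.mono (Set.inter_subset_right (s := Ω₁)))
    have hsub : Ω ⊆ Ω₁ ∩ Ω₂ :=
      subset_closure.trans (Set.subset_inter hc₁ hc₂)
    refine ⟨Submodule.add_mem _ h₁ h₂, Ω₁ ∩ Ω₂, hΩ₁.inter hΩ₂, Set.subset_inter hc₁ hc₂,
      hadd.1.toLp _, ⟨_, hadd.congr hadd.1.coeFn_toLp.symm⟩, ?_⟩
    filter_upwards [Lp.coeFn_add u₁ u₂, he₁, he₂,
      hadd.1.coeFn_toLp.filter_mono (ae_mono (Measure.restrict_mono_set μ hsub))] with x h1 h2 h3 h4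
    rw [h1, h4, Pi.add_apply, h2, h3]
  smul_mem' := by
    rintro a u ⟨h, Ω', hΩ', hc, u', hu', he⟩
    refine ⟨Submodule.smul_mem _ a h, Ω', hΩ', hc, a • u', Submodule.smul_mem _ a hu', ?_⟩
    filter_upwards [Lp.coeFn_smul a u, he,
      (Lp.coeFn_smul a u').filter_mono
        (ae_mono (Measure.restrict_mono_set μ (subset_closure.trans hc)))]
      with x h1 h2 h3
    rw [h1, h3, Pi.smul_apply, Pi.smul_apply, h2]

theorem isOpen_cube {n : ℕ} (c : Eucl n) (ℓ : ℝ) : IsOpen (cube c ℓ) := by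
  have : cube c ℓ = ⋂ i, {x : Eucl n | |x i - c i| < ℓ / 2} := by
    ext x; simp [cube]
  rw [this]
  exact isOpen_iInter_of_finite fun i => isOpen_lt (by fun_prop) continuous_const

theorem isOpen_cubeRing {n : ℕ} (c : Eucl n) (ℓ α : ℝ) : IsOpen (cubeRing c ℓ α) := by
  have : cubeRing c ℓ α = cube c ℓ ∩ ⋃ i, {x : Eucl n | (1 - α) * ℓ / 2 < |x i - c i|} := by
    ext x; simp [cubeRing]
  rw [this]
  exact (isOpen_cube c ℓ).inter
    (isOpen_iUnion fun i => isOpen_lt continuous_const (by fun_prop))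

end WeightedSobolev

open WeightedSobolev

/-! The ring surrounds a hole, the concentric cube of half side `a = (1 - α) ℓ / 2`, and only the
hole has to be filled. Fix a shell of thickness `b ≤ a` around the hole, inside the ring, with `a ≤
2 ^ j * b`; at the end `j = m + 1`. Close to the boundary of the hole the extension at `x` is a
weighted `μ`-average of `u` over a cube around the radial reflection of `x`, whose size and distance
from `x` are comparable with the distance of `x` to the boundary. Further in, it is one constant,
the mean of `u` over a cube of side `b` at a corner of the shell. A cutoff at scale `b` glues the
two. This is a Whitney type extension without a Whitney decomposition: `depth` is a smooth
substitute for the distance to the boundary, so the averages depend smoothly on `x`.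

Differentiating an average costs `1 / depth` times the mean oscillation on the reflected cube
(`exists_enorm_fderiv_layerAverage_le`), and Poincaré gives back a factor `depth`, leaving an
average of `‖∇u‖ ^ p`. Such averages integrate to a multiple of the integral over the shell, by
Tonelli and doubling (`IsDoubling.lintegral_setLAverage_reflectedCube_le`). Only the gluing feels
the ratio `a / b`. The derivative of the cutoff, of order `1 / b`, multiplies the difference between
a local average and the corner mean. That difference is bounded by a chain of about `2 ^ j` cubes of
side `b` along the shell, each contributing `b` times the energy, and comparing their measures with
that of the hole costs `A ^ j` (`enorm_layerAverage_sub_corner_le`). Hence a factor `(2 * A) ^ j`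
for the gradient; the function itself needs no chain and pays only `A ^ j`. The chain goes around
the shell, which is where `n ≥ 2` is essential.

For a test function `φ` the filled function `F` satisfies `|F - φ| ≤ K * depth` near the boundary
and has bounded gradient. Passing from `φ` to `F` in ever thinner layers therefore approximates the
extension by smooth functions (`IsCollar.hasSobolevGradient_extension`). An element of the Sobolev
space of the closed ring is a limit on the ring of test functions, so linearity, the two bounds and
completeness of `L^p` give the general case.

The gradient bound concerns arbitrary gradients of `u` and `Eu`, so gradients must be unique
(`HasSobolevGradient.ae_eq`). If `φ_i → 0` and `∇φ_i → v`, Poincaré for `φ_i - ⟪q, ·⟫` shows that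
`‖q‖` is at most a constant times the `L^p` mean of `v - q` on every small cube. Lebesgue
differentiation gives `‖q‖ ≤ C ‖v x - q‖` almost everywhere, and `q = v x` gives `v x = 0`. -/

namespace WeightedSobolev

/-! ### The maximum norm. -/

/-- The maximum norm on `ℝⁿ`. -/
noncomputable def supNorm {n : ℕ} (x : Eucl n) : ℝ := ‖x.ofLp‖

section SupNorm

variable {n : ℕ}

theorem supNorm_nonneg (x : Eucl n) : 0 ≤ supNorm x := norm_nonneg _

@[simp] theorem supNorm_zero : supNorm (0 : Eucl n) = 0 := by simp [supNorm]

theorem supNorm_neg (x : Eucl n) : supNorm (-x) = supNorm x := by simp [supNorm]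

theorem supNorm_add_le (x y : Eucl n) : supNorm (x + y) ≤ supNorm x + supNorm y := by
  simpa [supNorm] using norm_add_le x.ofLp y.ofLp

theorem supNorm_sub_comm (x y : Eucl n) : supNorm (x - y) = supNorm (y - x) := by
  rw [← supNorm_neg, neg_sub]

theorem supNorm_sub_le (x y z : Eucl n) : supNorm (x - z) ≤ supNorm (x - y) + supNorm (y - z) := by
  simpa using supNorm_add_le (x - y) (y - z)

theorem supNorm_smul (t : ℝ) (x : Eucl n) : supNorm (t • x) = |t| * supNorm x := by
  simp [supNorm, norm_smul]

theorem abs_apply_le_supNorm (x : Eucl n) (i : Fin n) : |x i| ≤ supNorm x :=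
  norm_le_pi_norm x.ofLp i

theorem supNorm_le_iff {x : Eucl n} {r : ℝ} (hr : 0 ≤ r) : supNorm x ≤ r ↔ ∀ i, |x i| ≤ r :=
  pi_norm_le_iff_of_nonneg hr

theorem supNorm_lt_iff {x : Eucl n} {r : ℝ} (hr : 0 < r) : supNorm x < r ↔ ∀ i, |x i| < r :=
  pi_norm_lt_iff hr

theorem lt_supNorm_iff {x : Eucl n} {r : ℝ} (hr : 0 ≤ r) : r < supNorm x ↔ ∃ i, r < |x i| := by
  simpa using (supNorm_le_iff (x := x) hr).not

theorem supNorm_le_norm (x : Eucl n) : supNorm x ≤ ‖x‖ :=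
  (supNorm_le_iff (norm_nonneg _)).2 fun i => PiLp.norm_apply_le x i

theorem norm_le_mul_supNorm (x : Eucl n) : ‖x‖ ≤ n * supNorm x := by
  rcases Nat.eq_zero_or_pos n with rfl | hn
  · simp [Subsingleton.elim x 0]
  rw [EuclideanSpace.norm_eq]
  refine Real.sqrt_le_iff.2 ⟨mul_nonneg (by positivity) (supNorm_nonneg x), ?_⟩
  calc ∑ i, ‖x i‖ ^ 2 ≤ ∑ _i : Fin n, supNorm x ^ 2 :=
        Finset.sum_le_sum fun i _ => by
          have := abs_apply_le_supNorm x i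
          rw [Real.norm_eq_abs]
          gcongr
    _ = n * supNorm x ^ 2 := by simp
    _ ≤ (n * supNorm x) ^ 2 := by
        rw [mul_pow]
        have : (1 : ℝ) ≤ n := by exact_mod_cast hn
        have h2 := sq_nonneg (supNorm x)
        have h1 : (n : ℝ) ≤ n ^ 2 := by nlinarith
        gcongr

theorem continuous_supNorm : Continuous (supNorm : Eucl n → ℝ) :=
  continuous_norm.comp (PiLp.continuous_ofLp _ _)

end SupNorm

/-! ### Cubes as balls of the maximum norm. -/

section Cubes

variable {n : ℕ}

theorem mem_cube_iff {c x : Eucl n} {ℓ : ℝ} (hℓ : 0 < ℓ) :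
    x ∈ cube c ℓ ↔ supNorm (x - c) < ℓ / 2 := by
  rw [supNorm_lt_iff (by positivity)]
  rfl

theorem mem_cube_self (c : Eucl n) {ℓ : ℝ} (hℓ : 0 < ℓ) : c ∈ cube c ℓ := by
  simp [mem_cube_iff hℓ, hℓ]

theorem mem_cubeRing_iff {c x : Eucl n} {ℓ α : ℝ} (hℓ : 0 < ℓ) (hα : α < 1) :
    x ∈ cubeRing c ℓ α ↔
      supNorm (x - c) < ℓ / 2 ∧ (1 - α) * ℓ / 2 < supNorm (x - c) := by
  have : 0 ≤ (1 - α) * ℓ / 2 := by have := sub_pos.2 hα; positivity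
  rw [lt_supNorm_iff this, ← mem_cube_iff hℓ]
  rfl

theorem cube_subset_cube {c c' : Eucl n} {ℓ ℓ' : ℝ} (hℓ : 0 < ℓ) (hℓ' : 0 < ℓ')
    (h : supNorm (c - c') + ℓ / 2 ≤ ℓ' / 2) : cube c ℓ ⊆ cube c' ℓ' := by
  intro x hx
  rw [mem_cube_iff hℓ] at hx
  rw [mem_cube_iff hℓ']
  have := supNorm_sub_le x c c'
  linarith

theorem measurableSet_cube (c : Eucl n) (ℓ : ℝ) : MeasurableSet (cube c ℓ) :=
  (isOpen_cube c ℓ).measurableSet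

theorem cube_subset_closedBall (c : Eucl n) {ℓ : ℝ} (hℓ : 0 < ℓ) :
    cube c ℓ ⊆ Metric.closedBall c (n * (ℓ / 2)) := by
  intro x hx
  rw [mem_cube_iff hℓ] at hx
  rw [mem_closedBall_iff_norm]
  refine (norm_le_mul_supNorm _).trans ?_
  gcongr

theorem isBounded_cube (c : Eucl n) {ℓ : ℝ} (hℓ : 0 < ℓ) : Bornology.IsBounded (cube c ℓ) :=
  Metric.isBounded_closedBall.subset (cube_subset_closedBall c hℓ)

theorem diam_cube_le (c : Eucl n) {ℓ : ℝ} (hℓ : 0 < ℓ) : Metric.diam (cube c ℓ) ≤ n * ℓ := by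
  refine (Metric.diam_mono (cube_subset_closedBall c hℓ) Metric.isBounded_closedBall).trans ?_
  refine (Metric.diam_closedBall (by positivity)).trans (le_of_eq ?_)
  ring

theorem convex_cube (c : Eucl n) {ℓ : ℝ} : Convex ℝ (cube c ℓ) := by
  have : cube c ℓ = ⋂ i, (fun x : Eucl n => x i) ⁻¹' Metric.ball (c i) (ℓ / 2) := by
    ext x
    simp [cube, Real.dist_eq]
  rw [this]
  exact convex_iInter fun i => (convex_ball _ _).is_linear_preimage ⟨fun _ _ => rfl, fun _ _ => rfl⟩

end Cubes

/-! ### Comparison of measures of cubes. -/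

section Doubling

variable {n : ℕ} {μ : Measure (Eucl n)} {A : ℝ≥0}

theorem IsDoubling.measure_pos (h : IsDoubling μ A) (c : Eucl n) {ℓ : ℝ} (hℓ : 0 < ℓ) :
    0 < μ (cube c ℓ) := (h.2 c ℓ hℓ).1

theorem IsDoubling.measure_ne_zero (h : IsDoubling μ A) (c : Eucl n) {ℓ : ℝ} (hℓ : 0 < ℓ) :
    μ (cube c ℓ) ≠ 0 := (h.measure_pos c hℓ).ne'

theorem IsDoubling.measure_ne_top (h : IsDoubling μ A) (c : Eucl n) {ℓ : ℝ} (hℓ : 0 < ℓ) :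
    μ (cube c ℓ) ≠ ⊤ := (h.2 c ℓ hℓ).2.ne

theorem IsDoubling.measure_cube_two_pow_mul_le (h : IsDoubling μ A) (c : Eucl n) {ℓ : ℝ}
    (hℓ : 0 < ℓ) (k : ℕ) : μ (cube c (2 ^ k * ℓ)) ≤ (A : ℝ≥0∞) ^ k * μ (cube c ℓ) := by
  induction k with
  | zero => simp
  | succ k ih =>
    calc μ (cube c (2 ^ (k + 1) * ℓ)) = μ (cube c (2 * (2 ^ k * ℓ))) := by ring_nf
      _ ≤ A * μ (cube c (2 ^ k * ℓ)) := h.1 c _ (by positivity)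
      _ ≤ A * (A ^ k * μ (cube c ℓ)) := by gcongr
      _ = _ := by ring

/-- All later comparisons of measures of cubes are read off from this: `k` counts the doublings
after which the second cube swallows the first. -/
theorem IsDoubling.measure_cube_le (h : IsDoubling μ A) {c c' : Eucl n} {ℓ ℓ' : ℝ}
    (hℓ : 0 < ℓ) (hℓ' : 0 < ℓ') (k : ℕ) (hk : supNorm (c - c') + ℓ / 2 ≤ 2 ^ k * (ℓ' / 2)) :
    μ (cube c ℓ) ≤ (A : ℝ≥0∞) ^ k * μ (cube c' ℓ') :=
  (measure_mono (cube_subset_cube hℓ (by positivity) (by linarith))).trans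
    (h.measure_cube_two_pow_mul_le c' hℓ' k)

theorem IsDoubling.one_le (h : IsDoubling μ A) : 1 ≤ A := by
  have h1 := h.measure_cube_le (c := 0) (c' := 0) one_pos one_pos 1 (by norm_num)
  rw [pow_one] at h1
  have h0 := h.measure_ne_zero 0 one_pos
  have ht := h.measure_ne_top 0 one_pos
  by_contra hA
  push Not at hA
  have : (A : ℝ≥0∞) * μ (cube 0 1) < 1 * μ (cube 0 1) :=
    (ENNReal.mul_lt_mul_iff_left h0 ht).2 (by exact_mod_cast hA)
  rw [one_mul] at this
  exact absurd h1 (not_le.2 this)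

end Doubling

/-! ### Local finiteness and null boundaries. -/

section WeightMeasure

variable {n : ℕ} {p : ℝ} {w : Eucl n → ℝ} {A B : ℝ≥0}

theorem IsDoubling.isLocallyFiniteMeasure {μ : Measure (Eucl n)} (h : IsDoubling μ A) :
    IsLocallyFiniteMeasure μ :=
  ⟨fun x => ⟨cube x 1, (isOpen_cube x 1).mem_nhds (mem_cube_self x one_pos),
    (h.2 x 1 one_pos).2⟩⟩

theorem weightMeasure_absolutelyContinuous (w : Eucl n → ℝ) : weightMeasure w ≪ volume :=
  withDensity_absolutelyContinuous _ _

/-- A convex set has Lebesgue null frontier, and `w dx` inherits this. It makes the boundary of the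
hole negligible, and is the only use of the density beyond doubling and Poincaré. -/
theorem weightMeasure_frontier_cube (w : Eucl n → ℝ) (c : Eucl n) (ℓ : ℝ) :
    weightMeasure w (frontier (cube c ℓ)) = 0 :=
  weightMeasure_absolutelyContinuous w ((convex_cube c).addHaar_frontier volume)

end WeightMeasure


/-! ### Averages of nonnegative functions and Jensen's inequality. -/

section Averages

variable {X : Type*} [MeasurableSpace X] {μ : Measure X} {s t : Set X}

theorem setLAverage_eq_inv_mul (f : X → ℝ≥0∞) (s : Set X) :
    ⨍⁻ x in s, f x ∂μ = (μ s)⁻¹ * ∫⁻ x in s, f x ∂μ := by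
  rw [setLAverage_eq, ENNReal.div_eq_inv_mul]

/-- The normalized restriction of `μ` to `s`. -/
noncomputable def normalizedRestrict (μ : Measure X) (s : Set X) : Measure X :=
  (μ s)⁻¹ • μ.restrict s

theorem setLAverage_eq_lintegral_normalizedRestrict (f : X → ℝ≥0∞) (s : Set X) :
    ⨍⁻ x in s, f x ∂μ = ∫⁻ x, f x ∂normalizedRestrict μ s := setLAverage_eq' _ f s

theorem isProbabilityMeasure_normalizedRestrict (h0 : μ s ≠ 0) (ht : μ s ≠ ⊤) :
    IsProbabilityMeasure (normalizedRestrict μ s) :=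
  ⟨by simp [normalizedRestrict, ENNReal.inv_mul_cancel h0 ht]⟩

theorem eLpNorm_normalizedRestrict {F : Type*} [NormedAddCommGroup F] {p : ℝ} (hp : 1 ≤ p)
    (f : X → F) : eLpNorm f (ENNReal.ofReal p) (normalizedRestrict μ s) =
      (⨍⁻ x in s, ‖f x‖ₑ ^ p ∂μ) ^ (1 / p) := by
  have hp0 : 0 < p := by linarith
  rw [eLpNorm_eq_lintegral_rpow_enorm_toReal (by simpa using hp0) ENNReal.ofReal_ne_top,
    ENNReal.toReal_ofReal hp0.le, setLAverage_eq_lintegral_normalizedRestrict]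

/-- Jensen's inequality for averages of `p`-th powers. -/
theorem setLAverage_le_rpow {F : Type*} [NormedAddCommGroup F] {p : ℝ} (hp : 1 ≤ p) (h0 : μ s ≠ 0)
    (ht : μ s ≠ ⊤) {f : X → F} (hf : AEStronglyMeasurable f (μ.restrict s)) :
    ⨍⁻ x in s, ‖f x‖ₑ ∂μ ≤ (⨍⁻ x in s, ‖f x‖ₑ ^ p ∂μ) ^ (1 / p) := by
  have := isProbabilityMeasure_normalizedRestrict h0 ht
  rw [← eLpNorm_normalizedRestrict hp, setLAverage_eq_lintegral_normalizedRestrict,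
    ← eLpNorm_one_eq_lintegral_enorm]
  exact eLpNorm_le_eLpNorm_of_exponent_le (by simpa using hp) (hf.smul_measure _)

theorem _root_.ENNReal.inv_le_mul_inv {a b D : ℝ≥0∞} (h : b ≤ D * a) (h0 : b ≠ 0) (ht : b ≠ ⊤) :
    a⁻¹ ≤ D * b⁻¹ := by
  rw [← div_eq_mul_inv, ENNReal.le_div_iff_mul_le (Or.inl h0) (Or.inl ht)]
  calc a⁻¹ * b ≤ a⁻¹ * (D * a) := by gcongr
    _ = D * (a⁻¹ * a) := by ring
    _ ≤ D * 1 := by gcongr; exact ENNReal.inv_mul_le_one a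
    _ = D := mul_one D

theorem setLAverage_le_mul_of_subset {f : X → ℝ≥0∞} (hst : s ⊆ t) {D : ℝ≥0∞}
    (hD : μ t ≤ D * μ s) (h0 : μ t ≠ 0) (ht : μ t ≠ ⊤) :
    ⨍⁻ x in s, f x ∂μ ≤ D * ⨍⁻ x in t, f x ∂μ := by
  rw [setLAverage_eq_inv_mul, setLAverage_eq_inv_mul, ← mul_assoc]
  gcongr
  exact ENNReal.inv_le_mul_inv hD h0 ht

end Averages

/-! ### Uniqueness of the Sobolev gradient. -/

section Uniqueness

variable {n : ℕ} {p : ℝ} {μ : Measure (Eucl n)} {A B : ℝ≥0}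

theorem gradient_sub_inner {φ : Eucl n → ℝ} {x : Eucl n} (h : DifferentiableAt ℝ φ x) (q : Eucl n) :
    gradient (fun y => φ y - inner ℝ q y) x = gradient φ x - q := by
  have h2 : HasFDerivAt (fun y : Eucl n => inner ℝ q y) (innerSL ℝ q) x :=
    (innerSL ℝ q).hasFDerivAt
  rw [gradient, (h.hasFDerivAt.fun_sub h2).fderiv, map_sub, gradient]
  congr 1
  exact (InnerProductSpace.toDual ℝ (Eucl n)).symm_apply_apply q

/-- A linear function oscillates on a cube proportionally to its slope. -/
theorem IsDoubling.norm_mul_le_setLAverage (h : IsDoubling μ A) (hn : 0 < n) (x₀ q : Eucl n)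
    {r : ℝ} (hr : 0 < r) (m : ℝ) :
    ENNReal.ofReal (‖q‖ * r / 8) ≤
      (A : ℝ≥0∞) ^ (n + 3) * ⨍⁻ x in cube x₀ r, ‖inner ℝ q x - m‖ₑ ∂μ := by
  have hn' : (0 : ℝ) < n := by exact_mod_cast hn
  -- A cube of this side lies in a Euclidean ball of radius `r / 8`. Around `x₀ + (r / 4) e`, with
  -- `e` parallel to `q`, the linear function then stays at least `‖q‖ (r / 4 - r / 8)` beyond its
  -- value at `x₀`.
  set s : ℝ := r / (4 * n) with hs
  have hs0 : 0 < s := by positivity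
  have key : ∀ e : Eucl n, ‖e‖ ≤ 1 → (∀ x ∈ cube (x₀ + (r / 4) • e) s,
      ‖q‖ * r / 8 ≤ |inner ℝ q x - m|) → ENNReal.ofReal (‖q‖ * r / 8) ≤
      (A : ℝ≥0∞) ^ (n + 3) * ⨍⁻ x in cube x₀ r, ‖inner ℝ q x - m‖ₑ ∂μ := by
    intro e he hx
    have hsn : supNorm ((r / 4) • e) ≤ r / 4 := by
      rw [supNorm_smul, abs_of_pos (by positivity)]
      have := (supNorm_le_norm e).trans he
      nlinarith
    have hsr : s ≤ r / 4 := by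
      rw [hs, div_le_div_iff₀ (by positivity) (by positivity)]
      have : (1 : ℝ) ≤ n := by exact_mod_cast hn
      nlinarith
    have hsub : cube (x₀ + (r / 4) • e) s ⊆ cube x₀ r :=
      cube_subset_cube hs0 hr (by rw [add_sub_cancel_left]; linarith)
    have hD : μ (cube x₀ r) ≤ (A : ℝ≥0∞) ^ (n + 3) * μ (cube (x₀ + (r / 4) • e) s) := by
      refine h.measure_cube_le hr hs0 _ ?_
      rw [sub_add_cancel_left, supNorm_neg]
      have h2 : (n : ℝ) ≤ 2 ^ n := by exact_mod_cast Nat.lt_two_pow_self.le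
      have : r ≤ 2 ^ (n + 3) * (s / 2) := by
        calc r = n * 8 * (s / 2) := by rw [hs]; field_simp; norm_num
          _ ≤ 2 ^ n * 8 * (s / 2) := by gcongr
          _ = _ := by ring
      linarith
    refine le_trans ?_ (setLAverage_le_mul_of_subset hsub hD (h.measure_ne_zero _ hr)
      (h.measure_ne_top _ hr))
    rw [setLAverage_eq, ENNReal.le_div_iff_mul_le (Or.inl (h.measure_ne_zero _ hs0))
      (Or.inl (h.measure_ne_top _ hs0)), ← setLIntegral_const]
    refine setLIntegral_mono' (measurableSet_cube _ _) fun x hx' => ?_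
    rw [Real.enorm_eq_ofReal_abs]
    exact ENNReal.ofReal_le_ofReal (hx x hx')
  rcases eq_or_ne q 0 with rfl | hq
  · simp
  have hq' : 0 < ‖q‖ := norm_pos_iff.2 hq
  set e : Eucl n := ‖q‖⁻¹ • q with he
  have he1 : ‖e‖ = 1 := by rw [he, norm_smul, norm_inv, norm_norm, inv_mul_cancel₀ hq'.ne']
  have hqe : inner ℝ q e = ‖q‖ := by
    rw [he, inner_smul_right, real_inner_self_eq_norm_sq]
    field_simp
  have hball : ∀ e' x : Eucl n, x ∈ cube (x₀ + (r / 4) • e') s →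
      |inner ℝ q x - inner ℝ q x₀ - (r / 4) * inner ℝ q e'| ≤ ‖q‖ * (r / 8) := by
    intro e' x hx
    have h1 := cube_subset_closedBall _ hs0 hx
    rw [mem_closedBall_iff_norm] at h1
    have h2 : inner ℝ q x - inner ℝ q x₀ - (r / 4) * inner ℝ q e' =
        inner ℝ q (x - (x₀ + (r / 4) • e')) := by
      rw [inner_sub_right, inner_add_right, inner_smul_right]; ring
    rw [h2]
    refine (abs_real_inner_le_norm _ _).trans ?_
    have : (n : ℝ) * (s / 2) = r / 8 := by rw [hs]; field_simp; norm_num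
    rw [this] at h1
    gcongr
  -- The sign of `e` is chosen so that the linear function moves away from `m`.
  rcases le_total m (inner ℝ q x₀) with hm | hm
  · refine key e he1.le fun x hx => ?_
    have := abs_le.1 (hball e x hx)
    rw [hqe] at this
    refine le_trans ?_ (le_abs_self _)
    linarith [this.1]
  · refine key (-e) (by rw [norm_neg, he1]) fun x hx => ?_
    have := abs_le.1 (hball (-e) x hx)
    rw [inner_neg_right, hqe] at this
    refine le_trans ?_ (neg_le_abs _)
    linarith [this.2]

/-- Passing to the limit in the Poincaré inequality for `φ_i - ⟪q, ·⟫`, where `φ_i → 0`. -/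
theorem HasSobolevGradient.norm_le_of_zero (hn : 0 < n) (hp : 1 ≤ p) (hd : IsDoubling μ A)
    (hP : SatisfiesPoincare p μ B) {Ω : Set (Eucl n)} (hΩ : IsOpen Ω) {v : Eucl n → Eucl n}
    (h : HasSobolevGradient p μ Ω (fun _ => 0) v) (q x₀ : Eucl n) {r : ℝ} (hr : 0 < r)
    (hsub : closure (cube x₀ r) ⊆ Ω) :
    ENNReal.ofReal (‖q‖ * r / 8) ≤ (A : ℝ≥0∞) ^ (n + 3) * (B * ENNReal.ofReal (n * r) *
      (⨍⁻ x in cube x₀ r, ‖v x - q‖ₑ ^ p ∂μ) ^ (1 / p)) := by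
  obtain ⟨-, hv, φ, hφ, ht, hg⟩ := h
  have hμ0 := hd.measure_ne_zero x₀ hr
  have hμt := hd.measure_ne_top x₀ hr
  set ν := normalizedRestrict μ (cube x₀ r) with hν
  have := isProbabilityMeasure_normalizedRestrict hμ0 hμt
  have hcube : cube x₀ r ⊆ Ω := subset_closure.trans hsub
  have hms := measurableSet_cube x₀ r
  have hp' : (1 : ℝ≥0∞) ≤ ENNReal.ofReal p := by simpa using hp
  have hdiff : ∀ i, ∀ x ∈ cube x₀ r, DifferentiableAt ℝ (φ i) x := fun i x hx =>
    ((hφ i).contDiffAt (hΩ.mem_nhds (hcube hx))).differentiableAt (by simp)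
  have hc : ∀ i, AEStronglyMeasurable (φ i) ν := fun i =>
    (((hφ i).continuousOn.mono hcube).aestronglyMeasurable hms).smul_measure _
  have hc' : ∀ i, AEStronglyMeasurable (gradient (φ i)) ν := fun i =>
    ((((InnerProductSpace.toDual ℝ (Eucl n)).symm.continuous.comp_continuousOn
      ((hφ i).continuousOn_fderiv_of_isOpen hΩ (by simp))).mono hcube).aestronglyMeasurable
      hms).smul_measure _
  have hvν : AEStronglyMeasurable v ν :=
    (hv.1.mono_measure (Measure.restrict_mono_set μ hcube)).smul_measure _
  have hlim : ∀ {F : Type} [NormedAddCommGroup F] (f : ℕ → Eucl n → F),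
      Tendsto (fun i => eLpNorm (f i) (ENNReal.ofReal p) (μ.restrict Ω)) atTop (𝓝 0) →
      Tendsto (fun i => eLpNorm (f i) (ENNReal.ofReal p) ν) atTop (𝓝 0) := by
    intro F _ f hf
    have hc1 : ((μ (cube x₀ r))⁻¹) ^ (1 / ENNReal.ofReal p).toReal ≠ ⊤ :=
      ENNReal.rpow_ne_top_of_nonneg (by positivity) (ENNReal.inv_ne_top.2 hμ0)
    have h1 := ENNReal.Tendsto.const_mul (a := ((μ (cube x₀ r))⁻¹) ^ (1 / ENNReal.ofReal p).toReal)
      hf (Or.inr hc1)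
    rw [mul_zero] at h1
    refine tendsto_of_tendsto_of_tendsto_of_le_of_le tendsto_const_nhds h1
      (fun _ => zero_le) fun i => ?_
    rw [hν, normalizedRestrict, eLpNorm_smul_measure_of_ne_top ENNReal.ofReal_ne_top]
    exact mul_le_mul_right (eLpNorm_mono_measure _ (Measure.restrict_mono_set μ hcube)) _
  have ht' := hlim _ ht
  have hg' := hlim _ hg
  simp only [sub_zero] at ht'
  have hbound : ∀ i, ENNReal.ofReal (‖q‖ * r / 8) ≤ (A : ℝ≥0∞) ^ (n + 3) *
      (B * ENNReal.ofReal (n * r) *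
        ((⨍⁻ x in cube x₀ r, ‖v x - q‖ₑ ^ p ∂μ) ^ (1 / p) +
          eLpNorm (fun x => gradient (φ i) x - v x) (ENNReal.ofReal p) ν) +
        eLpNorm (fun x => φ i x) (ENNReal.ofReal p) ν) := by
    intro i
    set ψ : Eucl n → ℝ := fun x => φ i x - inner ℝ q x with hψ
    have hψs : ContDiffOn ℝ ∞ ψ Ω := (hφ i).sub (innerSL ℝ q).contDiff.contDiffOn
    -- Poincaré is assumed for bounded functions only, which is why the closed cube has to lie in
    -- `Ω`.
    obtain ⟨M, hM⟩ := ((isBounded_cube x₀ hr).isCompact_closure).exists_bound_of_continuousOn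
      (hψs.continuousOn.mono hsub)
    have h1 := hP.2 x₀ r hr ψ (hψs.mono hcube) ⟨M, fun x hx => hM x (subset_closure hx)⟩
    set m := ⨍ y in cube x₀ r, ψ y ∂μ
    refine (hd.norm_mul_le_setLAverage hn x₀ q hr (-m)).trans ?_
    gcongr
    have h2 : ⨍⁻ x in cube x₀ r, ‖inner ℝ q x - -m‖ₑ ∂μ ≤
        ⨍⁻ x in cube x₀ r, ‖ψ x - m‖ₑ ∂μ + ⨍⁻ x in cube x₀ r, ‖φ i x‖ₑ ∂μ := by
      simp only [setLAverage_eq_lintegral_normalizedRestrict]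
      rw [← lintegral_add_right' _ (hc i).enorm]
      refine lintegral_mono fun x => ?_
      have : inner ℝ q x - -m = φ i x - (ψ x - m) := by simp only [hψ]; ring
      rw [this, add_comm]
      exact enorm_sub_le
    refine h2.trans (add_le_add (h1.trans ?_) ?_)
    · gcongr
      · exact diam_cube_le x₀ hr
      · rw [← eLpNorm_normalizedRestrict hp, ← eLpNorm_normalizedRestrict hp, add_comm]
        have h3 : eLpNorm (gradient ψ) (ENNReal.ofReal p) ν =
            eLpNorm ((fun x => gradient (φ i) x - v x) + fun x => v x - q) (ENNReal.ofReal p) ν := by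
          refine eLpNorm_congr_ae (Measure.ae_smul_measure ?_ _)
          filter_upwards [ae_restrict_mem hms] with x hx
          rw [hψ, gradient_sub_inner (hdiff i x hx)]
          simp
        rw [← hν, h3]
        exact eLpNorm_add_le ((hc' i).sub hvν) (hvν.sub aestronglyMeasurable_const) hp'
    · exact (setLAverage_le_rpow hp hμ0 hμt
        (((hφ i).continuousOn.mono hcube).aestronglyMeasurable hms)).trans
        (eLpNorm_normalizedRestrict hp _).ge
  refine ge_of_tendsto' (x := atTop) ?_ hbound
  have hA : ((A : ℝ≥0∞) ^ (n + 3)) ≠ ⊤ := by finiteness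
  have hB : (B : ℝ≥0∞) * ENNReal.ofReal (n * r) ≠ ⊤ := by finiteness
  have h5 := ENNReal.Tendsto.const_mul ((ENNReal.Tendsto.const_mul
    (Tendsto.const_add ((⨍⁻ x in cube x₀ r, ‖v x - q‖ₑ ^ p ∂μ) ^ (1 / p)) hg') (Or.inr hB)).add ht')
    (Or.inr hA)
  simpa using h5

/-- At almost every point `x`, the `p`-th power of `‖v - q‖` is the limit of its averages over small
cubes, up to the doubling constant. -/
theorem HasSobolevGradient.ae_norm_le_of_zero (hn : 0 < n) (hp : 1 ≤ p) (hd : IsDoubling μ A)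
    (hP : SatisfiesPoincare p μ B) {Ω : Set (Eucl n)} (hΩ : IsOpen Ω) {v : Eucl n → Eucl n}
    (h : HasSobolevGradient p μ Ω (fun _ => 0) v) (q : Eucl n) :
    ∀ᵐ x ∂μ, x ∈ Ω → ENNReal.ofReal (‖q‖ / 8) ≤ (A : ℝ≥0∞) ^ (n + 3) * (B * n *
      ((A : ℝ≥0∞) ^ (n + 1) * ‖v x - q‖ₑ ^ p) ^ (1 / p)) := by
  have hloc := hd.isLocallyFiniteMeasure
  have hp0 : 0 < p := by linarith
  have hn' : (0 : ℝ) < n := by exact_mod_cast hn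
  -- The constant `q` need not be in `L^p(Ω)`; cutting to balls makes the function integrable, as
  -- the differentiation theorem requires.
  let g : ℕ → Eucl n → ℝ≥0∞ := fun N =>
    (Ω ∩ Metric.ball 0 N).indicator fun x => ‖v x - q‖ₑ ^ p
  have hmsN : ∀ N : ℕ, MeasurableSet (Ω ∩ Metric.ball (0 : Eucl n) N) := fun N =>
    hΩ.measurableSet.inter measurableSet_ball
  have hmem : ∀ N : ℕ, MemLp (fun x => v x - q) (ENNReal.ofReal p)
      (μ.restrict (Ω ∩ Metric.ball 0 N)) := by
    intro N
    have : IsFiniteMeasure (μ.restrict (Ω ∩ Metric.ball (0 : Eucl n) N)) :=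
      ⟨by rw [Measure.restrict_apply_univ]
          exact (measure_mono Set.inter_subset_right).trans_lt measure_ball_lt_top⟩
    exact (h.2.1.mono_measure (Measure.restrict_mono_set μ Set.inter_subset_left)).sub
      (memLp_const q)
  have hgm : ∀ N, AEMeasurable (g N) μ := fun N =>
    (aemeasurable_indicator_iff (hmsN N)).2 ((hmem N).1.enorm.pow_const p)
  have hgt : ∀ N, ∫⁻ x, g N x ∂μ ≠ ⊤ := by
    intro N
    rw [lintegral_indicator (hmsN N)]
    have := lintegral_rpow_enorm_lt_top_of_eLpNorm_lt_top (by simpa using hp0)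
      ENNReal.ofReal_ne_top (hmem N).2
    rw [ENNReal.toReal_ofReal hp0.le] at this
    exact this.ne
  have hae : ∀ᵐ x ∂μ, ∀ N, Tendsto (fun a => (∫⁻ y in a, g N y ∂μ) / μ a)
      ((Besicovitch.vitaliFamily μ).filterAt x) (𝓝 (g N x)) :=
    ae_all_iff.2 fun N => VitaliFamily.ae_tendsto_lintegral_div _ (hgm N) (hgt N)
  filter_upwards [hae] with x hx hxΩ
  obtain ⟨N, hN⟩ := exists_nat_gt ‖x‖
  have hxN : x ∈ Ω ∩ Metric.ball (0 : Eucl n) N := ⟨hxΩ, by simpa using hN⟩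
  have hlim := (hx N).comp (Besicovitch.tendsto_filterAt μ x)
  have hgx : g N x = ‖v x - q‖ₑ ^ p := Set.indicator_of_mem hxN _
  rw [hgx] at hlim
  have hA : ((A : ℝ≥0∞) ^ (n + 3)) ≠ ⊤ := by finiteness
  have hA' : ((A : ℝ≥0∞) ^ (n + 1)) ≠ ⊤ := by finiteness
  have hB : (B : ℝ≥0∞) * n ≠ ⊤ := by finiteness
  have hlim2 := ENNReal.Tendsto.const_mul (ENNReal.Tendsto.const_mul
    ((ENNReal.continuous_rpow_const (y := 1 / p)).continuousAt.tendsto.comp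
    (ENNReal.Tendsto.const_mul hlim (Or.inr hA'))) (Or.inr hB)) (Or.inr hA)
  refine ge_of_tendsto hlim2 ?_
  obtain ⟨ε, hε, hεs⟩ := Metric.isOpen_iff.1 (hΩ.inter Metric.isOpen_ball) x hxN
  filter_upwards [Ioo_mem_nhdsGT hε] with R hR
  -- Differentiation is along closed balls. With this radius the ball contains the cube of side `r`
  -- and lies in the cube of side `2 ^ (n + 1) * r`, so doubling passes from one average to the
  -- other.
  obtain ⟨r, hr, rfl⟩ : ∃ r : ℝ, 0 < r ∧ R = n * (r / 2) :=
    ⟨2 * R / n, by have := hR.1; positivity, by field_simp⟩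
  have hball : Metric.closedBall x (n * (r / 2)) ⊆ Ω ∩ Metric.ball 0 N :=
    (Metric.closedBall_subset_ball hR.2).trans hεs
  have hcl : closure (cube x r) ⊆ Metric.closedBall x (n * (r / 2)) :=
    closure_minimal (cube_subset_closedBall x hr) Metric.isClosed_closedBall
  have h1 := h.norm_le_of_zero hn hp hd hP hΩ q x hr
    (hcl.trans (hball.trans Set.inter_subset_left))
  have hsub : Metric.closedBall x (n * (r / 2)) ⊆ cube x (2 ^ (n + 1) * r) := by
    intro y hy
    rw [mem_cube_iff (by positivity)]
    rw [mem_closedBall_iff_norm] at hy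
    refine ((supNorm_le_norm _).trans hy).trans_lt ?_
    have h2 : (n : ℝ) < 2 ^ n := by exact_mod_cast Nat.lt_two_pow_self
    rw [pow_succ]
    nlinarith
  have hDoub : μ (Metric.closedBall x (n * (r / 2))) ≤ (A : ℝ≥0∞) ^ (n + 1) * μ (cube x r) :=
    (measure_mono hsub).trans (hd.measure_cube_two_pow_mul_le x hr _)
  have hb0 : μ (Metric.closedBall x (n * (r / 2))) ≠ 0 :=
    (lt_of_lt_of_le (hd.measure_pos x hr) (measure_mono (cube_subset_closedBall x hr))).ne'
  have h2 : ⨍⁻ y in cube x r, ‖v y - q‖ₑ ^ p ∂μ ≤ (A : ℝ≥0∞) ^ (n + 1) *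
      ((∫⁻ y in Metric.closedBall x (n * (r / 2)), g N y ∂μ) /
        μ (Metric.closedBall x (n * (r / 2)))) := by
    refine (setLAverage_le_mul_of_subset (cube_subset_closedBall x hr) hDoub hb0
      measure_closedBall_lt_top.ne).trans ?_
    rw [setLAverage_eq]
    have h4 : ∫⁻ y in Metric.closedBall x (n * (r / 2)), ‖v y - q‖ₑ ^ p ∂μ ≤
        ∫⁻ y in Metric.closedBall x (n * (r / 2)), g N y ∂μ :=
      setLIntegral_mono' Metric.isClosed_closedBall.measurableSet fun y hy =>
        (Set.indicator_of_mem (hball hy) (fun x => ‖v x - q‖ₑ ^ p)).ge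
    gcongr
  have h3 := h1.trans (mul_le_mul_right (mul_le_mul_right
    (ENNReal.rpow_le_rpow h2 (by positivity : 0 ≤ 1 / p)) _) _)
  have hr0 : ENNReal.ofReal r ≠ 0 := by simpa using hr
  have e1 : ENNReal.ofReal (‖q‖ * r / 8) = ENNReal.ofReal r * ENNReal.ofReal (‖q‖ / 8) := by
    rw [← ENNReal.ofReal_mul hr.le]; congr 1; ring
  rw [e1, ENNReal.ofReal_mul hn'.le, ENNReal.ofReal_natCast] at h3
  -- The oscillation of the linear function and the diameter in Poincaré are both proportional to
  -- `r`, which cancels before the limit.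
  rw [← ENNReal.mul_le_mul_iff_right hr0 ENNReal.ofReal_ne_top]
  refine h3.trans (le_of_eq ?_)
  simp only [Function.comp]
  ring

/-- The inequality of `ae_norm_le_of_zero` holds off one null set for a countable dense set of `q`,
hence for all `q` by continuity; `q = v x` makes its right side vanish. -/
theorem HasSobolevGradient.ae_eq_zero_of_zero (hn : 0 < n) (hp : 1 ≤ p) (hd : IsDoubling μ A)
    (hP : SatisfiesPoincare p μ B) {Ω : Set (Eucl n)} (hΩ : IsOpen Ω) {v : Eucl n → Eucl n}
    (h : HasSobolevGradient p μ Ω (fun _ => 0) v) : v =ᵐ[μ.restrict Ω] fun _ => 0 := by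
  have hp0 : 0 < p := by linarith
  have hae : ∀ᵐ x ∂μ, ∀ k, x ∈ Ω → _ := ae_all_iff.2 fun k =>
    h.ae_norm_le_of_zero hn hp hd hP hΩ (TopologicalSpace.denseSeq (Eucl n) k)
  rw [EventuallyEq, ae_restrict_iff' hΩ.measurableSet]
  filter_upwards [hae] with x hx hxΩ
  have hcont : Continuous fun q : Eucl n => (A : ℝ≥0∞) ^ (n + 3) * (B * n *
      ((A : ℝ≥0∞) ^ (n + 1) * ‖v x - q‖ₑ ^ p) ^ (1 / p)) := by
    refine (ENNReal.continuous_const_mul (by finiteness)).comp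
      ((ENNReal.continuous_const_mul (by finiteness)).comp
      (ENNReal.continuous_rpow_const.comp
      ((ENNReal.continuous_const_mul (by finiteness)).comp
      (ENNReal.continuous_rpow_const.comp ?_))))
    fun_prop
  have hclosed : IsClosed {q : Eucl n | ENNReal.ofReal (‖q‖ / 8) ≤ (A : ℝ≥0∞) ^ (n + 3) *
      (B * n * ((A : ℝ≥0∞) ^ (n + 1) * ‖v x - q‖ₑ ^ p) ^ (1 / p))} :=
    isClosed_le (ENNReal.continuous_ofReal.comp (by fun_prop)) hcont
  have hall := (TopologicalSpace.denseRange_denseSeq (Eucl n)).closure_range ▸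
    closure_minimal (Set.range_subset_iff.2 fun k => hx k hxΩ) hclosed
  have := hall (Set.mem_univ (v x))
  simp only [Set.mem_ofPred_eq, sub_self, enorm_zero, ENNReal.zero_rpow_of_pos hp0, mul_zero,
    ENNReal.zero_rpow_of_pos (by positivity : 0 < 1 / p), nonpos_iff_eq_zero,
    ENNReal.ofReal_eq_zero] at this
  exact norm_le_zero_iff.1 (by linarith)

/-- The gradient of an element of `H^{1,p}(Ω; μ)` is unique up to null sets. -/
theorem HasSobolevGradient.ae_eq (hn : 0 < n) (hp : 1 ≤ p) (hd : IsDoubling μ A)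
    (hP : SatisfiesPoincare p μ B) {Ω : Set (Eucl n)} (hΩ : IsOpen Ω) {u : Eucl n → ℝ}
    {v v' : Eucl n → Eucl n} (h : HasSobolevGradient p μ Ω u v)
    (h' : HasSobolevGradient p μ Ω u v') : v =ᵐ[μ.restrict Ω] v' := by
  have h0 := h.add hp hΩ (h'.const_smul hΩ (-1))
  have h1 := HasSobolevGradient.ae_eq_zero_of_zero hn hp hd hP hΩ
    (h0.congr (Eventually.of_forall fun x => by simp : _ =ᵐ[μ.restrict Ω] fun _ => (0 : ℝ)))
  filter_upwards [h1] with x hx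
  simpa [← sub_eq_add_neg, sub_eq_zero] using hx

end Uniqueness

/-! ### A smooth distance to the boundary of the hole. -/

section Depth

variable {n : ℕ} {c x y : Eucl n} {a : ℝ}

/-- A smooth function comparable with the distance to the boundary of `cube c (2 * a)`. -/
noncomputable def depth (c : Eucl n) (a : ℝ) (x : Eucl n) : ℝ :=
  (∑ i, ((a - (x i - c i))⁻¹ + (a + (x i - c i))⁻¹))⁻¹

theorem mem_cube_two_mul_iff (ha : 0 < a) : x ∈ cube c (2 * a) ↔ supNorm (x - c) < a := by
  rw [mem_cube_iff (by positivity), mul_div_cancel_left₀ _ two_ne_zero]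

theorem abs_apply_sub_lt (hx : x ∈ cube c (2 * a)) (i : Fin n) : |x i - c i| < a := by
  simpa using hx i

theorem sub_apply_pos (hx : x ∈ cube c (2 * a)) (i : Fin n) : 0 < a - (x i - c i) :=
  sub_pos.2 ((le_abs_self _).trans_lt (abs_apply_sub_lt hx i))

theorem add_apply_pos (hx : x ∈ cube c (2 * a)) (i : Fin n) : 0 < a + (x i - c i) := by
  have := (neg_le_abs _).trans_lt (abs_apply_sub_lt hx i)
  linarith

theorem depth_inv (c : Eucl n) (a : ℝ) (x : Eucl n) :
    (depth c a x)⁻¹ = ∑ i, ((a - (x i - c i))⁻¹ + (a + (x i - c i))⁻¹) := inv_inv _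

theorem inv_add_inv_le_depth_inv (hx : x ∈ cube c (2 * a)) (i : Fin n) :
    (a - (x i - c i))⁻¹ + (a + (x i - c i))⁻¹ ≤ (depth c a x)⁻¹ := by
  rw [depth_inv]
  exact Finset.single_le_sum
    (f := fun i => (a - (x i - c i))⁻¹ + (a + (x i - c i))⁻¹) (fun j _ => by
    have := sub_apply_pos hx j
    have := add_apply_pos hx j
    positivity) (Finset.mem_univ i)

theorem inv_sub_le_depth_inv (hx : x ∈ cube c (2 * a)) (i : Fin n) :
    (a - (x i - c i))⁻¹ ≤ (depth c a x)⁻¹ :=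
  (le_add_of_nonneg_right (inv_nonneg.2 (add_apply_pos hx i).le)).trans
    (inv_add_inv_le_depth_inv hx i)

theorem inv_add_le_depth_inv (hx : x ∈ cube c (2 * a)) (i : Fin n) :
    (a + (x i - c i))⁻¹ ≤ (depth c a x)⁻¹ :=
  (le_add_of_nonneg_left (inv_nonneg.2 (sub_apply_pos hx i).le)).trans
    (inv_add_inv_le_depth_inv hx i)

theorem depth_pos (hn : 0 < n) (hx : x ∈ cube c (2 * a)) : 0 < depth c a x :=
  inv_pos.1 ((inv_pos.2 (sub_apply_pos hx ⟨0, hn⟩)).trans_le (inv_sub_le_depth_inv hx _))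

/-- The sum defining the inverse depth dominates the inverse distance to each face. -/
theorem supNorm_add_depth_le (hn : 0 < n) (hx : x ∈ cube c (2 * a)) :
    supNorm (x - c) + depth c a x ≤ a := by
  have hd := depth_pos hn hx
  have key : ∀ i, |(x - c) i| ≤ a - depth c a x := fun i => by
    have h1 := (inv_le_inv₀ (sub_apply_pos hx i) hd).1 (inv_sub_le_depth_inv hx i)
    have h2 := (inv_le_inv₀ (add_apply_pos hx i) hd).1 (inv_add_le_depth_inv hx i)
    rw [PiLp.sub_apply]
    exact abs_le.2 ⟨by linarith, by linarith⟩
  have := (supNorm_le_iff ((abs_nonneg _).trans (key ⟨0, hn⟩))).2 key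
  linarith

theorem depth_le (hn : 0 < n) (hx : x ∈ cube c (2 * a)) : depth c a x ≤ a := by
  have := supNorm_add_depth_le hn hx
  have := supNorm_nonneg (x - c)
  linarith

/-- Each of the `2 * n` terms of the inverse depth is at most the inverse distance to the nearest
face. -/
theorem le_supNorm_add_mul_depth (hn : 0 < n) (hx : x ∈ cube c (2 * a)) :
    a ≤ supNorm (x - c) + 2 * n * depth c a x := by
  have hd := depth_pos hn hx
  have hlt : 0 < a - supNorm (x - c) := by
    have := supNorm_add_depth_le hn hx; linarith
  have h1 : (depth c a x)⁻¹ ≤ 2 * n * (a - supNorm (x - c))⁻¹ := by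
    rw [depth_inv]
    calc _ ≤ ∑ _i : Fin n, 2 * (a - supNorm (x - c))⁻¹ := by
          refine Finset.sum_le_sum fun i _ => ?_
          have h := abs_le.1 (abs_apply_le_supNorm (x - c) i)
          rw [PiLp.sub_apply] at h
          have h2 : (a - (x i - c i))⁻¹ ≤ (a - supNorm (x - c))⁻¹ :=
            inv_anti₀ hlt (by linarith [h.2])
          have h3 : (a + (x i - c i))⁻¹ ≤ (a - supNorm (x - c))⁻¹ :=
            inv_anti₀ hlt (by linarith [h.1])
          linarith
      _ = _ := by simp; ring
  rw [← div_eq_mul_inv, le_div_iff₀ hlt, inv_mul_le_iff₀ hd] at h1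
  linarith

/-- The inverse of a face distance `s` changes by `s⁻¹ * t⁻¹ * |s - t|`, and `s⁻¹`, `t⁻¹` are at
most the inverse depths. Multiplying the sum of `2 * n` such differences by both depths removes
every singular factor. -/
theorem abs_depth_sub_le (hn : 0 < n) (hx : x ∈ cube c (2 * a)) (hy : y ∈ cube c (2 * a)) :
    |depth c a x - depth c a y| ≤ 2 * n * supNorm (x - y) := by
  have hdx := depth_pos hn hx
  have hdy := depth_pos hn hy
  have aux : ∀ {s t S T δ : ℝ}, 0 < s → 0 < t → s⁻¹ ≤ S → t⁻¹ ≤ T → |s - t| ≤ δ →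
      |s⁻¹ - t⁻¹| ≤ S * T * δ := by
    intro s t S T δ hs ht hS hT hδ
    have : s⁻¹ - t⁻¹ = s⁻¹ * t⁻¹ * (t - s) := by field_simp
    rw [this, abs_mul, abs_of_pos (by positivity), abs_sub_comm]
    have h0 : 0 ≤ S := (inv_pos.2 hs).le.trans hS
    have h0' : 0 ≤ T := (inv_pos.2 ht).le.trans hT
    gcongr
  have h1 : |(depth c a x)⁻¹ - (depth c a y)⁻¹| ≤
      (depth c a x)⁻¹ * (depth c a y)⁻¹ * (2 * n * supNorm (x - y)) := by
    rw [depth_inv c a x, depth_inv c a y, ← Finset.sum_sub_distrib, ← depth_inv, ← depth_inv]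
    refine (Finset.abs_sum_le_sum_abs _ _).trans ?_
    calc _ ≤ ∑ _i : Fin n, 2 * ((depth c a x)⁻¹ * (depth c a y)⁻¹ * supNorm (x - y)) := by
          refine Finset.sum_le_sum fun i _ => ?_
          have h := abs_apply_le_supNorm (x - y) i
          rw [PiLp.sub_apply] at h
          have e1 := aux (sub_apply_pos hx i) (sub_apply_pos hy i) (inv_sub_le_depth_inv hx i)
            (inv_sub_le_depth_inv hy i) (δ := supNorm (x - y)) (by
              rw [abs_sub_comm]; convert h using 2; ring)
          have e2 := aux (add_apply_pos hx i) (add_apply_pos hy i) (inv_add_le_depth_inv hx i)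
            (inv_add_le_depth_inv hy i) (δ := supNorm (x - y)) (by convert h using 2; ring)
          have e3 := abs_add_le ((a - (x i - c i))⁻¹ - (a - (y i - c i))⁻¹)
            ((a + (x i - c i))⁻¹ - (a + (y i - c i))⁻¹)
          calc _ = _ := by congr 1; ring
            _ ≤ _ := e3
            _ ≤ _ := by linarith
      _ = _ := by simp; ring
  have h2 : depth c a x - depth c a y =
      depth c a x * depth c a y * ((depth c a y)⁻¹ - (depth c a x)⁻¹) := by
    field_simp
  rw [h2, abs_mul, abs_of_pos (by positivity), abs_sub_comm]
  calc _ ≤ depth c a x * depth c a y *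
      ((depth c a x)⁻¹ * (depth c a y)⁻¹ * (2 * n * supNorm (x - y))) := by gcongr
    _ = _ := by field_simp

theorem contDiffOn_depth (hn : 0 < n) : ContDiffOn ℝ ∞ (depth c a) (cube c (2 * a)) := by
  unfold depth
  refine ContDiffOn.inv (ContDiffOn.sum fun i _ => ContDiffOn.add ?_ ?_) fun x hx => ?_
  · exact ContDiffOn.inv (ContDiff.contDiffOn (by fun_prop)) fun x hx => (sub_apply_pos hx i).ne'
  · exact ContDiffOn.inv (ContDiff.contDiffOn (by fun_prop)) fun x hx => (add_apply_pos hx i).ne'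
  · rw [← depth_inv]
    exact (inv_pos.2 (depth_pos hn hx)).ne'

end Depth

/-! ### Radial reflection into the shell. -/

section Reflection

variable {n : ℕ} {c x y z : Eucl n} {a b : ℝ}

/-- The radial reflection of the points of `cube c (2 * a)` close to its boundary. -/
noncomputable def reflection (c : Eucl n) (a : ℝ) (x : Eucl n) : Eucl n :=
  c + (1 + 8 * n * depth c a x / a) • (x - c)

/-- The cube centred at the reflection of `x` whose size is comparable with the depth of `x`. -/
def reflectedCube (c : Eucl n) (a : ℝ) (x : Eucl n) : Set (Eucl n) :=
  cube (reflection c a x) (2 * (n * depth c a x))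

theorem contDiffOn_reflection (hn : 0 < n) :
    ContDiffOn ℝ ∞ (reflection c a) (cube c (2 * a)) := by
  unfold reflection
  refine contDiffOn_const.add (ContDiffOn.fun_smul ?_ (contDiff_id.sub contDiff_const).contDiffOn)
  exact contDiffOn_const.add ((contDiffOn_const.mul (contDiffOn_depth hn)).div_const a)

theorem supNorm_reflection_sub_reflection_le (hn : 0 < n) (ha : 0 < a)
    (hx : x ∈ cube c (2 * a)) (hy : y ∈ cube c (2 * a)) :
    supNorm (reflection c a x - reflection c a y) ≤ 25 * n ^ 2 * supNorm (x - y) := by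
  have h1 : reflection c a x - reflection c a y = (1 + 8 * n * depth c a x / a) • (x - y) +
      (8 * n * (depth c a x - depth c a y) / a) • (y - c) := by
    unfold reflection
    module
  rw [h1]
  refine (supNorm_add_le _ _).trans ?_
  rw [supNorm_smul, supNorm_smul]
  have hd := depth_pos hn hx
  have hn1 : (1 : ℝ) ≤ n := by exact_mod_cast hn
  have h2 : |1 + 8 * n * depth c a x / a| ≤ 9 * n := by
    rw [abs_of_pos (by positivity)]
    have : 8 * n * depth c a x / a ≤ 8 * n := by
      rw [div_le_iff₀ ha]
      gcongr
      exact depth_le hn hx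
    linarith
  have h3 : |8 * n * (depth c a x - depth c a y) / a| * supNorm (y - c) ≤
      16 * n ^ 2 * supNorm (x - y) := by
    rw [abs_div, abs_mul, abs_of_pos ha, abs_of_nonneg (by positivity : (0 : ℝ) ≤ 8 * n),
      div_mul_eq_mul_div, div_le_iff₀ ha]
    have h4 := abs_depth_sub_le hn hx hy
    have h5 := ((mem_cube_two_mul_iff ha).1 hy).le
    have h6 := supNorm_nonneg (x - y)
    have h7 := supNorm_nonneg (y - c)
    calc 8 * n * |depth c a x - depth c a y| * supNorm (y - c)
        ≤ 8 * n * (2 * n * supNorm (x - y)) * a := by gcongr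
      _ = _ := by ring
  have h6 := supNorm_nonneg (x - y)
  have h7 : |1 + 8 * n * depth c a x / a| * supNorm (x - y) ≤ 9 * n ^ 2 * supNorm (x - y) := by
    gcongr
    nlinarith
  linarith

theorem supNorm_reflection_sub_self_le (hn : 0 < n) (ha : 0 < a) (hx : x ∈ cube c (2 * a)) :
    supNorm (reflection c a x - x) ≤ 8 * n * depth c a x := by
  have h1 : reflection c a x - x = (8 * n * depth c a x / a) • (x - c) := by
    unfold reflection
    module
  have hd := depth_pos hn hx
  rw [h1, supNorm_smul, abs_of_nonneg (by positivity), div_mul_eq_mul_div, div_le_iff₀ ha]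
  have := ((mem_cube_two_mul_iff ha).1 hx).le
  gcongr

theorem supNorm_reflection_sub (hn : 0 < n) (ha : 0 < a) (hx : x ∈ cube c (2 * a)) :
    supNorm (reflection c a x - c) = (1 + 8 * n * depth c a x / a) * supNorm (x - c) := by
  have hd := depth_pos hn hx
  rw [reflection, add_sub_cancel_left, supNorm_smul, abs_of_pos (by positivity)]

/-- Small depth forces `supNorm (x - c) ≥ 8 / 9 * a`, so the dilation moves `x` outwards by at least
`64 / 9 * n * depth`. Reaching the boundary uses at most `2 * n * depth` of this. -/
theorem le_supNorm_reflection_sub (hn : 0 < n) (ha : 0 < a) (hx : x ∈ cube c (2 * a))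
    (hd : 18 * n * depth c a x ≤ a) :
    a + 2 * n * depth c a x ≤ supNorm (reflection c a x - c) := by
  rw [supNorm_reflection_sub hn ha hx]
  have h1 := le_supNorm_add_mul_depth hn hx
  have h2 := depth_pos hn hx
  have h3 : 8 / 9 * a ≤ supNorm (x - c) := by linarith
  have hn1 : (0 : ℝ) < n := by exact_mod_cast hn
  have h4 : 8 * n * depth c a x / a * (8 / 9 * a) ≤ 8 * n * depth c a x / a * supNorm (x - c) := by
    gcongr
  have h5 : 8 * n * depth c a x / a * (8 / 9 * a) = 64 / 9 * (n * depth c a x) := by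
    field_simp; norm_num
  have h6 : 0 < n * depth c a x := by positivity
  linarith

theorem supNorm_reflection_sub_le (hn : 0 < n) (ha : 0 < a) (hx : x ∈ cube c (2 * a)) :
    supNorm (reflection c a x - c) ≤ a + 8 * n * depth c a x := by
  have h1 := supNorm_sub_le (reflection c a x) x c
  have h2 := supNorm_reflection_sub_self_le hn ha hx
  have := ((mem_cube_two_mul_iff ha).1 hx).le
  linarith

theorem mem_reflectedCube_iff (hn : 0 < n) (hx : x ∈ cube c (2 * a)) :
    z ∈ reflectedCube c a x ↔ supNorm (z - reflection c a x) < n * depth c a x := by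
  have hd := depth_pos hn hx
  exact mem_cube_two_mul_iff (by positivity)

/-- The reflected centre lies between `2 * n` and `8 * n` depths outside the hole and the cube has
half side `n` depths. The reflected cube thus stays at a distance from the hole comparable with its
own size. -/
theorem supNorm_of_mem_reflectedCube (hn : 0 < n) (ha : 0 < a) (hx : x ∈ cube c (2 * a))
    (hd : 18 * n * depth c a x ≤ a) (hz : z ∈ reflectedCube c a x) :
    a + n * depth c a x < supNorm (z - c) ∧ supNorm (z - c) < a + 9 * n * depth c a x := by
  rw [mem_reflectedCube_iff hn hx] at hz
  have h1 := le_supNorm_reflection_sub hn ha hx hd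
  have h2 := supNorm_reflection_sub_le hn ha hx
  have h3 := supNorm_sub_le z (reflection c a x) c
  have h4 := supNorm_sub_le (reflection c a x) z c
  rw [supNorm_sub_comm _ z] at h4
  constructor <;> linarith

/-- The cubical shell of inner half side `a` and thickness `b`. -/
def shell (c : Eucl n) (a b : ℝ) : Set (Eucl n) :=
  {z | a < supNorm (z - c) ∧ supNorm (z - c) < a + b}

theorem isOpen_shell (c : Eucl n) (a b : ℝ) : IsOpen (shell c a b) := by
  have : Continuous fun z : Eucl n => supNorm (z - c) :=
    continuous_supNorm.comp (continuous_id.sub continuous_const)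
  exact (isOpen_lt continuous_const this).inter (isOpen_lt this continuous_const)

theorem reflectedCube_subset_shell (hn : 0 < n) (ha : 0 < a) (hba : b ≤ a)
    (hx : x ∈ cube c (2 * a)) (hd : 18 * n * depth c a x ≤ b) :
    reflectedCube c a x ⊆ shell c a b := by
  intro z hz
  have h1 := supNorm_of_mem_reflectedCube hn ha hx (hd.trans hba) hz
  have h2 := depth_pos hn hx
  have : (0 : ℝ) < n * depth c a x := by positivity
  exact ⟨by linarith [h1.1], by linarith [h1.2]⟩

end Reflection

/-! ### The averaging kernel. -/

section Kernel

variable {n : ℕ} {c x y z : Eucl n} {a b : ℝ}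

/-- A smooth bump which equals `1` on the unit ball and vanishes off the ball of radius `2`. -/
noncomputable def bump (n : ℕ) : ContDiffBump (0 : Eucl n) :=
  ⟨1, 2, one_pos, one_lt_two⟩

theorem exists_bump_lipschitz (n : ℕ) :
    ∃ L : ℝ≥0, ∀ x y : Eucl n, |bump n x - bump n y| ≤ L * ‖x - y‖ := by
  obtain ⟨L, hL⟩ := (bump n).contDiff.lipschitzWith_of_hasCompactSupport (n := 1)
    (bump n).hasCompactSupport one_ne_zero
  exact ⟨L, fun x y => by simpa [Real.dist_eq, dist_eq_norm] using hL.dist_le_mul x y⟩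

/-- The averaging kernel at `x`, supported in the reflected cube of `x`. -/
noncomputable def layerKernel (c : Eucl n) (a : ℝ) (x z : Eucl n) : ℝ :=
  bump n ((2 / depth c a x) • (reflection c a x - z))

theorem layerKernel_nonneg : 0 ≤ layerKernel c a x z := (bump n).nonneg

theorem layerKernel_le_one : layerKernel c a x z ≤ 1 := (bump n).le_one

theorem continuous_layerKernel : Continuous (layerKernel c a x) :=
  (bump n).continuous.comp (by fun_prop)

theorem layerKernel_eq_zero (hn : 0 < n) (hx : x ∈ cube c (2 * a))
    (h : depth c a x ≤ ‖reflection c a x - z‖) : layerKernel c a x z = 0 := by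
  have hd := depth_pos hn hx
  refine (bump n).zero_of_le_dist ?_
  rw [dist_zero_right, norm_smul, Real.norm_of_nonneg (by positivity), div_mul_eq_mul_div,
    le_div_iff₀ hd]
  change 2 * _ ≤ _
  gcongr

theorem layerKernel_eq_zero_of_supNorm (hn : 0 < n) (hx : x ∈ cube c (2 * a))
    (h : depth c a x ≤ supNorm (reflection c a x - z)) : layerKernel c a x z = 0 :=
  layerKernel_eq_zero hn hx (h.trans (supNorm_le_norm _))

theorem layerKernel_eq_zero_of_notMem (hn : 0 < n) (hx : x ∈ cube c (2 * a))
    (h : z ∉ reflectedCube c a x) : layerKernel c a x z = 0 := by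
  rw [mem_reflectedCube_iff hn hx, not_lt, supNorm_sub_comm] at h
  refine layerKernel_eq_zero_of_supNorm hn hx (le_trans ?_ h)
  have hd := depth_pos hn hx
  have hn1 : (1 : ℝ) ≤ n := by exact_mod_cast hn
  nlinarith

/-- A cube of side `depth / n` fits into the Euclidean ball of radius `depth / 2`, where the
rescaled bump is `1`. This bounds the total mass of the kernel from below. -/
theorem layerKernel_eq_one (hn : 0 < n) (hx : x ∈ cube c (2 * a))
    (h : z ∈ cube (reflection c a x) (depth c a x / n)) : layerKernel c a x z = 1 := by
  have hd := depth_pos hn hx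
  have hn1 : (0 : ℝ) < n := by exact_mod_cast hn
  refine (bump n).one_of_mem_closedBall ?_
  have h1 := cube_subset_closedBall _ (by positivity) h
  rw [mem_closedBall_iff_norm'] at h1
  rw [mem_closedBall_zero_iff, norm_smul, Real.norm_of_nonneg (by positivity), div_mul_eq_mul_div,
    div_le_iff₀ hd]
  change _ ≤ 1 * _
  have : (n : ℝ) * (depth c a x / n / 2) = depth c a x / 2 := by field_simp
  linarith

theorem hasCompactSupport_layerKernel (hn : 0 < n) (hx : x ∈ cube c (2 * a)) :
    HasCompactSupport (layerKernel c a x) :=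
  HasCompactSupport.intro (isCompact_closedBall (reflection c a x) (depth c a x)) fun z hz => by
    rw [mem_closedBall_iff_norm', not_le] at hz
    exact layerKernel_eq_zero hn hx hz.le

/-- The kernel depends on its centre in a Lipschitz way, at the scale given by the depth. -/
theorem exists_layerKernel_lipschitz (hn : 2 ≤ n) : ∃ L : ℝ≥0,
    ∀ {c : Eucl n} {a : ℝ} {x₀ : Eucl n}, 0 < a → x₀ ∈ cube c (2 * a) →
      ∀ᶠ x in 𝓝 x₀, x ∈ cube c (2 * a) ∧ (∀ z, |layerKernel c a x z - layerKernel c a x₀ z| ≤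
        L / depth c a x₀ * ‖x - x₀‖) ∧ ∀ z ∉ reflectedCube c a x₀, layerKernel c a x z = 0 := by
  obtain ⟨L, hL⟩ := exists_bump_lipschitz n
  have hn0 : 0 < n := by omega
  -- Here `108 = 4 * 25 + 4 * 2`: the first term comes from moving the reflected centre, the second
  -- from changing the scale.
  refine ⟨L * (108 * n ^ 3), fun {c a x₀} ha hx₀ => ?_⟩
  have hd₀ := depth_pos hn0 hx₀
  have hnhds := (isOpen_cube c (2 * a)).mem_nhds hx₀
  have hcd : ContinuousAt (depth c a) x₀ := (contDiffOn_depth hn0).continuousOn.continuousAt hnhds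
  have hcr : ContinuousAt (reflection c a) x₀ :=
    (contDiffOn_reflection hn0).continuousOn.continuousAt hnhds
  have hn2 : (2 : ℝ) ≤ n := by exact_mod_cast hn
  have h1 : ∀ᶠ x in 𝓝 x₀, depth c a x₀ / 2 < depth c a x :=
    hcd.eventually (lt_mem_nhds (by linarith))
  -- At `x₀` this is `depth < n * depth`, strict because `n ≥ 2`. The kernels of nearby points
  -- therefore all live in the reflected cube of `x₀`.
  have h2 : ∀ᶠ x in 𝓝 x₀, depth c a x + supNorm (reflection c a x - reflection c a x₀) <
      n * depth c a x₀ := by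
    have hc : ContinuousAt (fun x => depth c a x +
        supNorm (reflection c a x - reflection c a x₀)) x₀ :=
      hcd.add (continuous_supNorm.continuousAt.comp (hcr.sub continuousAt_const))
    refine hc.eventually (gt_mem_nhds ?_)
    simp only [sub_self, supNorm_zero, add_zero]
    nlinarith
  filter_upwards [hnhds, h1, h2] with x hx hxd hxr
  have hd := depth_pos hn0 hx
  have hvan : ∀ z ∉ reflectedCube c a x₀, layerKernel c a x z = 0 := by
    intro z hz
    rw [mem_reflectedCube_iff hn0 hx₀, not_lt] at hz
    refine layerKernel_eq_zero_of_supNorm hn0 hx ?_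
    have h3 := supNorm_sub_le z (reflection c a x) (reflection c a x₀)
    rw [supNorm_sub_comm z (reflection c a x)] at h3
    linarith
  refine ⟨hx, fun z => ?_, hvan⟩
  by_cases hz : z ∈ reflectedCube c a x₀
  swap
  · rw [hvan z hz, layerKernel_eq_zero_of_notMem hn0 hx₀ hz, sub_zero, abs_zero]
    positivity
  refine (hL _ _).trans ?_
  rw [NNReal.coe_mul, mul_div_assoc, mul_assoc (L : ℝ)]
  refine mul_le_mul_of_nonneg_left ?_ L.2
  have e1 : (2 / depth c a x) • (reflection c a x - z) -
      (2 / depth c a x₀) • (reflection c a x₀ - z) =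
      (2 / depth c a x) • (reflection c a x - reflection c a x₀) +
        (2 / depth c a x - 2 / depth c a x₀) • (reflection c a x₀ - z) := by module
  rw [e1]
  refine (norm_add_le _ _).trans ?_
  rw [norm_smul, norm_smul, Real.norm_of_nonneg (by positivity), Real.norm_eq_abs]
  have hsn := supNorm_le_norm (x - x₀)
  have b1 : ‖reflection c a x - reflection c a x₀‖ ≤ 25 * n ^ 3 * ‖x - x₀‖ := by
    refine (norm_le_mul_supNorm _).trans ?_
    have := supNorm_reflection_sub_reflection_le hn0 ha hx hx₀
    calc (n : ℝ) * supNorm (reflection c a x - reflection c a x₀)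
        ≤ n * (25 * n ^ 2 * ‖x - x₀‖) := by gcongr; exact this.trans (by gcongr)
      _ = _ := by ring
  have b2 : ‖reflection c a x₀ - z‖ ≤ n ^ 2 * depth c a x₀ := by
    refine (norm_le_mul_supNorm _).trans ?_
    rw [mem_reflectedCube_iff hn0 hx₀] at hz
    rw [supNorm_sub_comm]
    calc (n : ℝ) * supNorm (z - reflection c a x₀) ≤ n * (n * depth c a x₀) := by gcongr
      _ = _ := by ring
  have b3 : 2 / depth c a x ≤ 4 / depth c a x₀ := by
    rw [div_le_div_iff₀ hd hd₀]; linarith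
  have b4 : |2 / depth c a x - 2 / depth c a x₀| ≤
      4 / depth c a x₀ ^ 2 * (2 * n * ‖x - x₀‖) := by
    have e2 : 2 / depth c a x - 2 / depth c a x₀ =
        2 / depth c a x * (1 / depth c a x₀) * (depth c a x₀ - depth c a x) := by field_simp
    rw [e2, abs_mul, abs_of_pos (by positivity), abs_sub_comm]
    have := (abs_depth_sub_le hn0 hx hx₀).trans
      (mul_le_mul_of_nonneg_left hsn (by positivity))
    calc _ ≤ 4 / depth c a x₀ * (1 / depth c a x₀) * (2 * n * ‖x - x₀‖) := by gcongr
      _ = _ := by field_simp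
  calc _ ≤ 4 / depth c a x₀ * (25 * n ^ 3 * ‖x - x₀‖) +
        4 / depth c a x₀ ^ 2 * (2 * n * ‖x - x₀‖) * (n ^ 2 * depth c a x₀) := by gcongr
    _ = (108 * n ^ 3) / depth c a x₀ * ‖x - x₀‖ := by field_simp; ring
    _ = _ := by simp

end Kernel

/-! ### Smoothness and size of the averages. -/

section LayerAverage

variable {n : ℕ} {c x y z : Eucl n} {a b : ℝ} {μ : Measure (Eucl n)} {A : ℝ≥0} {f : Eucl n → ℝ}

/-- The integral of `f` against the averaging kernel. -/
noncomputable def layerIntegral (μ : Measure (Eucl n)) (c : Eucl n) (a : ℝ) (f : Eucl n → ℝ)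
    (x : Eucl n) : ℝ := ∫ z, f z * layerKernel c a x z ∂μ

/-- The weighted average of `f` over the reflected cube of `x`. -/
noncomputable def layerAverage (μ : Measure (Eucl n)) (c : Eucl n) (a : ℝ) (f : Eucl n → ℝ)
    (x : Eucl n) : ℝ := layerIntegral μ c a f x / layerIntegral μ c a (fun _ => 1) x

/-- The integral is a convolution with a kernel depending smoothly on the parameter `x`, evaluated
at the reflection of `x`. Since `depth ≤ a`, one ball of radius `a` contains the supports for all
parameters. -/
theorem contDiffOn_layerIntegral (hn : 0 < n) (hf : LocallyIntegrable f μ) :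
    ContDiffOn ℝ ∞ (layerIntegral μ c a f) (cube c (2 * a)) := by
  have hc : ContDiffOn ℝ ∞ (fun q : Eucl n × Eucl n => bump n ((2 / depth c a q.1) • q.2))
      (cube c (2 * a) ×ˢ Set.univ) := by
    refine (bump n).contDiff.comp_contDiffOn (ContDiffOn.fun_smul ?_ contDiff_snd.contDiffOn)
    refine ContDiffOn.div contDiffOn_const ((contDiffOn_depth hn).comp contDiff_fst.contDiffOn
      fun q hq => hq.1) fun q hq => (depth_pos hn hq.1).ne'
  exact contDiffOn_convolution_right_with_param_comp (n := ⊤) (ContinuousLinearMap.mul ℝ ℝ)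
    (contDiffOn_reflection hn) (g := fun x y => bump n ((2 / depth c a x) • y))
    (isOpen_cube c (2 * a)) (isCompact_closedBall 0 a) (fun x y hx hy => by
      refine (bump n).zero_of_le_dist ?_
      have hd := depth_pos hn hx
      have := depth_le hn hx
      rw [mem_closedBall_zero_iff, not_le] at hy
      rw [dist_zero_right, norm_smul, Real.norm_of_nonneg (by positivity), div_mul_eq_mul_div,
        le_div_iff₀ hd]
      change 2 * _ ≤ _
      linarith) hf hc

theorem integrable_mul_layerKernel (hn : 0 < n) (hf : LocallyIntegrable f μ)
    (hx : x ∈ cube c (2 * a)) : Integrable (fun z => f z * layerKernel c a x z) μ := by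
  simpa [mul_comm] using hf.integrable_smul_left_of_hasCompactSupport continuous_layerKernel
    (hasCompactSupport_layerKernel hn hx)

/-- The sides have ratio `2 * n ^ 2 ≤ 2 ^ (2 * n + 1)`. -/
theorem IsDoubling.measure_reflectedCube_le (h : IsDoubling μ A) (hn : 0 < n)
    (hx : x ∈ cube c (2 * a)) : μ (reflectedCube c a x) ≤
      (A : ℝ≥0∞) ^ (2 * n + 1) * μ (cube (reflection c a x) (depth c a x / n)) := by
  have hd := depth_pos hn hx
  have hn1 : (0 : ℝ) < n := by exact_mod_cast hn
  refine h.measure_cube_le (by positivity) (by positivity) _ ?_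
  rw [sub_self, supNorm_zero, zero_add]
  have h2 : (n : ℝ) ≤ 2 ^ n := by exact_mod_cast Nat.lt_two_pow_self.le
  rw [div_div, mul_div_assoc', le_div_iff₀ (by positivity), pow_succ, pow_mul']
  have : (n : ℝ) ^ 2 ≤ (2 ^ n) ^ 2 := by gcongr
  calc _ = 2 * (n : ℝ) ^ 2 * depth c a x := by ring
    _ ≤ 2 * (2 ^ n) ^ 2 * depth c a x := by gcongr
    _ = _ := by ring

theorem IsDoubling.measure_cube_le_layerIntegral (h : IsDoubling μ A) (hn : 0 < n)
    (hx : x ∈ cube c (2 * a)) : μ (cube (reflection c a x) (depth c a x / n)) ≤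
      ENNReal.ofReal (layerIntegral μ c a (fun _ => 1) x) := by
  have := h.isLocallyFiniteMeasure
  have hint := integrable_mul_layerKernel (f := fun _ => (1 : ℝ)) hn (μ := μ)
    (locallyIntegrable_const 1) hx
  rw [layerIntegral, ofReal_integral_eq_lintegral_ofReal hint
    (Eventually.of_forall fun z => by simpa using layerKernel_nonneg)]
  calc μ (cube (reflection c a x) (depth c a x / n))
      = ∫⁻ z in cube (reflection c a x) (depth c a x / n), 1 ∂μ := by simp
    _ ≤ ∫⁻ z in cube (reflection c a x) (depth c a x / n),
        ENNReal.ofReal (1 * layerKernel c a x z) ∂μ :=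
        setLIntegral_mono' (measurableSet_cube _ _) fun z hz => by
          rw [layerKernel_eq_one hn hx hz]; simp
    _ ≤ _ := setLIntegral_le_lintegral _ _

theorem IsDoubling.measure_reflectedCube_le_layerIntegral (h : IsDoubling μ A) (hn : 0 < n)
    (hx : x ∈ cube c (2 * a)) : μ (reflectedCube c a x) ≤
      (A : ℝ≥0∞) ^ (2 * n + 1) * ENNReal.ofReal (layerIntegral μ c a (fun _ => 1) x) :=
  (h.measure_reflectedCube_le hn hx).trans (by
    gcongr
    exact h.measure_cube_le_layerIntegral hn hx)

theorem IsDoubling.layerIntegral_one_pos (h : IsDoubling μ A) (hn : 0 < n)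
    (hx : x ∈ cube c (2 * a)) : 0 < layerIntegral μ c a (fun _ => 1) x := by
  have hd := depth_pos hn hx
  exact ENNReal.ofReal_pos.1 ((h.measure_pos _ (by positivity)).trans_le
    (h.measure_cube_le_layerIntegral hn hx))

theorem IsDoubling.contDiffOn_layerAverage (h : IsDoubling μ A) (hn : 0 < n)
    (hf : LocallyIntegrable f μ) :
    ContDiffOn ℝ ∞ (layerAverage μ c a f) (cube c (2 * a)) := by
  have := h.isLocallyFiniteMeasure
  exact (contDiffOn_layerIntegral hn hf).div
    (contDiffOn_layerIntegral hn (locallyIntegrable_const 1))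
    fun x hx => (h.layerIntegral_one_pos hn hx).ne'

/-- The averages reproduce constants. This allows sizes of `f` to be replaced by oscillations below.
-/
theorem IsDoubling.layerAverage_sub_const (h : IsDoubling μ A) (hn : 0 < n)
    (hf : LocallyIntegrable f μ) (hx : x ∈ cube c (2 * a)) (m : ℝ) :
    layerAverage μ c a f x - m = layerAverage μ c a (fun z => f z - m) x := by
  have := h.isLocallyFiniteMeasure
  have h1 := (h.layerIntegral_one_pos hn hx).ne'
  have h2 : layerIntegral μ c a (fun z => f z - m) x =
      layerIntegral μ c a f x - m * layerIntegral μ c a (fun _ => 1) x := by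
    unfold layerIntegral
    rw [← integral_const_mul, ← integral_sub (integrable_mul_layerKernel hn hf hx)
      ((integrable_mul_layerKernel hn (locallyIntegrable_const 1) hx).const_mul m)]
    congr 1
    ext z
    ring
  rw [layerAverage, layerAverage, h2]
  field_simp

theorem enorm_layerIntegral_le (hn : 0 < n) (hx : x ∈ cube c (2 * a)) {H : Set (Eucl n)}
    (hH : reflectedCube c a x ⊆ H) (hHm : MeasurableSet H) :
    ‖layerIntegral μ c a f x‖ₑ ≤ ∫⁻ z in H, ‖f z‖ₑ ∂μ := by
  rw [layerIntegral, ← lintegral_indicator hHm]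
  refine (enorm_integral_le_lintegral_enorm _).trans (lintegral_mono fun z => ?_)
  by_cases hz : z ∈ H
  · rw [Set.indicator_of_mem hz, enorm_mul]
    refine mul_le_of_le_one_right' ?_
    rw [Real.enorm_eq_ofReal layerKernel_nonneg]
    exact ENNReal.ofReal_le_one.2 layerKernel_le_one
  · rw [layerKernel_eq_zero_of_notMem hn hx fun h => hz (hH h)]
    simp

/-- The averages differ from a constant by at most the mean oscillation. -/
theorem IsDoubling.enorm_layerAverage_sub_le (h : IsDoubling μ A) (hn : 0 < n)
    (hf : LocallyIntegrable f μ) (hx : x ∈ cube c (2 * a)) (m : ℝ) {H : Set (Eucl n)}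
    (hH : reflectedCube c a x ⊆ H) (hHm : MeasurableSet H) {D : ℝ≥0∞}
    (hD : μ H ≤ D * ENNReal.ofReal (layerIntegral μ c a (fun _ => 1) x))
    (h0 : μ H ≠ 0) (ht : μ H ≠ ⊤) :
    ‖layerAverage μ c a f x - m‖ₑ ≤ D * ⨍⁻ z in H, ‖f z - m‖ₑ ∂μ := by
  have hpos := h.layerIntegral_one_pos hn hx
  rw [h.layerAverage_sub_const hn hf hx, layerAverage, div_eq_inv_mul, enorm_mul,
    setLAverage_eq_inv_mul, ← mul_assoc]
  refine mul_le_mul' ?_ (enorm_layerIntegral_le hn hx hH hHm)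
  rw [Real.enorm_eq_ofReal (by positivity), ENNReal.ofReal_inv_of_pos hpos]
  exact ENNReal.inv_le_mul_inv hD h0 ht

end LayerAverage

/-! ### Derivative of the averages. -/

section GradientBound

variable {n : ℕ} {c x x₀ y z : Eucl n} {a b : ℝ} {μ : Measure (Eucl n)} {A B : ℝ≥0}
  {f φ : Eucl n → ℝ} {p : ℝ}

theorem isBounded_reflectedCube (hn : 0 < n) (hx : x ∈ cube c (2 * a)) :
    Bornology.IsBounded (reflectedCube c a x) := by
  have := depth_pos hn hx
  exact isBounded_cube _ (by positivity)

theorem measurableSet_reflectedCube : MeasurableSet (reflectedCube c a x) :=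
  measurableSet_cube _ _

theorem _root_.MeasureTheory.LocallyIntegrable.integrableOn_of_isBounded [IsLocallyFiniteMeasure μ]
    (hf : LocallyIntegrable f μ) {s : Set (Eucl n)} (hs : Bornology.IsBounded s) :
    IntegrableOn f s μ :=
  (hf.integrableOn_isCompact hs.isCompact_closure).mono_set subset_closure

theorem abs_layerIntegral_sub_le [IsLocallyFiniteMeasure μ] (hn : 0 < n)
    (hf : LocallyIntegrable f μ) (hx : x ∈ cube c (2 * a)) (hx₀ : x₀ ∈ cube c (2 * a)) {K : ℝ}
    (hK : ∀ z, |layerKernel c a x z - layerKernel c a x₀ z| ≤ K)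
    (hvan : ∀ z ∉ reflectedCube c a x₀, layerKernel c a x z = 0) :
    |layerIntegral μ c a f x - layerIntegral μ c a f x₀| ≤
      K * ∫ z in reflectedCube c a x₀, |f z| ∂μ := by
  have hint := (hf.integrableOn_of_isBounded (isBounded_reflectedCube hn hx₀)).abs
  unfold layerIntegral
  rw [← integral_sub (integrable_mul_layerKernel hn hf hx) (integrable_mul_layerKernel hn hf hx₀),
    ← integral_const_mul, ← integral_indicator measurableSet_reflectedCube, ← Real.norm_eq_abs]
  refine norm_integral_le_of_norm_le
    ((integrable_indicator_iff measurableSet_reflectedCube).2 (hint.const_mul K))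
    (Eventually.of_forall fun z => ?_)
  rw [Real.norm_eq_abs]
  by_cases hz : z ∈ reflectedCube c a x₀
  · rw [Set.indicator_of_mem hz, ← mul_sub, abs_mul, mul_comm]
    gcongr
    exact hK z
  · rw [Set.indicator_of_notMem hz, hvan z hz, layerKernel_eq_zero_of_notMem hn hx₀ hz]
    simp

theorem abs_layerIntegral_le [IsLocallyFiniteMeasure μ] (hn : 0 < n)
    (hf : LocallyIntegrable f μ) (hx : x ∈ cube c (2 * a)) :
    |layerIntegral μ c a f x| ≤ ∫ z in reflectedCube c a x, |f z| ∂μ := by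
  have hint := (hf.integrableOn_of_isBounded (isBounded_reflectedCube hn hx)).abs
  rw [layerIntegral, ← integral_indicator measurableSet_reflectedCube, ← Real.norm_eq_abs]
  refine norm_integral_le_of_norm_le
    ((integrable_indicator_iff measurableSet_reflectedCube).2 hint)
    (Eventually.of_forall fun z => ?_)
  rw [Real.norm_eq_abs]
  by_cases hz : z ∈ reflectedCube c a x
  · rw [Set.indicator_of_mem hz, abs_mul, abs_of_nonneg layerKernel_nonneg]
    exact mul_le_of_le_one_right (abs_nonneg _) layerKernel_le_one
  · rw [Set.indicator_of_notMem hz, layerKernel_eq_zero_of_notMem hn hx hz]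
    simp

/-- The derivative of the averages is controlled by the mean oscillation. -/
theorem exists_enorm_fderiv_layerAverage_le (hn : 2 ≤ n) : ∃ L : ℝ≥0,
    ∀ {μ : Measure (Eucl n)} {A : ℝ≥0}, IsDoubling μ A → ∀ {f : Eucl n → ℝ},
      LocallyIntegrable f μ → ∀ {c : Eucl n} {a : ℝ} {x₀ : Eucl n}, 0 < a →
      x₀ ∈ cube c (2 * a) → ∀ m : ℝ,
      ‖fderiv ℝ (layerAverage μ c a f) x₀‖ₑ ≤ ENNReal.ofReal (L / depth c a x₀) *
        ((A : ℝ≥0∞) ^ (4 * n + 2) * ⨍⁻ z in reflectedCube c a x₀, ‖f z - m‖ₑ ∂μ) := by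
  obtain ⟨L, hL⟩ := exists_layerKernel_lipschitz hn
  refine ⟨4 * L, fun {μ A} h {f} hf {c a x₀} ha hx₀ m => ?_⟩
  have hn0 : 0 < n := by omega
  have := h.isLocallyFiniteMeasure
  have hd₀ := depth_pos hn0 hx₀
  set g : Eucl n → ℝ := fun z => f z - m with hg
  have hgl : LocallyIntegrable g μ := hf.sub (locallyIntegrable_const m)
  have h1l : LocallyIntegrable (fun _ : Eucl n => (1 : ℝ)) μ := locallyIntegrable_const 1
  set N : Eucl n → ℝ := layerIntegral μ c a fun _ => 1 with hN
  set F : Eucl n → ℝ := layerIntegral μ c a g with hF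
  set I : ℝ := ∫ z in reflectedCube c a x₀, |g z| ∂μ with hI
  set M : ℝ := μ.real (reflectedCube c a x₀) with hM
  have hN₀ : 0 < N x₀ := h.layerIntegral_one_pos hn0 hx₀
  have hI0 : 0 ≤ I := integral_nonneg fun z => abs_nonneg _
  have hsz : 0 < 2 * (n * depth c a x₀) := by positivity
  have hM0 : 0 < M := ENNReal.toReal_pos (h.measure_ne_zero _ hsz) (h.measure_ne_top _ hsz)
  have hMN : M ≤ (A : ℝ) ^ (2 * n + 1) * N x₀ := by
    have := h.measure_reflectedCube_le_layerIntegral hn0 hx₀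
    have h2 := ENNReal.toReal_mono (by finiteness) this
    rwa [ENNReal.toReal_mul, ENNReal.toReal_ofReal hN₀.le, ENNReal.toReal_pow,
      ENNReal.coe_toReal] at h2
  have hA1 : (1 : ℝ) ≤ A := by exact_mod_cast h.one_le
  set D : ℝ := (A : ℝ) ^ (2 * n + 1) with hD
  have hD1 : 1 ≤ D := one_le_pow₀ hA1
  have hNc : ContinuousAt N x₀ :=
    (contDiffOn_layerIntegral hn0 h1l).continuousOn.continuousAt
      ((isOpen_cube c (2 * a)).mem_nhds hx₀)
  have hNe : ∀ᶠ x in 𝓝 x₀, N x₀ / 2 < N x := hNc.eventually (lt_mem_nhds (by linarith))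
  have hbound : ‖fderiv ℝ (layerAverage μ c a f) x₀‖ ≤
      4 * L / depth c a x₀ * (D ^ 2 * (I / M)) := by
    refine norm_fderiv_le_of_lip' ℝ (by positivity) ?_
    filter_upwards [hL ha hx₀, hNe] with x ⟨hx, hk, hvan⟩ hNx
    have hNx0 : 0 < N x := by linarith
    set κ : ℝ := L / depth c a x₀ * ‖x - x₀‖ with hκ
    have hκ0 : 0 ≤ κ := by positivity
    -- A difference form of the quotient rule for numerator `F` and normalization `N`; the constant
    -- `m` has been moved into `F`.
    have e1 : layerAverage μ c a f x - layerAverage μ c a f x₀ =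
        (F x - F x₀) / N x - F x₀ * (N x - N x₀) / (N x * N x₀) := by
      have : layerAverage μ c a f x - layerAverage μ c a f x₀ = F x / N x - F x₀ / N x₀ := by
        have e2 := h.layerAverage_sub_const hn0 hf hx m
        have e3 := h.layerAverage_sub_const hn0 hf hx₀ m
        rw [layerAverage] at e2 e3
        rw [← sub_sub_sub_cancel_right _ _ m]
        exact congrArg₂ _ e2 e3
      rw [this]
      field_simp
      ring
    have b1 : |F x - F x₀| ≤ κ * I := abs_layerIntegral_sub_le hn0 hgl hx hx₀ hk hvan
    have b2 : |N x - N x₀| ≤ κ * M := by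
      have := abs_layerIntegral_sub_le (μ := μ) hn0 h1l hx hx₀ hk hvan
      simpa [hM] using this
    have b3 : |F x₀| ≤ I := abs_layerIntegral_le hn0 hgl hx₀
    rw [Real.norm_eq_abs, e1]
    refine (abs_sub _ _).trans ?_
    rw [abs_div, abs_div, abs_mul, abs_of_pos hNx0, abs_of_pos (mul_pos hNx0 hN₀)]
    have hMN' : M / D ≤ N x₀ := by rw [div_le_iff₀ (by linarith)]; linarith
    have hMD : 0 < M / D := by positivity
    have c1 : |F x - F x₀| / N x ≤ κ * I / (M / D / 2) := by
      gcongr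
      linarith
    have c2 : |F x₀| * |N x - N x₀| / (N x * N x₀) ≤ I * (κ * M) / (M / D / 2 * (M / D)) := by
      gcongr
      linarith
    calc _ ≤ κ * I / (M / D / 2) + I * (κ * M) / (M / D / 2 * (M / D)) := add_le_add c1 c2
      _ = κ * (I / M) * (2 * D + 2 * D ^ 2) := by field_simp
      _ ≤ κ * (I / M) * (4 * D ^ 2) := by
          gcongr
          nlinarith
      _ = _ := by rw [hκ]; ring
  have hID : ENNReal.ofReal (I / M) = ⨍⁻ z in reflectedCube c a x₀, ‖f z - m‖ₑ ∂μ := by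
    have := ofReal_setAverage (μ := μ) (f := fun z => |g z|)
      (hgl.integrableOn_of_isBounded (isBounded_reflectedCube hn0 hx₀)).abs
      (Eventually.of_forall fun z => abs_nonneg _)
    rw [setAverage_eq, smul_eq_mul, ← div_eq_inv_mul] at this
    rw [setLAverage_eq]
    simpa only [Real.enorm_eq_ofReal_abs] using this
  rw [← ofReal_norm, ← hID]
  refine (ENNReal.ofReal_le_ofReal hbound).trans ?_
  rw [ENNReal.ofReal_mul (by positivity), ENNReal.ofReal_mul (by positivity), hD, ← pow_mul,
    ENNReal.ofReal_pow (by positivity), ENNReal.ofReal_coe_nnreal]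
  apply le_of_eq
  simp
  ring

theorem norm_gradient_eq (φ : Eucl n → ℝ) (x : Eucl n) : ‖gradient φ x‖ₑ = ‖fderiv ℝ φ x‖ₑ := by
  simp [gradient, enorm_eq_nnnorm]

/-- The Poincaré inequality for test functions, with an explicit bound for the diameter. -/
theorem SatisfiesPoincare.setLAverage_le (hP : SatisfiesPoincare p μ B) (hφ : ContDiff ℝ ∞ φ)
    (hc : HasCompactSupport φ) (c : Eucl n) {ℓ : ℝ} (hℓ : 0 < ℓ) :
    ⨍⁻ x in cube c ℓ, ‖φ x - ⨍ y in cube c ℓ, φ y ∂μ‖ₑ ∂μ ≤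
      B * ENNReal.ofReal (n * ℓ) * (⨍⁻ x in cube c ℓ, ‖gradient φ x‖ₑ ^ p ∂μ) ^ (1 / p) := by
  obtain ⟨M, hM⟩ := hc.exists_bound_of_continuous hφ.continuous
  refine (hP.2 c ℓ hℓ φ hφ.contDiffOn ⟨M, fun x _ => hM x⟩).trans ?_
  gcongr
  exact diam_cube_le c hℓ

/-- The derivative of the averages of a test function is controlled by the averages of the
gradient of that function. -/
theorem exists_enorm_fderiv_layerAverage_le_gradient (hn : 2 ≤ n) (A B : ℝ≥0) :
    ∃ D : ℝ≥0, ∀ {p : ℝ} {μ : Measure (Eucl n)}, IsDoubling μ A → SatisfiesPoincare p μ B →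
      ∀ {f φ : Eucl n → ℝ}, LocallyIntegrable f μ → ContDiff ℝ ∞ φ → HasCompactSupport φ →
      ∀ {c : Eucl n} {a : ℝ} {x : Eucl n}, 0 < a → x ∈ cube c (2 * a) →
      (∀ z ∈ reflectedCube c a x, f z = φ z) →
      ‖fderiv ℝ (layerAverage μ c a f) x‖ₑ ≤
        D * (⨍⁻ z in reflectedCube c a x, ‖gradient φ z‖ₑ ^ p ∂μ) ^ (1 / p) := by
  obtain ⟨L, hL⟩ := exists_enorm_fderiv_layerAverage_le hn
  -- The factor `2 * n ^ 2` is what remains of `1 / depth` times the bound for the diameter of the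
  -- reflected cube, whose side is `2 * n * depth`.
  refine ⟨L * A ^ (4 * n + 2) * B * (2 * n ^ 2),
    fun {p μ} hd hP {f φ} hf hφ hc {c a x} ha hx hfφ => ?_⟩
  have hn0 : 0 < n := by omega
  have hρ := depth_pos hn0 hx
  set m := ⨍ y in reflectedCube c a x, φ y ∂μ with hm
  refine (hL hd hf ha hx m).trans ?_
  rw [setLAverage_congr_fun (g := fun z => ‖φ z - m‖ₑ) measurableSet_reflectedCube fun z hz => by
    simp only [hfφ z hz]]
  have h1 : ⨍⁻ z in reflectedCube c a x, ‖φ z - m‖ₑ ∂μ ≤ _ :=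
    hP.setLAverage_le hφ hc _ (by positivity)
  refine (mul_le_mul_right (mul_le_mul_right h1 _) _).trans (le_of_eq ?_)
  have e : ENNReal.ofReal (L / depth c a x) * ENNReal.ofReal (n * (2 * (n * depth c a x))) =
      L * (2 * n ^ 2) := by
    rw [← ENNReal.ofReal_mul (by positivity)]
    have : L / depth c a x * (n * (2 * (n * depth c a x))) =
        ((L * (2 * n ^ 2) : ℝ≥0) : ℝ) := by
      push_cast; field_simp
    rw [this, ENNReal.ofReal_coe_nnreal]
    push_cast
    rfl
  push_cast
  calc _ = (ENNReal.ofReal (L / depth c a x) * ENNReal.ofReal (n * (2 * (n * depth c a x)))) *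
        ((A : ℝ≥0∞) ^ (4 * n + 2) * B *
        (⨍⁻ z in reflectedCube c a x, ‖gradient φ z‖ₑ ^ p ∂μ) ^ (1 / p)) := by
        simp only [reflectedCube]; ring
    _ = _ := by rw [e]; ring

end GradientBound

/-! ### Integrating averages over reflected cubes. -/

section Fubini

variable {n : ℕ} {c x y z : Eucl n} {a b : ℝ} {μ : Measure (Eucl n)} {A : ℝ≥0}

/-- The points of `cube c (2 * a)` whose reflected cubes lie well inside `shell c a b`. -/
def innerLayer (c : Eucl n) (a b : ℝ) : Set (Eucl n) :=
  {x | x ∈ cube c (2 * a) ∧ 18 * n * depth c a x ≤ b}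

theorem measurable_depth : Measurable (depth c a) := by
  unfold depth
  fun_prop

theorem measurableSet_innerLayer : MeasurableSet (innerLayer c a b) :=
  (measurableSet_cube _ _).inter
    (measurableSet_le (measurable_depth.const_mul _) measurable_const)

/-- Integrating averages over reflected cubes. -/
theorem IsDoubling.lintegral_setLAverage_reflectedCube_le (h : IsDoubling μ A) (hn : 0 < n)
    (ha : 0 < a) (hba : b ≤ a) {g : Eucl n → ℝ≥0∞} (hg : Measurable g) :
    ∫⁻ x in innerLayer c a b, (⨍⁻ z in reflectedCube c a x, g z ∂μ) ∂μ ≤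
      (A : ℝ≥0∞) ^ 7 * ∫⁻ z in shell c a b, g z ∂μ := by
  have := h.isLocallyFiniteMeasure
  -- If `y` is in the reflected cube of `x`, then `x` is within `9 * n * depth` of `y`, while `y` is
  -- more than `n * depth` outside the hole. So `U` contains all relevant pairs. Its slices in `x`
  -- are cubes around `y`, whose measure `M y` replaces that of the reflected cube and cancels after
  -- Tonelli.
  let U : Set (Eucl n × Eucl n) := {q | supNorm (q.1 - q.2) < 9 * (supNorm (q.2 - c) - a)}
  have hU : MeasurableSet U :=
    (isOpen_lt (continuous_supNorm.comp (by fun_prop))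
      (continuous_const.mul ((continuous_supNorm.comp (by fun_prop)).sub
        continuous_const))).measurableSet
  let M : Eucl n → ℝ≥0∞ := fun y => μ ((fun x => (x, y)) ⁻¹' U)
  have hM : Measurable M := measurable_measure_prodMk_right hU
  let G : Eucl n → ℝ≥0∞ := (shell c a b).indicator fun y => (M y)⁻¹ * g y
  have hG : Measurable G := (hM.inv.mul hg).indicator (isOpen_shell c a b).measurableSet
  have hslice : ∀ {y}, a < supNorm (y - c) →
      (fun x => (x, y)) ⁻¹' U = cube y (2 * (9 * (supNorm (y - c) - a))) := fun {y} hy => by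
    ext x
    rw [mem_cube_two_mul_iff (by linarith)]
    rfl
  have hpt : ∀ x ∈ innerLayer c a b, (⨍⁻ z in reflectedCube c a x, g z ∂μ) ≤
      (A : ℝ≥0∞) ^ 7 * ∫⁻ y, U.indicator (fun q => G q.2) (x, y) ∂μ := by
    rintro x ⟨hx, hxb⟩
    have hd := depth_pos hn hx
    have hG0 : μ (reflectedCube c a x) ≠ 0 := h.measure_ne_zero _ (by positivity)
    rw [setLAverage_eq_inv_mul, ← lintegral_const_mul' _ _ (ENNReal.inv_ne_top.2 hG0), ← lintegral_indicator measurableSet_reflectedCube,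
      ← lintegral_const_mul' _ _ (by finiteness)]
    refine lintegral_mono fun y => ?_
    by_cases hy : y ∈ reflectedCube c a x
    swap
    · rw [Set.indicator_of_notMem hy]; exact zero_le
    have hys := reflectedCube_subset_shell hn ha hba hx hxb hy
    have hyb := supNorm_of_mem_reflectedCube hn ha hx (hxb.trans hba) hy
    have hyr := (mem_reflectedCube_iff hn hx).1 hy
    have h1 := supNorm_reflection_sub_self_le hn ha hx
    have h2 := supNorm_sub_le x (reflection c a x) y
    rw [supNorm_sub_comm x (reflection c a x), supNorm_sub_comm (reflection c a x) y] at h2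
    have hxy : (x, y) ∈ U := by
      change supNorm (x - y) < 9 * (supNorm (y - c) - a)
      linarith [hyb.1]
    rw [Set.indicator_of_mem hy, Set.indicator_of_mem hxy]
    simp only [G]
    rw [Set.indicator_of_mem hys, ← mul_assoc]
    gcongr
    simp only [M]
    rw [hslice hys.1]
    have hpos : 0 < 2 * (9 * (supNorm (y - c) - a)) := by linarith [hys.1]
    -- In units of `n * depth` the centres are at distance at most `1` and the slice has half side
    -- at most `81`; `82 ≤ 2 ^ 7`.
    refine ENNReal.inv_le_mul_inv (h.measure_cube_le hpos (by positivity) 7 ?_)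
      (h.measure_ne_zero _ hpos) (h.measure_ne_top _ hpos)
    have : 0 < n * depth c a x := by positivity
    linarith [hyb.2]
  calc _ ≤ ∫⁻ x in innerLayer c a b,
        (A : ℝ≥0∞) ^ 7 * ∫⁻ y, U.indicator (fun q => G q.2) (x, y) ∂μ ∂μ :=
        setLIntegral_mono' measurableSet_innerLayer hpt
    _ ≤ ∫⁻ x, (A : ℝ≥0∞) ^ 7 * ∫⁻ y, U.indicator (fun q => G q.2) (x, y) ∂μ ∂μ :=
        setLIntegral_le_lintegral _ _
    _ = (A : ℝ≥0∞) ^ 7 * ∫⁻ y, ∫⁻ x, U.indicator (fun q => G q.2) (x, y) ∂μ ∂μ := by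
        rw [lintegral_const_mul' _ _ (by finiteness), lintegral_lintegral_swap]
        exact ((hG.comp measurable_snd).indicator hU).aemeasurable
    _ = (A : ℝ≥0∞) ^ 7 * ∫⁻ y, G y * M y ∂μ := by
        congr 2
        ext y
        have : ∀ x, U.indicator (fun q => G q.2) (x, y) =
            ((fun x => (x, y)) ⁻¹' U).indicator (fun _ => G y) x := fun x => by
          simp only [Set.indicator, Set.mem_preimage]
        simp only [this]
        rw [lintegral_indicator_const (measurable_prodMk_right hU)]
    _ ≤ _ := by
        rw [← lintegral_indicator (isOpen_shell c a b).measurableSet]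
        gcongr with y
        simp only [G]
        by_cases hy : y ∈ shell c a b
        · rw [Set.indicator_of_mem hy, Set.indicator_of_mem hy]
          calc (M y)⁻¹ * g y * M y = (M y)⁻¹ * M y * g y := by ring
            _ ≤ 1 * g y := by gcongr; exact ENNReal.inv_mul_le_one _
            _ = g y := one_mul _
        · rw [Set.indicator_of_notMem hy, zero_mul]
          exact zero_le

end Fubini

/-! ### Chains of cubes along the shell. -/

section Chain

variable {n : ℕ} {c x y y' z : Eucl n} {a b r : ℝ} {μ : Measure (Eucl n)} {A B : ℝ≥0}
  {f φ : Eucl n → ℝ} {p : ℝ} {j : ℕ}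

theorem _root_.MeasureTheory.enorm_setAverage_sub_le {X : Type*} [MeasurableSpace X]
    {μ : Measure X} {s t : Set X} {f : X → ℝ} (hst : s ⊆ t) (hf : IntegrableOn f t μ)
    {D : ℝ≥0∞} (hD : μ t ≤ D * μ s) (h0 : μ s ≠ 0) (ht : μ t ≠ ⊤) (m : ℝ) :
    ‖⨍ x in s, f x ∂μ - m‖ₑ ≤ D * ⨍⁻ x in t, ‖f x - m‖ₑ ∂μ := by
  have hs : μ s ≠ ⊤ := ne_top_of_le_ne_top ht (measure_mono hst)
  have hp := isProbabilityMeasure_normalizedRestrict h0 hs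
  refine le_trans ?_ (setLAverage_le_mul_of_subset hst hD
    (fun h => h0 (measure_mono_null hst h)) ht)
  have hi : Integrable f (normalizedRestrict μ s) :=
    (hf.mono_set hst).smul_measure (ENNReal.inv_ne_top.2 h0)
  have e : ⨍ x in s, f x ∂μ - m = ∫ x, (f x - m) ∂normalizedRestrict μ s := by
    rw [integral_sub hi (integrable_const m), integral_const, probReal_univ, one_smul,
      average_eq', Measure.restrict_apply_univ]
    rfl
  rw [e, setLAverage_eq_lintegral_normalizedRestrict]
  exact enorm_integral_le_lintegral_enorm _

theorem cube_subset_shell (hb : 0 < b) (hy : supNorm (y - c) = a + b / 2) :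
    cube y b ⊆ shell c a b := by
  intro z hz
  rw [mem_cube_iff hb] at hz
  have h1 := supNorm_sub_le z y c
  have h2 := supNorm_sub_le y z c
  rw [supNorm_sub_comm y z] at h2
  exact ⟨by linarith, by linarith⟩

/-- The average of the `p`-th power of the gradient, normalized by the measure of the hole. -/
noncomputable def shellEnergy (μ : Measure (Eucl n)) (c : Eucl n) (a b : ℝ)
    (g : Eucl n → ℝ≥0∞) : ℝ≥0∞ :=
  (μ (cube c (2 * a)))⁻¹ * ∫⁻ z in shell c a b, g z ∂μ

/-- Enlarging the cube of side `b` by `2 ^ (j + 3)` covers the hole. This is the source of the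
factor `A ^ j`. -/
theorem IsDoubling.setLAverage_cube_le_shellEnergy (h : IsDoubling μ A) (ha : 0 < a) (hb : 0 < b)
    (hba : b ≤ a) (hj : a ≤ 2 ^ j * b) (hy : supNorm (y - c) = a + b / 2)
    (g : Eucl n → ℝ≥0∞) :
    ⨍⁻ z in cube y b, g z ∂μ ≤ (A : ℝ≥0∞) ^ (j + 3) * shellEnergy μ c a b g := by
  rw [setLAverage_eq_inv_mul, shellEnergy, ← mul_assoc]
  refine mul_le_mul' (ENNReal.inv_le_mul_inv (h.measure_cube_le (by positivity) hb _ ?_)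
    (h.measure_ne_zero _ (by positivity)) (h.measure_ne_top _ (by positivity)))
    (lintegral_mono_set (cube_subset_shell hb hy))
  rw [supNorm_sub_comm, hy, pow_add]
  linarith

/-- The oscillation bound which holds on every cube of side `b` in the middle of the shell. -/
noncomputable def shellOscillation (p : ℝ) (μ : Measure (Eucl n)) (A B : ℝ≥0) (c : Eucl n)
    (a b : ℝ) (j : ℕ) (φ : Eucl n → ℝ) : ℝ≥0∞ :=
  B * ENNReal.ofReal (n * b) *
    ((A : ℝ≥0∞) ^ (j + 3) * shellEnergy μ c a b fun z => ‖gradient φ z‖ₑ ^ p) ^ (1 / p)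

theorem setLAverage_cube_le_shellOscillation (hp : 1 ≤ p) (h : IsDoubling μ A)
    (hP : SatisfiesPoincare p μ B) (hφ : ContDiff ℝ ∞ φ) (hc : HasCompactSupport φ) (ha : 0 < a)
    (hb : 0 < b) (hba : b ≤ a) (hj : a ≤ 2 ^ j * b) (hy : supNorm (y - c) = a + b / 2) :
    ⨍⁻ x in cube y b, ‖φ x - ⨍ z in cube y b, φ z ∂μ‖ₑ ∂μ ≤
      shellOscillation p μ A B c a b j φ := by
  refine (hP.setLAverage_le hφ hc y hb).trans ?_
  unfold shellOscillation
  gcongr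
  exact h.setLAverage_cube_le_shellEnergy ha hb hba hj hy _

/-- Both cubes contain the cube of side `b / 2` around `y'`, and both means are compared with the
mean over it. -/
theorem edist_setAverage_cube_le (hp : 1 ≤ p) (h : IsDoubling μ A)
    (hP : SatisfiesPoincare p μ B) (hφ : ContDiff ℝ ∞ φ) (hc : HasCompactSupport φ) (ha : 0 < a)
    (hb : 0 < b) (hba : b ≤ a) (hj : a ≤ 2 ^ j * b) (hy : supNorm (y - c) = a + b / 2)
    (hy' : supNorm (y' - c) = a + b / 2) (hyy' : supNorm (y - y') ≤ b / 4) :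
    edist (⨍ z in cube y b, φ z ∂μ) (⨍ z in cube y' b, φ z ∂μ) ≤
      2 * (A : ℝ≥0∞) ^ 2 * shellOscillation p μ A B c a b j φ := by
  have := h.isLocallyFiniteMeasure
  have hint : ∀ w : Eucl n, IntegrableOn φ (cube w b) μ := fun w =>
    (hφ.continuous.locallyIntegrable).integrableOn_of_isBounded (isBounded_cube w hb)
  have key : ∀ w : Eucl n, supNorm (w - c) = a + b / 2 → supNorm (w - y') ≤ b / 4 →
      edist (⨍ z in cube y' (b / 2), φ z ∂μ) (⨍ z in cube w b, φ z ∂μ) ≤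
        (A : ℝ≥0∞) ^ 2 * shellOscillation p μ A B c a b j φ := by
    intro w hw hwy
    rw [edist_eq_enorm_sub]
    refine (enorm_setAverage_sub_le (t := cube w b) ?_ (hint w) (D := (A : ℝ≥0∞) ^ 2) ?_
      (h.measure_ne_zero _ (by positivity)) (h.measure_ne_top _ hb) _).trans ?_
    · refine cube_subset_cube (by positivity) hb ?_
      rw [supNorm_sub_comm]
      linarith
    · refine h.measure_cube_le hb (by positivity) 2 ?_
      linarith
    · gcongr
      exact setLAverage_cube_le_shellOscillation hp h hP hφ hc ha hb hba hj hw
  have h1 := key y hy hyy'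
  have h2 := key y' hy' (by simpa using by positivity)
  rw [edist_comm] at h1
  calc _ ≤ _ := edist_triangle _ (⨍ z in cube y' (b / 2), φ z ∂μ) _
    _ ≤ _ := add_le_add h1 h2
    _ = _ := by ring

/-- The common extremal coordinate puts both points on one face of the sphere of the maximum norm,
and a face is convex. Chains may thus run along segments. -/
theorem supNorm_lineMap_eq {i : Fin n} (hy : supNorm (y - c) = r) (hy' : supNorm (y' - c) = r)
    (hi : y i = y' i) (hir : |y i - c i| = r) {t : ℝ} (ht : t ∈ Set.Icc (0 : ℝ) 1) :
    supNorm (y + t • (y' - y) - c) = r := by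
  apply le_antisymm
  · have e : y + t • (y' - y) - c = (1 - t) • (y - c) + t • (y' - c) := by module
    rw [e]
    refine (supNorm_add_le _ _).trans ?_
    rw [supNorm_smul, supNorm_smul, hy, hy', abs_of_nonneg ht.1, abs_of_nonneg (by linarith [ht.2])]
    linarith
  · have h := abs_apply_le_supNorm (y + t • (y' - y) - c) i
    have e : (y + t • (y' - y) - c) i = y i - c i := by
      simp [hi]
    rwa [e, hir] at h

theorem edist_setAverage_cube_le_of_face (hp : 1 ≤ p) (h : IsDoubling μ A)
    (hP : SatisfiesPoincare p μ B) (hφ : ContDiff ℝ ∞ φ) (hc : HasCompactSupport φ) (ha : 0 < a)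
    (hb : 0 < b) (hba : b ≤ a) (hj : a ≤ 2 ^ j * b) (hy : supNorm (y - c) = a + b / 2)
    (hy' : supNorm (y' - c) = a + b / 2) {i : Fin n} (hi : y i = y' i)
    (hir : |y i - c i| = a + b / 2) :
    edist (⨍ z in cube y b, φ z ∂μ) (⨍ z in cube y' b, φ z ∂μ) ≤
      (12 * 2 ^ j : ℕ) * (2 * (A : ℝ≥0∞) ^ 2 * shellOscillation p μ A B c a b j φ) := by
  -- The segment has length at most `3 * a ≤ 3 * 2 ^ j * b` and each step may have length `b / 4`.
  set N : ℕ := 12 * 2 ^ j with hN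
  have hN0 : (0 : ℝ) < N := by positivity
  let w : ℕ → Eucl n := fun k => y + ((k : ℝ) / N) • (y' - y)
  have hw : ∀ k ≤ N, supNorm (w k - c) = a + b / 2 := fun k hk =>
    supNorm_lineMap_eq hy hy' hi hir ⟨by positivity, by
      rw [div_le_one hN0]; exact_mod_cast hk⟩
  have hlen : supNorm (y - y') ≤ 3 * a := by
    have := supNorm_sub_le y c y'
    rw [supNorm_sub_comm c y'] at this
    linarith
  have hstep : ∀ k, supNorm (w k - w (k + 1)) ≤ b / 4 := fun k => by
    have e : w k - w (k + 1) = (1 / (N : ℝ)) • (y - y') := by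
      simp only [w]
      push_cast
      module
    rw [e, supNorm_smul, abs_of_pos (by positivity), one_div_mul_eq_div, div_le_iff₀ hN0, hN]
    push_cast
    linarith
  have h0 : w 0 = y := by simp [w]
  have h1 : w N = y' := by simp [w, hN0.ne']
  have h2 := edist_le_range_sum_edist (fun k => ⨍ z in cube (w k) b, φ z ∂μ) N
  simp only [h0, h1] at h2
  refine h2.trans ((Finset.sum_le_card_nsmul _ _
    (2 * (A : ℝ≥0∞) ^ 2 * shellOscillation p μ A B c a b j φ) fun k hk => ?_).trans
    (le_of_eq (by simp)))
  rw [Finset.mem_range] at hk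
  exact edist_setAverage_cube_le hp h hP hφ hc ha hb hba hj (hw k hk.le) (hw (k + 1) hk) (hstep k)

/-- The corner `c + r (1, …, 1)`. -/
noncomputable def corner (c : Eucl n) (r : ℝ) : Eucl n := WithLp.toLp 2 fun i => c i + r

theorem corner_apply (c : Eucl n) (r : ℝ) (i : Fin n) : corner c r i = c i + r := rfl

theorem supNorm_corner_sub (hn : 0 < n) (hr : 0 ≤ r) : supNorm (corner c r - c) = r := by
  apply le_antisymm
  · rw [supNorm_le_iff hr]
    intro i
    simp [corner_apply, abs_of_nonneg hr]
  · have := abs_apply_le_supNorm (corner c r - c) ⟨0, hn⟩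
    simpa [corner_apply, abs_of_nonneg hr] using this

/-- Two segments suffice. The first stays on a face containing `y`, fixing coordinate `i` and moving
all others to their corner values; the second fixes such another coordinate `k` and corrects `i`.
The coordinate `k` exists because `n ≥ 2`. -/
theorem edist_setAverage_cube_corner_le (hn : 2 ≤ n) (hp : 1 ≤ p) (h : IsDoubling μ A)
    (hP : SatisfiesPoincare p μ B) (hφ : ContDiff ℝ ∞ φ) (hc : HasCompactSupport φ) (ha : 0 < a)
    (hb : 0 < b) (hba : b ≤ a) (hj : a ≤ 2 ^ j * b) (hy : supNorm (y - c) = a + b / 2) :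
    edist (⨍ z in cube y b, φ z ∂μ) (⨍ z in cube (corner c (a + b / 2)) b, φ z ∂μ) ≤
      48 * 2 ^ j * (A : ℝ≥0∞) ^ 2 * shellOscillation p μ A B c a b j φ := by
  set r := a + b / 2 with hr
  have hr0 : 0 < r := by positivity
  obtain ⟨i, hi⟩ : ∃ i, |y i - c i| = r := by
    by_contra! hne
    have : supNorm (y - c) < r := (supNorm_lt_iff hr0).2 fun i =>
      lt_of_le_of_ne (hy ▸ abs_apply_le_supNorm (y - c) i) (hne i)
    exact absurd hy this.ne
  have : Nontrivial (Fin n) := Fin.nontrivial_iff_two_le.2 hn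
  obtain ⟨k, hk⟩ := exists_ne i
  set y' : Eucl n := WithLp.toLp 2 fun l => if l = i then y i else c l + r with hy'
  have hy'i : y' i = y i := by simp [hy']
  have hy'k : y' k = corner c r k := by simp [hy', hk, corner_apply]
  have hy's : supNorm (y' - c) = r := by
    apply le_antisymm
    · rw [supNorm_le_iff hr0.le]
      intro l
      by_cases hl : l = i
      · subst hl
        rw [PiLp.sub_apply, hy'i, hi]
      · simp [hy', hl, abs_of_pos hr0]
    · have := abs_apply_le_supNorm (y' - c) i
      rwa [PiLp.sub_apply, hy'i, hi] at this
  have h1 := edist_setAverage_cube_le_of_face hp h hP hφ hc ha hb hba hj hy hy's hy'i.symm hi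
  have h2 := edist_setAverage_cube_le_of_face hp h hP hφ hc ha hb hba hj hy's
    (supNorm_corner_sub (by omega) hr0.le) hy'k (by
      rw [hy'k, corner_apply, add_sub_cancel_left, abs_of_pos hr0])
  refine (edist_triangle _ _ _).trans ((add_le_add h1 h2).trans (le_of_eq ?_))
  push_cast
  ring

/-- The witness is the radial projection of the reflection to the middle of the shell. The cube of
side `b` around it contains the reflected cube, which links averages at `x` to the chain. -/
theorem supNorm_smul_reflection_sub (hn : 0 < n) (ha : 0 < a) (hb : 0 < b) (hba : b ≤ a)
    (hx : x ∈ innerLayer c a b) : ∃ y : Eucl n, supNorm (y - c) = a + b / 2 ∧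
      supNorm (y - reflection c a x) + 2 * n * depth c a x ≤ b / 2 := by
  obtain ⟨hx, hxb⟩ := hx
  have hd := depth_pos hn hx
  have hnd : 0 < n * depth c a x := by positivity
  have h1 := le_supNorm_reflection_sub hn ha hx (hxb.trans hba)
  have h2 := supNorm_reflection_sub_le hn ha hx
  set s := supNorm (reflection c a x - c) with hs
  have hs0 : 0 < s := by linarith
  refine ⟨c + ((a + b / 2) / s) • (reflection c a x - c), ?_, ?_⟩
  · rw [add_sub_cancel_left, supNorm_smul, abs_of_pos (by positivity), ← hs]
    field_simp
  · have e : c + ((a + b / 2) / s) • (reflection c a x - c) - reflection c a x =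
        ((a + b / 2) / s - 1) • (reflection c a x - c) := by module
    have h3 : 1 ≤ (a + b / 2) / s := by
      rw [one_le_div hs0]; linarith
    rw [e, supNorm_smul, abs_of_nonneg (by linarith), ← hs, sub_mul, div_mul_cancel₀ _ hs0.ne']
    linarith

/-- In the transition region the averages differ little from the average over the corner cube. -/
theorem enorm_layerAverage_sub_corner_le (hn : 2 ≤ n) (hp : 1 ≤ p) (h : IsDoubling μ A)
    (hP : SatisfiesPoincare p μ B) (hf : LocallyIntegrable f μ)
    (hφ : ContDiff ℝ ∞ φ) (hc : HasCompactSupport φ) (ha : 0 < a)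
    (hb : 0 < b) (hba : b ≤ a) (hj : a ≤ 2 ^ j * b) (hfφ : ∀ z ∈ shell c a b, f z = φ z)
    (hx : x ∈ innerLayer c a b) (hxb : b ≤ 36 * n * depth c a x) :
    ‖layerAverage μ c a f x - ⨍ z in cube (corner c (a + b / 2)) b, f z ∂μ‖ₑ ≤
      ((A : ℝ≥0∞) ^ (2 * n + 7) + 48 * 2 ^ j * (A : ℝ≥0∞) ^ 2) *
        shellOscillation p μ A B c a b j φ := by
  have hn0 : 0 < n := by omega
  obtain ⟨y, hy, hyx⟩ := supNorm_smul_reflection_sub hn0 ha hb hba hx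
  have hd := depth_pos hn0 hx.1
  have hnd : 0 < n * depth c a x := by positivity
  have hav : ∀ w : Eucl n, supNorm (w - c) = a + b / 2 →
      ⨍ z in cube w b, f z ∂μ = ⨍ z in cube w b, φ z ∂μ := fun w hw =>
    setAverage_congr_fun (measurableSet_cube _ _) (Eventually.of_forall fun z hz =>
      hfφ z (cube_subset_shell hb hw hz))
  have hr : (0 : ℝ) ≤ a + b / 2 := by positivity
  rw [hav _ (supNorm_corner_sub hn0 hr), ← edist_eq_enorm_sub]
  refine (edist_triangle _ (⨍ z in cube y b, φ z ∂μ) _).trans ?_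
  rw [add_mul]
  refine add_le_add ?_ (edist_setAverage_cube_corner_le hn hp h hP hφ hc ha hb hba hj hy)
  rw [edist_eq_enorm_sub]
  have hsub : reflectedCube c a x ⊆ cube y b :=
    cube_subset_cube (by positivity) hb (by
      rw [supNorm_sub_comm]; linarith)
  have hmass : μ (cube y b) ≤ (A : ℝ≥0∞) ^ (2 * n + 7) *
      ENNReal.ofReal (layerIntegral μ c a (fun _ => 1) x) := by
    refine (h.measure_cube_le hb (ℓ' := depth c a x / n) (c' := reflection c a x)
      (by positivity) (2 * n + 7) ?_).trans ?_
    · have h2 : (n : ℝ) ≤ 2 ^ n := by exact_mod_cast Nat.lt_two_pow_self.le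
      -- In the transition region `b` is comparable with the depth, so no power of `2 ^ j` is lost
      -- here.
      have h3 : 36 * n * depth c a x ≤ 2 ^ (2 * n + 7) * (depth c a x / n / 2) := by
        rw [div_div, mul_div_assoc', le_div_iff₀ (by positivity), pow_add, pow_mul']
        have : (n : ℝ) ^ 2 ≤ (2 ^ n) ^ 2 := by gcongr
        calc _ = 72 * (n : ℝ) ^ 2 * depth c a x := by ring
          _ ≤ 128 * (2 ^ n) ^ 2 * depth c a x := by gcongr; norm_num
          _ = _ := by ring
      linarith
    · gcongr
      exact h.measure_cube_le_layerIntegral hn0 hx.1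
  refine (h.enorm_layerAverage_sub_le hn0 hf hx.1 _ hsub (measurableSet_cube _ _) hmass
    (h.measure_ne_zero _ hb) (h.measure_ne_top _ hb)).trans ?_
  gcongr
  rw [setLAverage_congr_fun (g := fun z => ‖φ z - ⨍ z in cube y b, φ z ∂μ‖ₑ)
    (measurableSet_cube _ _) fun z hz => by simp only [hfφ z (cube_subset_shell hb hy hz)]]
  exact setLAverage_cube_le_shellOscillation hp h hP hφ hc ha hb hba hj hy

end Chain

/-! ### Filling the hole. -/

section Fill

variable {n : ℕ} {c x y z : Eucl n} {a b r : ℝ} {μ : Measure (Eucl n)} {A B : ℝ≥0}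
  {f φ : Eucl n → ℝ} {p : ℝ} {j : ℕ}

theorem exists_smoothTransition_lipschitz : ∃ S : ℝ≥0, ∀ s t : ℝ,
    |Real.smoothTransition s - Real.smoothTransition t| ≤ S * |s - t| := by
  have hd : ContDiff ℝ 1 Real.smoothTransition := Real.smoothTransition.contDiff (n := 1)
  have hs : HasCompactSupport (deriv Real.smoothTransition) := by
    refine HasCompactSupport.intro (isCompact_Icc (a := 0) (b := 1)) fun x hx => ?_
    rw [Set.mem_Icc, not_and_or, not_le, not_le] at hx
    rcases hx with hx | hx
    · have : Real.smoothTransition =ᶠ[𝓝 x] fun _ => 0 := by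
        filter_upwards [gt_mem_nhds hx] with y hy
        exact Real.smoothTransition.zero_of_nonpos hy.le
      rw [this.deriv_eq, deriv_const]
    · have : Real.smoothTransition =ᶠ[𝓝 x] fun _ => 1 := by
        filter_upwards [lt_mem_nhds hx] with y hy
        exact Real.smoothTransition.one_of_one_le hy.le
      rw [this.deriv_eq, deriv_const]
  obtain ⟨S, hS⟩ := hs.exists_bound_of_continuous (hd.continuous_deriv le_rfl)
  refine ⟨S.toNNReal, fun s t => ?_⟩
  have := lipschitzWith_of_nnnorm_deriv_le (C := S.toNNReal) (hd.differentiable one_ne_zero)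
    fun x => by
      rw [← NNReal.coe_le_coe, coe_nnnorm]
      exact (hS x).trans (Real.le_coe_toNNReal S)
  simpa [Real.dist_eq] using this.dist_le_mul s t

/-- A smooth cutoff on `cube c (2 * a)` which is `1` where the depth is large and `0` where it is
small, the scale being `b`. -/
noncomputable def cutoff (c : Eucl n) (a b : ℝ) (x : Eucl n) : ℝ :=
  Real.smoothTransition (36 * n * depth c a x / b - 1)

theorem cutoff_eq_zero (hb : 0 < b) (h : 36 * n * depth c a x ≤ b) : cutoff c a b x = 0 :=
  Real.smoothTransition.zero_of_nonpos (by
    rw [sub_nonpos, div_le_one hb]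
    exact h)

theorem cutoff_eq_one (hb : 0 < b) (h : b ≤ 18 * n * depth c a x) : cutoff c a b x = 1 :=
  Real.smoothTransition.one_of_one_le (by
    rw [le_sub_iff_add_le, le_div_iff₀ hb]
    linarith)

theorem cutoff_nonneg : 0 ≤ cutoff c a b x := Real.smoothTransition.nonneg _

theorem cutoff_le_one : cutoff c a b x ≤ 1 := Real.smoothTransition.le_one _

theorem contDiffOn_cutoff (hn : 0 < n) : ContDiffOn ℝ ∞ (cutoff c a b) (cube c (2 * a)) :=
  Real.smoothTransition.contDiff.comp_contDiffOn
    (((contDiffOn_const.mul (contDiffOn_depth hn)).div_const b).sub contDiffOn_const)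

theorem exists_norm_fderiv_cutoff_le (n : ℕ) : ∃ S : ℝ≥0, ∀ {c x : Eucl n} {a b : ℝ}, 0 < n →
    0 < b → x ∈ cube c (2 * a) → ‖fderiv ℝ (cutoff c a b) x‖ ≤ S / b := by
  obtain ⟨S, hS⟩ := exists_smoothTransition_lipschitz
  refine ⟨S * (72 * n ^ 2), fun {c x a b} hn hb hx => ?_⟩
  refine norm_fderiv_le_of_lip' ℝ (by positivity) ?_
  filter_upwards [(isOpen_cube c (2 * a)).mem_nhds hx] with y hy
  rw [Real.norm_eq_abs]
  refine (hS _ _).trans ?_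
  have e : 36 * n * depth c a y / b - 1 - (36 * n * depth c a x / b - 1) =
      36 * n / b * (depth c a y - depth c a x) := by ring
  rw [e, abs_mul, abs_of_nonneg (by positivity)]
  have h1 := abs_depth_sub_le hn hy hx
  have h2 := supNorm_le_norm (y - x)
  calc S * (36 * n / b * |depth c a y - depth c a x|)
      ≤ S * (36 * n / b * (2 * n * ‖y - x‖)) := by
        gcongr
        exact h1.trans (by gcongr)
    _ = _ := by push_cast; ring

/-- The extension of `f` from the shell into the hole `cube c (2 * a)`. -/
noncomputable def fill (μ : Measure (Eucl n)) (c : Eucl n) (a b : ℝ) (f : Eucl n → ℝ)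
    (x : Eucl n) : ℝ :=
  (1 - cutoff c a b x) * layerAverage μ c a f x +
    cutoff c a b x * ⨍ z in cube (corner c (a + b / 2)) b, f z ∂μ

theorem IsDoubling.contDiffOn_fill (h : IsDoubling μ A) (hn : 0 < n)
    (hf : LocallyIntegrable f μ) : ContDiffOn ℝ ∞ (fill μ c a b f) (cube c (2 * a)) :=
  ((contDiffOn_const.sub (contDiffOn_cutoff hn)).mul (h.contDiffOn_layerAverage hn hf)).add
    ((contDiffOn_cutoff hn).mul contDiffOn_const)

/-- Discarding the root of factors that are at least `1` keeps the constants independent of `p`. -/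
theorem _root_.ENNReal.one_le_mul_rpow_le {x y : ℝ≥0∞} (hx : 1 ≤ x) (hp : 1 ≤ p) :
    (x * y) ^ (1 / p) ≤ x * y ^ (1 / p) := by
  have hp0 : 0 < p := by linarith
  rw [ENNReal.mul_rpow_of_nonneg _ _ (by positivity)]
  gcongr
  calc x ^ (1 / p) ≤ x ^ (1 : ℝ) :=
        ENNReal.rpow_le_rpow_of_exponent_le hx (by rw [div_le_one hp0]; exact hp)
    _ = x := ENNReal.rpow_one x

/-- Integrating pointwise bounds by local and global averages over the hole. -/
theorem IsDoubling.lintegral_rpow_le (h : IsDoubling μ A) (hn : 0 < n) (hp : 1 ≤ p)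
    (ha : 0 < a) (hba : b ≤ a) {g F : Eucl n → ℝ≥0∞} (hg : Measurable g) {D₁ D₂ : ℝ≥0∞}
    (hD₁ : D₁ ≠ ⊤)
    (hF : ∀ x ∈ cube c (2 * a), F x ≤ (innerLayer c a b).indicator
      (fun x => D₁ * (⨍⁻ z in reflectedCube c a x, g z ∂μ) ^ (1 / p)) x +
        D₂ * shellEnergy μ c a b g ^ (1 / p)) :
    (∫⁻ x in cube c (2 * a), F x ^ p ∂μ) ^ (1 / p) ≤
      2 * ((A : ℝ≥0∞) ^ 7 * D₁ + D₂) * (∫⁻ z in shell c a b, g z ∂μ) ^ (1 / p) := by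
  have hp0 : 0 < p := by linarith
  have hpp : 1 / p * p = 1 := by field_simp
  have hA : (1 : ℝ≥0∞) ≤ (A : ℝ≥0∞) ^ 7 := one_le_pow₀ (by exact_mod_cast h.one_le)
  have h0 := h.measure_ne_zero c (ℓ := 2 * a) (by positivity)
  have ht := h.measure_ne_top c (ℓ := 2 * a) (by positivity)
  have hrt : ∀ u v : ℝ≥0∞, (u * v ^ (1 / p)) ^ p = u ^ p * v := fun u v => by
    rw [ENNReal.mul_rpow_of_nonneg _ _ hp0.le, ← ENNReal.rpow_mul, hpp, ENNReal.rpow_one]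
  set I := ∫⁻ z in shell c a b, g z ∂μ with hI
  have key : ∫⁻ x in cube c (2 * a), F x ^ p ∂μ ≤
      (2 * ((A : ℝ≥0∞) ^ 7 * D₁ + D₂)) ^ p * I := by
    calc ∫⁻ x in cube c (2 * a), F x ^ p ∂μ
        ≤ ∫⁻ x in cube c (2 * a), 2 ^ (p - 1) * ((innerLayer c a b).indicator
            (fun x => D₁ ^ p * ⨍⁻ z in reflectedCube c a x, g z ∂μ) x +
              D₂ ^ p * shellEnergy μ c a b g) ∂μ := by
          refine setLIntegral_mono' (measurableSet_cube _ _) fun x hx => ?_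
          refine (ENNReal.rpow_le_rpow (hF x hx) hp0.le).trans ?_
          refine (ENNReal.rpow_add_le_mul_rpow_add_rpow _ _ hp).trans ?_
          rw [hrt]
          gcongr
          by_cases hxl : x ∈ innerLayer c a b
          · rw [Set.indicator_of_mem hxl, Set.indicator_of_mem hxl, hrt]
          · rw [Set.indicator_of_notMem hxl, Set.indicator_of_notMem hxl,
              ENNReal.zero_rpow_of_pos hp0]
      _ = 2 ^ (p - 1) * (∫⁻ x in cube c (2 * a), (innerLayer c a b).indicator
            (fun x => D₁ ^ p * ⨍⁻ z in reflectedCube c a x, g z ∂μ) x ∂μ +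
              D₂ ^ p * I) := by
          -- Integrating the constant `shellEnergy` over the hole undoes its normalization by the
          -- measure of the hole.
          rw [lintegral_const_mul' _ _ (ENNReal.rpow_ne_top_of_nonneg (by linarith) (by simp)),
            lintegral_add_right _ measurable_const, setLIntegral_const, shellEnergy]
          congr 2
          calc D₂ ^ p * ((μ (cube c (2 * a)))⁻¹ * I) * μ (cube c (2 * a))
              = D₂ ^ p * I * ((μ (cube c (2 * a)))⁻¹ * μ (cube c (2 * a))) := by ring
            _ = _ := by rw [ENNReal.inv_mul_cancel h0 ht, mul_one]
      _ ≤ 2 ^ p * (D₁ ^ p * ((A : ℝ≥0∞) ^ 7 * I) + D₂ ^ p * I) := by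
          gcongr
          · exact one_le_two
          · linarith
          · refine (setLIntegral_le_lintegral _ _).trans ?_
            rw [lintegral_indicator measurableSet_innerLayer,
              lintegral_const_mul' _ _ (ENNReal.rpow_ne_top_of_nonneg hp0.le hD₁)]
            gcongr
            exact h.lintegral_setLAverage_reflectedCube_le hn ha hba hg
      _ = 2 ^ p * ((A : ℝ≥0∞) ^ 7 * D₁ ^ p + D₂ ^ p) * I := by ring
      _ ≤ 2 ^ p * (((A : ℝ≥0∞) ^ 7 * D₁) ^ p + D₂ ^ p) * I := by
          gcongr
          rw [ENNReal.mul_rpow_of_nonneg _ _ hp0.le]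
          gcongr
          calc (A : ℝ≥0∞) ^ 7 = ((A : ℝ≥0∞) ^ 7) ^ (1 : ℝ) := (ENNReal.rpow_one _).symm
            _ ≤ _ := ENNReal.rpow_le_rpow_of_exponent_le hA hp
      _ ≤ 2 ^ p * ((A : ℝ≥0∞) ^ 7 * D₁ + D₂) ^ p * I := by
          gcongr
          exact ENNReal.add_rpow_le_rpow_add _ _ hp
      _ = _ := by rw [ENNReal.mul_rpow_of_nonneg _ _ hp0.le]
  refine (ENNReal.rpow_le_rpow key (by positivity)).trans (le_of_eq ?_)
  rw [ENNReal.mul_rpow_of_nonneg _ _ (by positivity), ← ENNReal.rpow_mul, mul_comm p, hpp,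
    ENNReal.rpow_one]

/-- The `L^p` bound for the extension into the hole. -/
theorem IsDoubling.lintegral_fill_le (h : IsDoubling μ A) (hn : 2 ≤ n) (hp : 1 ≤ p)
    (ha : 0 < a) (hb : 0 < b) (hba : b ≤ a) (hj : a ≤ 2 ^ j * b) (hf : LocallyIntegrable f μ)
    (hfm : Measurable f) :
    (∫⁻ x in cube c (2 * a), ‖fill μ c a b f x‖ₑ ^ p ∂μ) ^ (1 / p) ≤
      ((4 * A ^ (2 * n + 8) * A ^ j : ℝ≥0) : ℝ≥0∞) *
        (∫⁻ z in shell c a b, ‖f z‖ₑ ^ p ∂μ) ^ (1 / p) := by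
  have hn0 : 0 < n := by omega
  have hp0 : 0 < p := by linarith
  have hA1 : (1 : ℝ≥0∞) ≤ A := by exact_mod_cast h.one_le
  have hr : (0 : ℝ) ≤ a + b / 2 := by positivity
  refine (h.lintegral_rpow_le hn0 hp ha hba (g := fun z => ‖f z‖ₑ ^ p) (by fun_prop)
    (D₁ := (A : ℝ≥0∞) ^ (2 * n + 1)) (D₂ := (A : ℝ≥0∞) ^ (j + 3)) (by finiteness)
    fun x hx => ?_).trans ?_
  · have hd := depth_pos hn0 hx
    have hsz : 0 < 2 * (n * depth c a x) := by positivity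
    refine (enorm_add_le _ _).trans (add_le_add ?_ ?_)
    · by_cases hxl : x ∈ innerLayer c a b
      · rw [Set.indicator_of_mem hxl, enorm_mul]
        have h1 := h.enorm_layerAverage_sub_le hn0 hf hx 0 subset_rfl measurableSet_reflectedCube
          (h.measure_reflectedCube_le_layerIntegral hn0 hx) (h.measure_ne_zero _ hsz)
          (h.measure_ne_top _ hsz)
        simp only [sub_zero] at h1
        have h2 : ‖1 - cutoff c a b x‖ₑ ≤ 1 := by
          rw [Real.enorm_eq_ofReal (sub_nonneg.2 cutoff_le_one)]
          exact ENNReal.ofReal_le_one.2 (by linarith [cutoff_nonneg (c := c) (a := a) (b := b) (x := x)])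
        refine (mul_le_of_le_one_left' h2).trans (h1.trans ?_)
        gcongr
        exact setLAverage_le_rpow hp (h.measure_ne_zero _ hsz) (h.measure_ne_top _ hsz)
          hfm.aestronglyMeasurable
      -- Off the layer the cutoff is `1` and the average term disappears; reflected cubes need not
      -- lie in the shell there.
      · have : b ≤ 18 * n * depth c a x := by
          by_contra hlt
          exact hxl ⟨hx, (not_le.1 hlt).le⟩
        rw [cutoff_eq_one hb this]
        simp
    · rw [enorm_mul]
      have h2 : ‖cutoff c a b x‖ₑ ≤ 1 := by
        rw [Real.enorm_eq_ofReal cutoff_nonneg]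
        exact ENNReal.ofReal_le_one.2 cutoff_le_one
      refine (mul_le_of_le_one_left' h2).trans ?_
      have := h.isLocallyFiniteMeasure
      have hsub := cube_subset_shell (a := a) hb (supNorm_corner_sub (c := c) hn0 hr)
      have h3 := enorm_setAverage_sub_le (μ := μ) (D := 1) subset_rfl
        (hf.integrableOn_of_isBounded (isBounded_cube (corner c (a + b / 2)) hb)) (by simp)
        (h.measure_ne_zero _ hb) (h.measure_ne_top _ hb) 0
      simp only [sub_zero, one_mul] at h3
      refine h3.trans ((setLAverage_le_rpow hp (h.measure_ne_zero _ hb) (h.measure_ne_top _ hb)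
        hfm.aestronglyMeasurable).trans ?_)
      refine le_trans (ENNReal.rpow_le_rpow (h.setLAverage_cube_le_shellEnergy ha hb hba hj
        (supNorm_corner_sub hn0 hr) _) (by positivity)) ?_
      exact ENNReal.one_le_mul_rpow_le (one_le_pow₀ hA1) hp
  · gcongr
    push_cast
    have e1 : (A : ℝ≥0∞) ^ 7 * (A : ℝ≥0∞) ^ (2 * n + 1) ≤ (A : ℝ≥0∞) ^ (2 * n + 8) * (A : ℝ≥0∞) ^ j := by
      rw [← pow_add, ← pow_add]
      exact pow_le_pow_right₀ hA1 (by omega)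
    have e2 : (A : ℝ≥0∞) ^ (j + 3) ≤ (A : ℝ≥0∞) ^ (2 * n + 8) * (A : ℝ≥0∞) ^ j := by
      rw [← pow_add]
      exact pow_le_pow_right₀ hA1 (by omega)
    calc _ ≤ 2 * ((A : ℝ≥0∞) ^ (2 * n + 8) * (A : ℝ≥0∞) ^ j +
          (A : ℝ≥0∞) ^ (2 * n + 8) * (A : ℝ≥0∞) ^ j) := by gcongr
      _ = _ := by ring

/-- Pointwise bound for the gradient of the extension into the hole. -/
theorem exists_enorm_fderiv_fill_le (hn : 2 ≤ n) (A B : ℝ≥0) :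
    ∃ D C : ℝ≥0, ∀ {p : ℝ} {μ : Measure (Eucl n)}, 1 ≤ p → IsDoubling μ A →
      SatisfiesPoincare p μ B → ∀ {f φ : Eucl n → ℝ}, LocallyIntegrable f μ → ContDiff ℝ ∞ φ →
      HasCompactSupport φ → ∀ {c : Eucl n} {a b : ℝ} {j : ℕ}, 0 < a → 0 < b → b ≤ a →
      a ≤ 2 ^ j * b → (∀ z ∈ shell c a b, f z = φ z) → ∀ x ∈ cube c (2 * a),
      ‖fderiv ℝ (fill μ c a b f) x‖ₑ ≤ (innerLayer c a b).indicator (fun x => (D : ℝ≥0∞) *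
        (⨍⁻ z in reflectedCube c a x, ‖gradient φ z‖ₑ ^ p ∂μ) ^ (1 / p)) x +
        ((C * (2 * A) ^ j : ℝ≥0) : ℝ≥0∞) *
          shellEnergy μ c a b (fun z => ‖gradient φ z‖ₑ ^ p) ^ (1 / p) := by
  have hn0 : 0 < n := by omega
  obtain ⟨D, hD⟩ := exists_enorm_fderiv_layerAverage_le_gradient hn A B
  obtain ⟨S, hS⟩ := exists_norm_fderiv_cutoff_le n
  refine ⟨D, S * n * B * (A ^ (2 * n + 7) + 48 * A ^ 2) * A ^ 3,
    fun {p μ} hp h hP {f φ} hf hφ hc {c a b j} ha hb hba hj hfφ x hx => ?_⟩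
  have hA1 : (1 : ℝ≥0∞) ≤ A := by exact_mod_cast h.one_le
  set m := ⨍ z in cube (corner c (a + b / 2)) b, f z ∂μ with hm
  have hnhds := (isOpen_cube c (2 * a)).mem_nhds hx
  have hcd : ContinuousAt (depth c a) x := (contDiffOn_depth hn0).continuousOn.continuousAt hnhds
  by_cases hxl : x ∈ innerLayer c a b
  swap
  -- Deep inside, the filled function is locally constant.
  · have hlt : b < 18 * n * depth c a x := by
      by_contra hlt
      exact hxl ⟨hx, not_lt.1 hlt⟩
    have : fill μ c a b f =ᶠ[𝓝 x] fun _ => m := by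
      filter_upwards [(hcd.const_mul (18 * n)).eventually (lt_mem_nhds hlt)] with y hy
      rw [fill, cutoff_eq_one hb hy.le]
      simp [hm]
    rw [this.fderiv_eq, fderiv_const_apply, ← ofReal_norm, norm_zero, ENNReal.ofReal_zero]
    exact zero_le
  rw [Set.indicator_of_mem hxl]
  have hV := hD h hP hf hφ hc ha hx fun z hz =>
    hfφ z (reflectedCube_subset_shell hn0 ha hba hx hxl.2 hz)
  have hVd : DifferentiableAt ℝ (layerAverage μ c a f) x :=
    ((h.contDiffOn_layerAverage hn0 hf).contDiffAt hnhds).differentiableAt (by simp)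
  have hτd : DifferentiableAt ℝ (cutoff c a b) x :=
    ((contDiffOn_cutoff hn0).contDiffAt hnhds).differentiableAt (by simp)
  -- Near the boundary only the average is present. In the remaining transition region the
  -- derivative of the cutoff also contributes.
  rcases lt_or_ge (36 * n * depth c a x) b with hlt | hge
  · have : fill μ c a b f =ᶠ[𝓝 x] layerAverage μ c a f := by
      filter_upwards [(hcd.const_mul (36 * n)).eventually (gt_mem_nhds hlt)] with y hy
      rw [fill, cutoff_eq_zero hb (le_of_lt hy)]
      simp
    rw [this.fderiv_eq]
    exact hV.trans le_self_add
  have hfd : fderiv ℝ (fill μ c a b f) x = (1 - cutoff c a b x) • fderiv ℝ (layerAverage μ c a f) x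
      + (m - layerAverage μ c a f x) • fderiv ℝ (cutoff c a b) x := by
    have h1 := ((hτd.hasFDerivAt.const_sub 1).mul hVd.hasFDerivAt).add (hτd.hasFDerivAt.mul_const m)
    have h2 : fderiv ℝ (fill μ c a b f) x = _ := h1.fderiv
    rw [h2]
    module
  have hadd := enorm_add_le ((1 - cutoff c a b x) • fderiv ℝ (layerAverage μ c a f) x)
    ((m - layerAverage μ c a f x) • fderiv ℝ (cutoff c a b) x)
  rw [hfd]
  refine hadd.trans (add_le_add ?_ ?_)
  · rw [enorm_smul]
    have h2 : ‖1 - cutoff c a b x‖ₑ ≤ 1 := by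
      rw [Real.enorm_eq_ofReal (sub_nonneg.2 cutoff_le_one)]
      exact ENNReal.ofReal_le_one.2 (by linarith [cutoff_nonneg (c := c) (a := a) (b := b) (x := x)])
    exact (mul_le_of_le_one_left' h2).trans hV
  · rw [enorm_smul]
    have h3 := enorm_layerAverage_sub_corner_le hn hp h hP hf hφ hc ha hb hba hj hfφ hxl hge
    rw [← hm, ← enorm_neg, neg_sub] at h3
    have h4 : ‖fderiv ℝ (cutoff c a b) x‖ₑ ≤ ENNReal.ofReal (S / b) := by
      rw [← ofReal_norm]
      exact ENNReal.ofReal_le_ofReal (hS hn0 hb hx)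
    refine (mul_le_mul' h3 h4).trans ?_
    unfold shellOscillation
    set Φ := shellEnergy μ c a b fun z => ‖gradient φ z‖ₑ ^ p
    -- The diameter in Poincaré for cubes of side `b` compensates the derivative of the cutoff.
    have e : ENNReal.ofReal (n * b) * ENNReal.ofReal (S / b) = S * n := by
      rw [← ENNReal.ofReal_mul (by positivity)]
      have : n * b * (S / b) = ((S * n : ℝ≥0) : ℝ) := by push_cast; field_simp
      rw [this, ENNReal.ofReal_coe_nnreal]
      push_cast
      rfl
    have h5 : (A : ℝ≥0∞) ^ (2 * n + 7) + 48 * 2 ^ j * (A : ℝ≥0∞) ^ 2 ≤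
        2 ^ j * ((A : ℝ≥0∞) ^ (2 * n + 7) + 48 * (A : ℝ≥0∞) ^ 2) := by
      rw [mul_add]
      exact add_le_add (le_mul_of_one_le_left' (one_le_pow₀ one_le_two)) (le_of_eq (by ring))
    have h6 : ((A : ℝ≥0∞) ^ (j + 3) * Φ) ^ (1 / p) ≤ (A : ℝ≥0∞) ^ (j + 3) * Φ ^ (1 / p) :=
      ENNReal.one_le_mul_rpow_le (one_le_pow₀ hA1) hp
    calc _ = (ENNReal.ofReal (n * b) * ENNReal.ofReal (S / b)) * B *
          (((A : ℝ≥0∞) ^ (2 * n + 7) + 48 * 2 ^ j * (A : ℝ≥0∞) ^ 2) *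
            ((A : ℝ≥0∞) ^ (j + 3) * Φ) ^ (1 / p)) := by ring
      _ ≤ (S * n) * B * ((2 ^ j * ((A : ℝ≥0∞) ^ (2 * n + 7) + 48 * (A : ℝ≥0∞) ^ 2)) *
            ((A : ℝ≥0∞) ^ (j + 3) * Φ ^ (1 / p))) := by
          rw [e]
          gcongr
      _ = _ := by
          push_cast
          rw [mul_pow, pow_add]
          ring

/-- The `L^p` bound for the gradient of the extension into the hole. -/
theorem exists_lintegral_fderiv_fill_le (hn : 2 ≤ n) (A B : ℝ≥0) :
    ∃ C : ℝ≥0, ∀ {p : ℝ} {μ : Measure (Eucl n)}, 1 ≤ p → IsDoubling μ A →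
      SatisfiesPoincare p μ B → ∀ {f φ : Eucl n → ℝ}, LocallyIntegrable f μ → ContDiff ℝ ∞ φ →
      HasCompactSupport φ → ∀ {c : Eucl n} {a b : ℝ} {j : ℕ}, 0 < a → 0 < b → b ≤ a →
      a ≤ 2 ^ j * b → (∀ z ∈ shell c a b, f z = φ z) →
      (∫⁻ x in cube c (2 * a), ‖fderiv ℝ (fill μ c a b f) x‖ₑ ^ p ∂μ) ^ (1 / p) ≤
        ((C * (2 * A) ^ j : ℝ≥0) : ℝ≥0∞) *
          (∫⁻ z in shell c a b, ‖gradient φ z‖ₑ ^ p ∂μ) ^ (1 / p) := by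
  obtain ⟨D, C, hDC⟩ := exists_enorm_fderiv_fill_le hn A B
  refine ⟨2 * (A ^ 7 * D + C),
    fun {p μ} hp h hP {f φ} hf hφ hc {c a b j} ha hb hba hj hfφ => ?_⟩
  have hg : Measurable fun z => ‖gradient φ z‖ₑ ^ p := by
    have : Continuous (gradient φ) := (InnerProductSpace.toDual ℝ (Eucl n)).symm.continuous.comp
      (hφ.continuous_fderiv (by simp))
    exact this.measurable.enorm.pow_const p
  refine (h.lintegral_rpow_le (by omega) hp ha hba hg ENNReal.coe_ne_top
    (hDC hp h hP hf hφ hc ha hb hba hj hfφ)).trans ?_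
  gcongr
  have h1 : (1 : ℝ≥0) ≤ (2 * A) ^ j :=
    one_le_pow₀ (one_le_mul one_le_two h.one_le)
  have h2 : A ^ 7 * D + C * (2 * A) ^ j ≤ (A ^ 7 * D + C) * (2 * A) ^ j := by
    rw [add_mul]
    exact add_le_add (le_mul_of_one_le_right' h1) le_rfl
  calc _ = ((2 * (A ^ 7 * D + C * (2 * A) ^ j) : ℝ≥0) : ℝ≥0∞) := by push_cast; ring
    _ ≤ ((2 * ((A ^ 7 * D + C) * (2 * A) ^ j) : ℝ≥0) : ℝ≥0∞) := by gcongr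
    _ = _ := by push_cast; ring

end Fill

/-! ### Closedness of the gradient and density of test functions. -/

section Closure

variable {n : ℕ} {μ : Measure (Eucl n)} {p : ℝ} {Ω R : Set (Eucl n)}

theorem ContDiffOn.aestronglyMeasurable_gradient {φ : Eucl n → ℝ} (hΩ : IsOpen Ω)
    (hφ : ContDiffOn ℝ ∞ φ Ω) : AEStronglyMeasurable (gradient φ) (μ.restrict Ω) :=
  ((InnerProductSpace.toDual ℝ (Eucl n)).symm.continuous.comp_continuousOn
    (hφ.continuousOn_fderiv_of_isOpen hΩ (by simp))).aestronglyMeasurable hΩ.measurableSet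

theorem continuous_gradient {φ : Eucl n → ℝ} (hφ : ContDiff ℝ ∞ φ) : Continuous (gradient φ) :=
  (InnerProductSpace.toDual ℝ (Eucl n)).symm.continuous.comp (hφ.continuous_fderiv (by simp))

/-- The graph of the Sobolev gradient is closed. -/
theorem hasSobolevGradient_of_tendsto (hp : 1 ≤ p) (hΩ : IsOpen Ω) {u : ℕ → Eucl n → ℝ}
    {v : ℕ → Eucl n → Eucl n} {u' : Eucl n → ℝ} {v' : Eucl n → Eucl n}
    (h : ∀ i, HasSobolevGradient p μ Ω (u i) (v i))
    (hu' : MemLp u' (ENNReal.ofReal p) (μ.restrict Ω))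
    (hv' : MemLp v' (ENNReal.ofReal p) (μ.restrict Ω))
    (hu : Tendsto (fun i => eLpNorm (fun x => u i x - u' x) (ENNReal.ofReal p) (μ.restrict Ω))
      atTop (𝓝 0))
    (hv : Tendsto (fun i => eLpNorm (fun x => v i x - v' x) (ENNReal.ofReal p) (μ.restrict Ω))
      atTop (𝓝 0)) : HasSobolevGradient p μ Ω u' v' := by
  have hp' : (1 : ℝ≥0∞) ≤ ENNReal.ofReal p := by simpa using hp
  have hex : ∀ i, ∃ ψ : Eucl n → ℝ, ContDiffOn ℝ ∞ ψ Ω ∧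
      eLpNorm (fun x => ψ x - u i x) (ENNReal.ofReal p) (μ.restrict Ω) < ((i : ℝ≥0∞) + 1)⁻¹ ∧
      eLpNorm (fun x => gradient ψ x - v i x) (ENNReal.ofReal p) (μ.restrict Ω) <
        ((i : ℝ≥0∞) + 1)⁻¹ := by
    intro i
    obtain ⟨-, -, φ, hφ, ht, hd⟩ := h i
    have hpos : (0 : ℝ≥0∞) < ((i : ℝ≥0∞) + 1)⁻¹ := ENNReal.inv_pos.2 (by finiteness)
    obtain ⟨k, hk1, hk2⟩ := ((ht.eventually (gt_mem_nhds hpos)).and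
      (hd.eventually (gt_mem_nhds hpos))).exists
    exact ⟨φ k, hφ k, hk1, hk2⟩
  choose ψ hψ hψu hψv using hex
  have hinv : Tendsto (fun i : ℕ => ((i : ℝ≥0∞) + 1)⁻¹) atTop (𝓝 0) := by
    simpa using (tendsto_add_atTop_iff_nat (f := fun i : ℕ => (i : ℝ≥0∞)⁻¹) 1).2
      ENNReal.tendsto_inv_nat_nhds_zero
  refine ⟨hu', hv', ψ, hψ, ?_, ?_⟩
  · have hs := hinv.add hu
    rw [add_zero] at hs
    refine tendsto_of_tendsto_of_tendsto_of_le_of_le tendsto_const_nhds hs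
      (fun _ => zero_le) fun i => ?_
    have e : (fun x => ψ i x - u' x) = (fun x => ψ i x - u i x) + fun x => u i x - u' x := by
      ext x; simp
    rw [e]
    exact (eLpNorm_add_le (((hψ i).continuousOn.aestronglyMeasurable hΩ.measurableSet).sub (h i).1.1)
      ((h i).1.1.sub hu'.1) hp').trans (add_le_add (hψu i).le le_rfl)
  · have hs := hinv.add hv
    rw [add_zero] at hs
    refine tendsto_of_tendsto_of_tendsto_of_le_of_le tendsto_const_nhds hs
      (fun _ => zero_le) fun i => ?_
    have e : (fun x => gradient (ψ i) x - v' x) =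
        (fun x => gradient (ψ i) x - v i x) + fun x => v i x - v' x := by
      ext x; simp
    rw [e]
    exact (eLpNorm_add_le ((ContDiffOn.aestronglyMeasurable_gradient hΩ (hψ i)).sub (h i).2.1.1)
      ((h i).2.1.1.sub hv'.1) hp').trans (add_le_add (hψv i).le le_rfl)

theorem exists_test_function_eq_one {K : Set (Eucl n)} (hK : IsCompact K) (hΩ : IsOpen Ω)
    (hKΩ : K ⊆ Ω) : ∃ η : Eucl n → ℝ, ContDiff ℝ ∞ η ∧ HasCompactSupport η ∧ tsupport η ⊆ Ω ∧
      ∀ x ∈ K, η x = 1 := by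
  obtain ⟨L, hL, hKL, hLΩ⟩ := exists_compact_between hK hΩ hKΩ
  obtain ⟨η, hη, -, hs, h1⟩ := exists_contMDiff_support_eq_eq_one_iff
    (modelWithCornersSelf ℝ (Eucl n)) (n := ⊤) isOpen_interior hK.isClosed hKL
  have ht : tsupport η ⊆ L := by
    rw [tsupport, hs]
    exact closure_minimal interior_subset hL.isClosed
  exact ⟨η, hη.contDiff, HasCompactSupport.of_support_subset_isCompact hL
    (hs ▸ interior_subset), ht.trans hLΩ, fun x hx => (h1 x).1 hx⟩

/-- Elements of `H^{1,p}` of a neighbourhood of `closure R` are limits on `R` of test functions. -/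
theorem HasSobolevGradient.exists_test_functions (hR : IsOpen R) (hRb : Bornology.IsBounded R)
    (hΩ : IsOpen Ω) (hRΩ : closure R ⊆ Ω) {u : Eucl n → ℝ} {v : Eucl n → Eucl n}
    (h : HasSobolevGradient p μ Ω u v) :
    ∃ ψ : ℕ → Eucl n → ℝ, (∀ i, ContDiff ℝ ∞ (ψ i)) ∧ (∀ i, HasCompactSupport (ψ i)) ∧
      Tendsto (fun i => eLpNorm (fun x => ψ i x - u x) (ENNReal.ofReal p) (μ.restrict R))
        atTop (𝓝 0) ∧
      Tendsto (fun i => eLpNorm (fun x => gradient (ψ i) x - v x) (ENNReal.ofReal p)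
        (μ.restrict R)) atTop (𝓝 0) := by
  obtain ⟨-, -, φ, hφ, ht, hd⟩ := h
  -- Multiplication by `η` changes nothing on `R` but makes the approximants smooth and bounded on
  -- all of space. The room between `closure R` and the boundary of `Ω` is needed here.
  obtain ⟨η, hη, hηc, hηs, hη1⟩ := exists_test_function_eq_one hRb.isCompact_closure hΩ hRΩ
  have hm := Measure.restrict_mono_set μ (subset_closure.trans hRΩ)
  have heq : ∀ i, ∀ x ∈ R, (fun y => η y * φ i y) =ᶠ[𝓝 x] φ i := fun i x hx => by
    filter_upwards [hR.mem_nhds hx] with y hy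
    rw [hη1 y (subset_closure hy), one_mul]
  refine ⟨fun i y => η y * φ i y, fun i => ?_, fun i => hηc.mul_right, ?_, ?_⟩
  · rw [contDiff_iff_contDiffAt]
    intro x
    by_cases hx : x ∈ tsupport η
    · exact hη.contDiffAt.mul ((hφ i).contDiffAt (hΩ.mem_nhds (hηs hx)))
    · refine contDiffAt_const.congr_of_eventuallyEq (f := fun _ => 0) ?_
      filter_upwards [notMem_tsupport_iff_eventuallyEq.1 hx] with y hy
      rw [hy]
      simp
  · refine tendsto_of_tendsto_of_tendsto_of_le_of_le tendsto_const_nhds ht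
      (fun _ => zero_le) fun i => ?_
    refine le_trans (le_of_eq (eLpNorm_congr_ae ?_)) (eLpNorm_mono_measure _ hm)
    filter_upwards [ae_restrict_mem hR.measurableSet] with x hx
    exact congrArg (· - u x) (heq i x hx).self_of_nhds
  · refine tendsto_of_tendsto_of_tendsto_of_le_of_le tendsto_const_nhds hd
      (fun _ => zero_le) fun i => ?_
    refine le_trans (le_of_eq (eLpNorm_congr_ae ?_)) (eLpNorm_mono_measure _ hm)
    filter_upwards [ae_restrict_mem hR.measurableSet] with x hx
    rw [gradient, (heq i x hx).fderiv_eq, gradient]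

end Closure

/-! ### The extension of functions and its `L^p` bound. -/

section Extension

variable {n : ℕ} {c x y z : Eucl n} {a b r : ℝ} {μ : Measure (Eucl n)} {A B : ℝ≥0}
  {f g φ : Eucl n → ℝ} {p : ℝ} {j : ℕ} {R Q : Set (Eucl n)}

theorem layerIntegral_add (hn : 0 < n) (hf : LocallyIntegrable f μ) (hg : LocallyIntegrable g μ)
    (hx : x ∈ cube c (2 * a)) : layerIntegral μ c a (fun z => f z + g z) x =
      layerIntegral μ c a f x + layerIntegral μ c a g x := by
  unfold layerIntegral
  rw [← integral_add (integrable_mul_layerKernel hn hf hx) (integrable_mul_layerKernel hn hg hx)]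
  simp only [add_mul]

theorem layerIntegral_const_mul (t : ℝ) (f : Eucl n → ℝ) (x : Eucl n) :
    layerIntegral μ c a (fun z => t * f z) x = t * layerIntegral μ c a f x := by
  unfold layerIntegral
  rw [← integral_const_mul]
  simp only [mul_assoc]

theorem IsDoubling.fill_add (h : IsDoubling μ A) (hn : 0 < n) (hb : 0 < b)
    (hf : LocallyIntegrable f μ) (hg : LocallyIntegrable g μ) (hx : x ∈ cube c (2 * a)) :
    fill μ c a b (fun z => f z + g z) x = fill μ c a b f x + fill μ c a b g x := by
  have := h.isLocallyFiniteMeasure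
  have hbd := isBounded_cube (corner c (a + b / 2)) hb
  rw [fill, fill, fill, layerAverage, layerAverage, layerAverage, layerIntegral_add hn hf hg hx,
    setAverage_eq, setAverage_eq, setAverage_eq,
    integral_add (hf.integrableOn_of_isBounded hbd) (hg.integrableOn_of_isBounded hbd)]
  simp only [smul_eq_mul]
  ring

theorem fill_const_mul (t : ℝ) (f : Eucl n → ℝ) (x : Eucl n) :
    fill μ c a b (fun z => t * f z) x = t * fill μ c a b f x := by
  rw [fill, fill, layerAverage, layerAverage, layerIntegral_const_mul, setAverage_eq,
    setAverage_eq, integral_const_mul]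
  simp only [smul_eq_mul]
  ring

/-- The fill sees `f` only through integrals, so the extension is well defined on classes modulo
null sets. -/
theorem fill_congr (hfg : f =ᵐ[μ] g) : fill μ c a b f = fill μ c a b g := by
  ext x
  rw [fill, fill, layerAverage, layerAverage, setAverage_congr_fun (measurableSet_cube _ _)
    (hfg.mono fun z hz _ => hz)]
  congr 3
  exact integral_congr_ae (hfg.mono fun z hz => by simp only [hz])

/-- `R` surrounds the hole `cube c (2 * a)`, contains a shell of thickness `b` around it, and fills
`Q` together with the hole up to a null set. -/
structure IsCollar (μ : Measure (Eucl n)) (c : Eucl n) (a b : ℝ) (R Q : Set (Eucl n)) : Prop where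
  a_pos : 0 < a
  b_pos : 0 < b
  b_le : b ≤ a
  isOpen_collar : IsOpen R
  isOpen_total : IsOpen Q
  shell_subset : shell c a b ⊆ R
  disjoint : Disjoint (cube c (2 * a)) R
  collar_subset : R ⊆ Q
  ae_eq : Q =ᵐ[μ] (cube c (2 * a) ∪ R : Set (Eucl n))
  measure_ne_top : μ Q ≠ ⊤

/-- The function which agrees with `u` off the hole and extends it into the hole. -/
noncomputable def extension (μ : Measure (Eucl n)) (c : Eucl n) (a b : ℝ) (R : Set (Eucl n))
    (u : Eucl n → ℝ) (x : Eucl n) : ℝ :=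
  (cube c (2 * a)).indicator (fill μ c a b (R.indicator u)) x + (cube c (2 * a))ᶜ.indicator u x

theorem extension_of_mem (u : Eucl n → ℝ) (hx : x ∈ cube c (2 * a)) :
    extension μ c a b R u x = fill μ c a b (R.indicator u) x := by
  rw [extension, Set.indicator_of_mem hx, Set.indicator_of_notMem (Set.notMem_compl_iff.2 hx), add_zero]

theorem extension_of_notMem (u : Eucl n → ℝ) (hx : x ∉ cube c (2 * a)) :
    extension μ c a b R u x = u x := by
  rw [extension, Set.indicator_of_notMem hx, Set.indicator_of_mem hx, zero_add]

theorem IsCollar.extension_of_mem_collar (h : IsCollar μ c a b R Q) (u : Eucl n → ℝ) (hx : x ∈ R) :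
    extension μ c a b R u x = u x :=
  extension_of_notMem u fun hx' => h.disjoint.notMem_of_mem_left hx' hx

theorem IsCollar.restrict_eq (h : IsCollar μ c a b R Q) :
    μ.restrict Q = μ.restrict (cube c (2 * a)) + μ.restrict R := by
  rw [Measure.restrict_congr_set h.ae_eq,
    Measure.restrict_union h.disjoint h.isOpen_collar.measurableSet]

theorem IsCollar.eLpNorm_le (h : IsCollar μ c a b R Q) (hp : 1 ≤ p) {F : Type*}
    [NormedAddCommGroup F] (f : Eucl n → F) :
    eLpNorm f (ENNReal.ofReal p) (μ.restrict Q) ≤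
      (∫⁻ x in cube c (2 * a), ‖f x‖ₑ ^ p ∂μ) ^ (1 / p) +
        eLpNorm f (ENNReal.ofReal p) (μ.restrict R) := by
  have hp0 : 0 < p := by linarith
  have hp1 : 1 / p ≤ 1 := by rw [div_le_one hp0]; exact hp
  rw [eLpNorm_eq_lintegral_rpow_enorm_toReal (by simpa using hp0) ENNReal.ofReal_ne_top,
    eLpNorm_eq_lintegral_rpow_enorm_toReal (by simpa using hp0) ENNReal.ofReal_ne_top,
    ENNReal.toReal_ofReal hp0.le, h.restrict_eq, lintegral_add_measure]
  exact ENNReal.rpow_add_le_add_rpow _ _ (by positivity) hp1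

theorem IsCollar.rpow_lintegral_shell_le (h : IsCollar μ c a b R Q) (hp : 1 ≤ p) {F : Type*}
    [NormedAddCommGroup F] (f : Eucl n → F) :
    (∫⁻ z in shell c a b, ‖f z‖ₑ ^ p ∂μ) ^ (1 / p) ≤
      eLpNorm f (ENNReal.ofReal p) (μ.restrict R) := by
  have hp0 : 0 < p := by linarith
  rw [eLpNorm_eq_lintegral_rpow_enorm_toReal (by simpa using hp0) ENNReal.ofReal_ne_top,
    ENNReal.toReal_ofReal hp0.le]
  gcongr
  exact h.shell_subset

theorem IsCollar.integrable_indicator (h : IsCollar μ c a b R Q) (hp : 1 ≤ p) {u : Eucl n → ℝ}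
    (hu : MemLp u (ENNReal.ofReal p) (μ.restrict R)) : Integrable (R.indicator u) μ := by
  have : IsFiniteMeasure (μ.restrict R) := ⟨by
    rw [Measure.restrict_apply_univ]
    exact (measure_mono h.collar_subset).trans_lt h.measure_ne_top.lt_top⟩
  rw [integrable_indicator_iff h.isOpen_collar.measurableSet]
  exact hu.integrable (by simpa using hp)

theorem IsCollar.extension_congr (h : IsCollar μ c a b R Q) {u v : Eucl n → ℝ}
    (huv : u =ᵐ[μ.restrict R] v) :
    extension μ c a b R u =ᵐ[μ.restrict Q] extension μ c a b R v := by
  have hRm := h.isOpen_collar.measurableSet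
  have h1 : R.indicator u =ᵐ[μ] R.indicator v := by
    filter_upwards [(ae_restrict_iff' hRm).1 huv] with x hx
    by_cases hxR : x ∈ R
    · rw [Set.indicator_of_mem hxR, Set.indicator_of_mem hxR, hx hxR]
    · rw [Set.indicator_of_notMem hxR, Set.indicator_of_notMem hxR]
  rw [h.restrict_eq]
  refine ae_add_measure_iff.2 ⟨?_, ?_⟩
  · filter_upwards [ae_restrict_mem (measurableSet_cube _ _)] with x hx
    rw [extension_of_mem u hx, extension_of_mem v hx, fill_congr h1]
  · filter_upwards [ae_restrict_mem hRm, huv] with x hx hux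
    rw [h.extension_of_mem_collar u hx, h.extension_of_mem_collar v hx, hux]

theorem IsCollar.extension_add (h : IsCollar μ c a b R Q) (hd : IsDoubling μ A) (hn : 0 < n)
    {u v : Eucl n → ℝ} (hu : Integrable (R.indicator u) μ) (hv : Integrable (R.indicator v) μ) :
    extension μ c a b R (fun x => u x + v x) =
      fun x => extension μ c a b R u x + extension μ c a b R v x := by
  ext x
  by_cases hx : x ∈ cube c (2 * a)
  · rw [extension_of_mem _ hx, extension_of_mem _ hx, extension_of_mem _ hx,
      ← hd.fill_add hn h.b_pos hu.locallyIntegrable hv.locallyIntegrable hx]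
    congr 1
    exact Set.indicator_add R u v
  · rw [extension_of_notMem _ hx, extension_of_notMem _ hx, extension_of_notMem _ hx]

theorem extension_const_mul (t : ℝ) (u : Eucl n → ℝ) :
    extension μ c a b R (fun x => t * u x) = fun x => t * extension μ c a b R u x := by
  ext x
  by_cases hx : x ∈ cube c (2 * a)
  · rw [extension_of_mem _ hx, extension_of_mem _ hx, ← fill_const_mul]
    congr 1
    ext z
    by_cases hz : z ∈ R <;> simp [hz]
  · rw [extension_of_notMem _ hx, extension_of_notMem _ hx]

theorem IsCollar.extension_sub (h : IsCollar μ c a b R Q) (hd : IsDoubling μ A) (hn : 0 < n)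
    {u v : Eucl n → ℝ} (hu : Integrable (R.indicator u) μ) (hv : Integrable (R.indicator v) μ) :
    extension μ c a b R (fun x => u x - v x) =
      fun x => extension μ c a b R u x - extension μ c a b R v x := by
  have hv' : Integrable (R.indicator fun x => -1 * v x) μ := by
    have : (R.indicator fun x => -1 * v x) = fun x => -1 * R.indicator v x := by
      ext z
      by_cases hz : z ∈ R <;> simp [hz]
    rw [this]
    exact hv.const_mul _
  have h1 := h.extension_add hd hn hu hv'
  rw [extension_const_mul] at h1
  simpa [sub_eq_add_neg] using h1

theorem IsCollar.aestronglyMeasurable_extension (h : IsCollar μ c a b R Q) (hd : IsDoubling μ A)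
    (hn : 0 < n) (hp : 1 ≤ p) {u : Eucl n → ℝ}
    (hu : MemLp u (ENNReal.ofReal p) (μ.restrict R)) :
    AEStronglyMeasurable (extension μ c a b R u) (μ.restrict Q) := by
  rw [h.restrict_eq, aestronglyMeasurable_add_measure_iff]
  refine ⟨?_, ?_⟩
  · refine (((hd.contDiffOn_fill (b := b) hn
      (h.integrable_indicator hp hu).locallyIntegrable).continuousOn).aestronglyMeasurable
      (measurableSet_cube _ _)).congr ?_
    filter_upwards [ae_restrict_mem (measurableSet_cube _ _)] with x hx
    rw [extension_of_mem u hx]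
  · refine hu.1.congr ?_
    filter_upwards [ae_restrict_mem h.isOpen_collar.measurableSet] with x hx
    rw [h.extension_of_mem_collar u hx]

/-- The extension is bounded in `L^p`. -/
theorem IsCollar.eLpNorm_extension_le (h : IsCollar μ c a b R Q) (hd : IsDoubling μ A)
    (hn : 2 ≤ n) (hp : 1 ≤ p) (hj : a ≤ 2 ^ j * b) {u : Eucl n → ℝ}
    (hu : MemLp u (ENNReal.ofReal p) (μ.restrict R)) :
    eLpNorm (extension μ c a b R u) (ENNReal.ofReal p) (μ.restrict Q) ≤
      ((4 * A ^ (2 * n + 8) * A ^ j + 1 : ℝ≥0) : ℝ≥0∞) *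
        eLpNorm u (ENNReal.ofReal p) (μ.restrict R) := by
  have hRm := h.isOpen_collar.measurableSet
  -- The Tonelli argument needs a genuinely measurable representative.
  obtain ⟨u', hu'm, huu'⟩ := hu.1
  rw [eLpNorm_congr_ae (h.extension_congr huu'), eLpNorm_congr_ae huu']
  have hu' : MemLp u' (ENNReal.ofReal p) (μ.restrict R) := hu.ae_eq huu'
  refine (h.eLpNorm_le hp _).trans ?_
  push_cast
  rw [add_mul, one_mul]
  refine add_le_add ?_ (le_of_eq (eLpNorm_congr_ae ?_))
  · have h1 := hd.lintegral_fill_le (c := c) hn hp h.a_pos h.b_pos h.b_le hj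
      (h.integrable_indicator hp hu').locallyIntegrable (hu'm.measurable.indicator hRm)
    rw [setLIntegral_congr_fun (g := fun x => ‖fill μ c a b (R.indicator u') x‖ₑ ^ p)
      (measurableSet_cube _ _) fun x hx => by simp only [extension_of_mem u' hx]]
    refine h1.trans ?_
    push_cast
    gcongr
    refine (h.rpow_lintegral_shell_le hp _).trans (le_of_eq (eLpNorm_congr_ae ?_))
    filter_upwards [ae_restrict_mem hRm] with x hx
    rw [Set.indicator_of_mem hx]
  · filter_upwards [ae_restrict_mem hRm] with x hx
    rw [h.extension_of_mem_collar u' hx]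

theorem IsCollar.memLp_extension (h : IsCollar μ c a b R Q) (hd : IsDoubling μ A)
    (hn : 2 ≤ n) (hp : 1 ≤ p) {u : Eucl n → ℝ}
    (hu : MemLp u (ENNReal.ofReal p) (μ.restrict R)) :
    MemLp (extension μ c a b R u) (ENNReal.ofReal p) (μ.restrict Q) := by
  -- Only finiteness is at stake, so any admissible `j` will do.
  obtain ⟨j, hj⟩ := pow_unbounded_of_one_lt (a / b) one_lt_two
  rw [div_lt_iff₀ h.b_pos] at hj
  exact ⟨h.aestronglyMeasurable_extension hd (by omega) hp hu,
    (h.eLpNorm_extension_le hd hn hp hj.le hu).trans_lt (ENNReal.mul_lt_top ENNReal.coe_lt_top hu.2)⟩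

end Extension

/-! ### Extensions of test functions are Sobolev functions. -/

section TestFunctions

variable {n : ℕ} {c x y z : Eucl n} {a b r : ℝ} {μ : Measure (Eucl n)} {A B : ℝ≥0}
  {f g φ : Eucl n → ℝ} {p : ℝ} {j : ℕ} {R Q : Set (Eucl n)}

theorem _root_.MeasureTheory.setLAverage_le_of_forall_le {X : Type*} [MeasurableSpace X]
    {μ : Measure X} {s : Set X} (hs : MeasurableSet s) {f : X → ℝ≥0∞} {k : ℝ≥0∞}
    (h : ∀ z ∈ s, f z ≤ k) : ⨍⁻ z in s, f z ∂μ ≤ k := by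
  rw [setLAverage_eq_inv_mul]
  calc (μ s)⁻¹ * ∫⁻ z in s, f z ∂μ ≤ (μ s)⁻¹ * ∫⁻ _z in s, k ∂μ := by
        gcongr 1
        exact setLIntegral_mono' hs h
    _ = (μ s)⁻¹ * μ s * k := by rw [setLIntegral_const]; ring
    _ ≤ 1 * k := by gcongr; exact ENNReal.inv_mul_le_one _
    _ = k := one_mul k

theorem gradient_sub_gradient (φ ψ : Eucl n → ℝ) (x : Eucl n) :
    ‖gradient φ x - gradient ψ x‖ = ‖fderiv ℝ φ x - fderiv ℝ ψ x‖ := by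
  rw [gradient, gradient, ← map_sub, LinearIsometryEquiv.norm_map]

theorem hasCompactSupport_gradient (hc : HasCompactSupport φ) :
    HasCompactSupport (gradient φ) :=
  (hc.fderiv ℝ).comp_left (map_zero (InnerProductSpace.toDual ℝ (Eucl n)).symm)

/-- The gradient of the extension of a test function. -/
noncomputable def extensionGradient (μ : Measure (Eucl n)) (c : Eucl n) (a b : ℝ)
    (R : Set (Eucl n)) (φ : Eucl n → ℝ) (x : Eucl n) : Eucl n :=
  (cube c (2 * a)).indicator (gradient (fill μ c a b (R.indicator φ))) x +
    (cube c (2 * a))ᶜ.indicator (gradient φ) x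

theorem extensionGradient_of_mem (φ : Eucl n → ℝ) (hx : x ∈ cube c (2 * a)) :
    extensionGradient μ c a b R φ x = gradient (fill μ c a b (R.indicator φ)) x := by
  rw [extensionGradient, Set.indicator_of_mem hx,
    Set.indicator_of_notMem (Set.notMem_compl_iff.2 hx), add_zero]

theorem extensionGradient_of_notMem (φ : Eucl n → ℝ) (hx : x ∉ cube c (2 * a)) :
    extensionGradient μ c a b R φ x = gradient φ x := by
  rw [extensionGradient, Set.indicator_of_notMem hx, Set.indicator_of_mem hx, zero_add]

theorem IsCollar.extensionGradient_of_mem_collar (h : IsCollar μ c a b R Q) (φ : Eucl n → ℝ)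
    (hx : x ∈ R) : extensionGradient μ c a b R φ x = gradient φ x :=
  extensionGradient_of_notMem φ fun hx' => h.disjoint.notMem_of_mem_left hx' hx

theorem IsCollar.integrable_indicator_test (h : IsCollar μ c a b R Q) (hd : IsDoubling μ A)
    (hφ : ContDiff ℝ ∞ φ) (hc : HasCompactSupport φ) : Integrable (R.indicator φ) μ := by
  have := hd.isLocallyFiniteMeasure
  exact (hφ.continuous.integrable_of_hasCompactSupport hc).indicator h.isOpen_collar.measurableSet

theorem IsCollar.aestronglyMeasurable_extensionGradient (h : IsCollar μ c a b R Q)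
    (hd : IsDoubling μ A) (hn : 0 < n) (hφ : ContDiff ℝ ∞ φ) (hc : HasCompactSupport φ) :
    AEStronglyMeasurable (extensionGradient μ c a b R φ) (μ.restrict Q) := by
  rw [h.restrict_eq, aestronglyMeasurable_add_measure_iff]
  refine ⟨?_, ?_⟩
  · refine (ContDiffOn.aestronglyMeasurable_gradient (isOpen_cube _ _)
      (hd.contDiffOn_fill (b := b) hn
        (h.integrable_indicator_test hd hφ hc).locallyIntegrable)).congr ?_
    filter_upwards [ae_restrict_mem (measurableSet_cube _ _)] with x hx
    rw [extensionGradient_of_mem φ hx]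
  · refine (continuous_gradient hφ).aestronglyMeasurable.congr ?_
    filter_upwards [ae_restrict_mem h.isOpen_collar.measurableSet] with x hx
    rw [h.extensionGradient_of_mem_collar φ hx]

/-- The gradient of the extension is controlled in `L^p`. -/
theorem exists_eLpNorm_extensionGradient_le (hn : 2 ≤ n) (A B : ℝ≥0) :
    ∃ C : ℝ≥0, ∀ {p : ℝ} {μ : Measure (Eucl n)}, 1 ≤ p → IsDoubling μ A →
      SatisfiesPoincare p μ B → ∀ {c : Eucl n} {a b : ℝ} {R Q : Set (Eucl n)} {j : ℕ},
      IsCollar μ c a b R Q → a ≤ 2 ^ j * b → ∀ {φ : Eucl n → ℝ}, ContDiff ℝ ∞ φ →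
      HasCompactSupport φ →
      eLpNorm (extensionGradient μ c a b R φ) (ENNReal.ofReal p) (μ.restrict Q) ≤
        ((C * (2 * A) ^ j + 1 : ℝ≥0) : ℝ≥0∞) *
          eLpNorm (gradient φ) (ENNReal.ofReal p) (μ.restrict R) := by
  obtain ⟨C, hC⟩ := exists_lintegral_fderiv_fill_le hn A B
  refine ⟨C, fun {p μ} hp hd hP {c a b R Q j} h hj {φ} hφ hc => ?_⟩
  -- The function averaged is `R.indicator φ`, which is not smooth; it agrees with `φ` on the shell,
  -- where all averages are taken.
  have h1 := hC hp hd hP (h.integrable_indicator_test hd hφ hc).locallyIntegrable hφ hc h.a_pos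
    h.b_pos h.b_le hj fun z hz => Set.indicator_of_mem (h.shell_subset hz) φ
  refine (h.eLpNorm_le hp _).trans ?_
  rw [ENNReal.coe_add, ENNReal.coe_one, add_mul, one_mul]
  refine add_le_add ?_ (le_of_eq (eLpNorm_congr_ae ?_))
  · rw [setLIntegral_congr_fun (g := fun x => ‖fderiv ℝ (fill μ c a b (R.indicator φ)) x‖ₑ ^ p)
      (measurableSet_cube _ _) fun x hx => by
        simp only [extensionGradient_of_mem φ hx, norm_gradient_eq]]
    exact h1.trans (mul_le_mul_right (h.rpow_lintegral_shell_le hp _) _)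
  · filter_upwards [ae_restrict_mem h.isOpen_collar.measurableSet] with x hx
    rw [h.extensionGradient_of_mem_collar φ hx]

/-- Near the boundary of the hole the extension of a Lipschitz function is close to it. -/
theorem IsCollar.abs_fill_sub_le (h : IsCollar μ c a b R Q) (hd : IsDoubling μ A) (hn : 0 < n)
    (hφ : ContDiff ℝ ∞ φ) (hc : HasCompactSupport φ) {L : ℝ≥0}
    (hL : ∀ x y, |φ x - φ y| ≤ L * ‖x - y‖) (hx : x ∈ cube c (2 * a))
    (hxb : 36 * n * depth c a x ≤ b) :
    |fill μ c a b (R.indicator φ) x - φ x| ≤ A ^ (2 * n + 1) * (9 * n ^ 2 * L) * depth c a x := by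
  have hρ := depth_pos hn hx
  have hsz : 0 < 2 * (n * depth c a x) := by positivity
  have hsub := reflectedCube_subset_shell hn h.a_pos h.b_le hx (b := b) (by linarith)
  have e : fill μ c a b (R.indicator φ) x = layerAverage μ c a (R.indicator φ) x := by
    rw [fill, cutoff_eq_zero h.b_pos hxb]
    simp
  have h1 := hd.enorm_layerAverage_sub_le hn
    (h.integrable_indicator_test hd hφ hc).locallyIntegrable hx (φ x) subset_rfl
    measurableSet_reflectedCube (hd.measure_reflectedCube_le_layerIntegral hn hx)
    (hd.measure_ne_zero _ hsz) (hd.measure_ne_top _ hsz)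
  have h2 : ⨍⁻ z in reflectedCube c a x, ‖R.indicator φ z - φ x‖ₑ ∂μ ≤
      ENNReal.ofReal (9 * n ^ 2 * L * depth c a x) := by
    refine setLAverage_le_of_forall_le measurableSet_reflectedCube fun z hz => ?_
    rw [Set.indicator_of_mem (h.shell_subset (hsub hz)), Real.enorm_eq_ofReal_abs]
    refine ENNReal.ofReal_le_ofReal ((hL z x).trans ?_)
    have h3 := norm_le_mul_supNorm (z - x)
    have h4 := supNorm_sub_le z (reflection c a x) x
    have h5 := supNorm_reflection_sub_self_le hn h.a_pos hx
    have h6 := (mem_reflectedCube_iff hn hx).1 hz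
    have h7 : supNorm (z - x) ≤ 9 * n * depth c a x := by linarith
    calc (L : ℝ) * ‖z - x‖ ≤ L * (n * (9 * n * depth c a x)) := by
          gcongr
          exact h3.trans (by gcongr)
      _ = _ := by ring
  have h8 := h1.trans (mul_le_mul_right h2 _)
  rw [← e, Real.enorm_eq_ofReal_abs] at h8
  have e2 : (A : ℝ≥0∞) ^ (2 * n + 1) * ENNReal.ofReal (9 * n ^ 2 * L * depth c a x) =
      ENNReal.ofReal (A ^ (2 * n + 1) * (9 * n ^ 2 * L) * depth c a x) := by
    rw [mul_assoc ((A : ℝ) ^ (2 * n + 1)),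
      ENNReal.ofReal_mul (p := (A : ℝ) ^ (2 * n + 1)) (by positivity),
      ENNReal.ofReal_pow (by positivity), ENNReal.ofReal_coe_nnreal]
  rw [e2] at h8
  exact (ENNReal.ofReal_le_ofReal_iff (by positivity)).1 h8

/-- The gradient of the extension of a test function is bounded in the hole. -/
theorem IsCollar.exists_norm_fderiv_fill_le (h : IsCollar μ c a b R Q) (hd : IsDoubling μ A)
    (hP : SatisfiesPoincare p μ B) (hn : 2 ≤ n) (hp : 1 ≤ p)
    (hφ : ContDiff ℝ ∞ φ) (hc : HasCompactSupport φ) :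
    ∃ K : ℝ, ∀ x ∈ cube c (2 * a), ‖fderiv ℝ (fill μ c a b (R.indicator φ)) x‖ ≤ K := by
  have hp0 : 0 < p := by linarith
  have := hd.isLocallyFiniteMeasure
  obtain ⟨j, hj⟩ := pow_unbounded_of_one_lt (a / b) one_lt_two
  rw [div_lt_iff₀ h.b_pos] at hj
  obtain ⟨D, C, hDC⟩ := exists_enorm_fderiv_fill_le hn A B
  obtain ⟨L, hL⟩ := (hasCompactSupport_gradient hc).exists_bound_of_continuous
    (continuous_gradient hφ)
  have hLe : ∀ z, ‖gradient φ z‖ₑ ^ p ≤ ENNReal.ofReal L ^ p := fun z => by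
    refine ENNReal.rpow_le_rpow ?_ hp0.le
    rw [← ofReal_norm]
    exact ENNReal.ofReal_le_ofReal (hL z)
  have ha := h.a_pos
  have h0 := hd.measure_ne_zero c (ℓ := 2 * a) (by positivity)
  set M : ℝ≥0∞ := D * (ENNReal.ofReal L ^ p) ^ (1 / p) + ((C * (2 * A) ^ j : ℝ≥0) : ℝ≥0∞) *
    shellEnergy μ c a b (fun z => ‖gradient φ z‖ₑ ^ p) ^ (1 / p) with hM
  have hMt : M ≠ ⊤ := by
    have hE : shellEnergy μ c a b (fun z => ‖gradient φ z‖ₑ ^ p) ≠ ⊤ := by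
      refine ENNReal.mul_ne_top (ENNReal.inv_ne_top.2 h0) ?_
      refine ne_top_of_le_ne_top ?_ (setLIntegral_mono' (isOpen_shell c a b).measurableSet
        fun z _ => hLe z)
      rw [setLIntegral_const]
      refine ENNReal.mul_ne_top (ENNReal.rpow_ne_top_of_nonneg hp0.le ENNReal.ofReal_ne_top) ?_
      exact ne_top_of_le_ne_top h.measure_ne_top
        (measure_mono (h.shell_subset.trans h.collar_subset))
    refine ENNReal.add_ne_top.2 ⟨ENNReal.mul_ne_top ENNReal.coe_ne_top ?_,
      ENNReal.mul_ne_top ENNReal.coe_ne_top ?_⟩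
    · exact ENNReal.rpow_ne_top_of_nonneg (by positivity)
        (ENNReal.rpow_ne_top_of_nonneg hp0.le ENNReal.ofReal_ne_top)
    · exact ENNReal.rpow_ne_top_of_nonneg (by positivity) hE
  refine ⟨M.toReal, fun x hx => ?_⟩
  have h1 := hDC hp hd hP (h.integrable_indicator_test hd hφ hc).locallyIntegrable hφ hc h.a_pos
    h.b_pos h.b_le hj.le (fun z hz => Set.indicator_of_mem (h.shell_subset hz) φ) x hx
  have h2 : ‖fderiv ℝ (fill μ c a b (R.indicator φ)) x‖ₑ ≤ M := by
    refine h1.trans (add_le_add ?_ le_rfl)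
    refine Set.indicator_apply_le' (fun _ => ?_) fun _ => zero_le
    gcongr
    exact setLAverage_le_of_forall_le measurableSet_reflectedCube fun z _ => hLe z
  rw [← ofReal_norm] at h2
  exact (ENNReal.ofReal_le_iff_le_toReal hMt).1 h2

/-- For `b ≥ 0` the layers decrease to the empty set, the depth being positive in the hole, and the
hole has finite measure. -/
theorem tendsto_measure_innerLayer (hn : 0 < n) (ha : 0 < a) (hd : IsDoubling μ A) (b : ℝ) :
    Tendsto (fun i : ℕ => μ (innerLayer c a (b / (i + 2)))) atTop (𝓝 0) := by
  rcases lt_or_ge b 0 with hb | hb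
  · have : ∀ i : ℕ, innerLayer c a (b / (i + 2)) = ∅ := fun i => by
      ext x
      simp only [innerLayer, Set.mem_ofPred_eq, Set.mem_empty_iff_false, iff_false, not_and, not_le]
      intro hx
      have := depth_pos hn hx
      have : b / ((i : ℝ) + 2) < 0 := div_neg_of_neg_of_pos hb (by positivity)
      have : 0 < 18 * n * depth c a x := by positivity
      linarith
    simp [this]
  have hant : Antitone fun i : ℕ => innerLayer c a (b / (i + 2)) := by
    intro i k hik x hx
    refine ⟨hx.1, hx.2.trans ?_⟩
    have : (i : ℝ) ≤ k := by exact_mod_cast hik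
    gcongr
  have h := tendsto_measure_iInter_atTop (μ := μ)
    (fun i => measurableSet_innerLayer.nullMeasurableSet) hant
    ⟨0, ne_top_of_le_ne_top (hd.measure_ne_top c (ℓ := 2 * a) (by positivity))
      (measure_mono fun x hx => hx.1)⟩
  have hempty : ⋂ i : ℕ, innerLayer c a (b / (i + 2)) = ∅ := by
    rw [Set.eq_empty_iff_forall_notMem]
    intro x hx
    rw [Set.mem_iInter] at hx
    have hρ := depth_pos hn (hx 0).1
    have hpos : 0 < 18 * n * depth c a x := by positivity
    have hlim : Tendsto (fun i : ℕ => b / ((i : ℝ) + 2)) atTop (𝓝 0) :=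
      tendsto_const_nhds.div_atTop
        (tendsto_atTop_add_const_right _ _ tendsto_natCast_atTop_atTop)
    obtain ⟨i, hi⟩ := (hlim.eventually (gt_mem_nhds hpos)).exists
    exact absurd (hx i).2 (not_le.2 hi)
  rw [hempty, measure_empty] at h
  exact h

theorem tendsto_eLpNorm_of_le_indicator {X F : Type*} [MeasurableSpace X] [NormedAddCommGroup F]
    {μ : Measure X} {q : ℝ≥0∞} (hq0 : q ≠ 0) (hqt : q ≠ ⊤) {f : ℕ → X → F} {s : ℕ → Set X}
    (hs : ∀ i, MeasurableSet (s i)) (hμ : Tendsto (fun i => μ (s i)) atTop (𝓝 0)) {K : ℝ}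
    (hf : ∀ i x, ‖f i x‖ ≤ (s i).indicator (fun _ => K) x) :
    Tendsto (fun i => eLpNorm (f i) q μ) atTop (𝓝 0) := by
  have hpos : 0 < 1 / q.toReal := one_div_pos.2 (ENNReal.toReal_pos hq0 hqt)
  have h1 : Tendsto (fun i => ‖K‖ₑ * μ (s i) ^ (1 / q.toReal)) atTop (𝓝 0) := by
    have h2 := ENNReal.Tendsto.const_mul (a := ‖K‖ₑ)
      (((ENNReal.continuous_rpow_const (y := 1 / q.toReal)).tendsto 0).comp hμ)
      (Or.inr enorm_ne_top)
    rwa [ENNReal.zero_rpow_of_pos hpos, mul_zero] at h2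
  refine tendsto_of_tendsto_of_tendsto_of_le_of_le tendsto_const_nhds h1
    (fun _ => zero_le) fun i => ?_
  dsimp only
  rw [← eLpNorm_indicator_const (hs i) hq0 hqt]
  exact eLpNorm_mono fun x => (hf i x).trans (le_abs_self _)

/-- The extension of a test function belongs to the Sobolev space. -/
theorem IsCollar.hasSobolevGradient_extension (h : IsCollar μ c a b R Q) (hd : IsDoubling μ A)
    (hP : SatisfiesPoincare p μ B) (hn : 2 ≤ n) (hp : 1 ≤ p)
    (hφ : ContDiff ℝ ∞ φ) (hc : HasCompactSupport φ) :
    HasSobolevGradient p μ Q (extension μ c a b R φ) (extensionGradient μ c a b R φ) := by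
  have hn0 : 0 < n := by omega
  have := hd.isLocallyFiniteMeasure
  have hb := h.b_pos
  have ha := h.a_pos
  have hq0 : ENNReal.ofReal p ≠ 0 := by
    rw [Ne, ENNReal.ofReal_eq_zero]; linarith
  have hqt : ENNReal.ofReal p ≠ ⊤ := ENNReal.ofReal_ne_top
  have hφR : MemLp φ (ENNReal.ofReal p) (μ.restrict R) :=
    hφ.continuous.memLp_of_hasCompactSupport hc
  have hgR : MemLp (gradient φ) (ENNReal.ofReal p) (μ.restrict R) :=
    (continuous_gradient hφ).memLp_of_hasCompactSupport (hasCompactSupport_gradient hc)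
  obtain ⟨C, hC⟩ := exists_eLpNorm_extensionGradient_le hn A B
  obtain ⟨j, hj⟩ := pow_unbounded_of_one_lt (a / b) one_lt_two
  rw [div_lt_iff₀ hb] at hj
  obtain ⟨L, hL⟩ := hφ.lipschitzWith_of_hasCompactSupport hc (by simp)
  have hL' : ∀ x y, |φ x - φ y| ≤ L * ‖x - y‖ := fun x y => by
    simpa [Real.dist_eq, dist_eq_norm] using hL.dist_le_mul x y
  obtain ⟨M, hM⟩ := h.exists_norm_fderiv_fill_le hd hP hn hp hφ hc
  obtain ⟨S, hS⟩ := exists_norm_fderiv_cutoff_le n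
  set F := fill μ c a b (R.indicator φ) with hF
  have hFs : ContDiffOn ℝ ∞ F (cube c (2 * a)) :=
    hd.contDiffOn_fill hn0 (h.integrable_indicator_test hd hφ hc).locallyIntegrable
  set K : ℝ := A ^ (2 * n + 1) * (9 * n ^ 2 * L) with hK
  have hK0 : 0 ≤ K := by positivity
  -- The shift by `2` gives `2 * β i ≤ b`. On the layer of scale `β i`, where `18 * n * depth ≤ β
  -- i`, this yields `36 * n * depth ≤ b`, so the filled function is a pure average there.
  let β : ℕ → ℝ := fun i => b / (i + 2)
  have hβ : ∀ i, 0 < β i := fun i => by positivity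
  have hβb : ∀ i, 2 * β i ≤ b := fun i => by
    have : β i * (i + 2) = b := div_mul_cancel₀ _ (by positivity)
    have := hβ i
    have : (0 : ℝ) ≤ i := by positivity
    nlinarith
  -- It equals `φ` near and beyond the boundary of the hole and `F` below the layer of scale `β i`,
  -- so it is smooth everywhere and errs on that layer only.
  let ψ : ℕ → Eucl n → ℝ := fun i x => φ x +
    (cube c (2 * a)).indicator (fun x => cutoff c a (β i) x * (F x - φ x)) x
  have hψmem : ∀ i, ∀ x ∈ cube c (2 * a), ψ i x = φ x + cutoff c a (β i) x * (F x - φ x) :=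
    fun i x hx => by simp only [ψ, Set.indicator_of_mem hx]
  have hψnear : ∀ i, ∀ x ∉ cube c (2 * a), ψ i =ᶠ[𝓝 x] φ := by
    intro i x hx
    rw [mem_cube_two_mul_iff ha, not_lt] at hx
    have hpos : 0 < β i / (36 * n) := by have := hβ i; positivity
    have hcont : Continuous fun y : Eucl n => supNorm (y - c) :=
      continuous_supNorm.comp (continuous_id.sub continuous_const)
    filter_upwards [hcont.continuousAt.eventually
      (lt_mem_nhds (show a - β i / (36 * n) < supNorm (x - c) by linarith))] with y hy
    by_cases hyc : y ∈ cube c (2 * a)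
    · rw [hψmem i y hyc, cutoff_eq_zero (hβ i)]
      · ring
      · have h1 := supNorm_add_depth_le hn0 hyc
        have h2 : depth c a y ≤ β i / (36 * n) := by linarith
        rw [le_div_iff₀ (by positivity)] at h2
        linarith
    · simp only [ψ, Set.indicator_of_notMem hyc, add_zero]
  have hψmemnear : ∀ i, ∀ x ∈ cube c (2 * a),
      ψ i =ᶠ[𝓝 x] fun x => φ x + cutoff c a (β i) x * (F x - φ x) := fun i x hx => by
    filter_upwards [(isOpen_cube c (2 * a)).mem_nhds hx] with y hy
    exact hψmem i y hy
  have hψdeep : ∀ i, ∀ x ∈ cube c (2 * a), x ∉ innerLayer c a (β i) → ψ i =ᶠ[𝓝 x] F := by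
    intro i x hx hxl
    have hlt : β i < 18 * n * depth c a x := by
      by_contra hlt
      exact hxl ⟨hx, not_lt.1 hlt⟩
    have hnhds := (isOpen_cube c (2 * a)).mem_nhds hx
    have hcd : ContinuousAt (depth c a) x :=
      (contDiffOn_depth hn0).continuousOn.continuousAt hnhds
    filter_upwards [hnhds, (hcd.const_mul (18 * n)).eventually (lt_mem_nhds hlt)] with y hy hyl
    rw [hψmem i y hy, cutoff_eq_one (hβ i) (le_of_lt hyl)]
    ring
  have hclose : ∀ i, ∀ x ∈ innerLayer c a (β i), |F x - φ x| ≤ K * depth c a x := fun i x hx =>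
    h.abs_fill_sub_le hd hn0 hφ hc hL' hx.1 (by linarith [hβb i, hx.2])
  have hn1 : (1 : ℝ) ≤ n := by exact_mod_cast hn0
  have hdepth : ∀ i, ∀ x ∈ innerLayer c a (β i), depth c a x ≤ β i := fun i x hx => by
    have := hx.2
    have := depth_pos hn0 hx.1
    nlinarith
  refine ⟨h.memLp_extension hd hn hp hφR,
    ⟨h.aestronglyMeasurable_extensionGradient hd hn0 hφ hc,
      (hC hp hd hP h hj.le hφ hc).trans_lt (ENNReal.mul_lt_top ENNReal.coe_lt_top hgR.2)⟩,
    ψ, fun i => ContDiff.contDiffOn ?_, ?_, ?_⟩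
  · rw [contDiff_iff_contDiffAt]
    intro x
    by_cases hx : x ∈ cube c (2 * a)
    · have hnhds := (isOpen_cube c (2 * a)).mem_nhds hx
      refine ContDiffAt.congr_of_eventuallyEq ?_ (hψmemnear i x hx)
      exact hφ.contDiffAt.add (((contDiffOn_cutoff hn0).contDiffAt hnhds).mul
        ((hFs.contDiffAt hnhds).sub hφ.contDiffAt))
    · exact hφ.contDiffAt.congr_of_eventuallyEq (hψnear i x hx)
  · refine tendsto_eLpNorm_of_le_indicator (K := K * b) hq0 hqt
      (fun i => measurableSet_innerLayer (c := c) (a := a) (b := β i)) ?_ fun i x => ?_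
    · refine tendsto_of_tendsto_of_tendsto_of_le_of_le tendsto_const_nhds
        (tendsto_measure_innerLayer (c := c) hn0 ha hd b) (fun _ => zero_le) fun i => ?_
      exact Measure.restrict_apply_le _ _
    · by_cases hx : x ∈ cube c (2 * a)
      · rw [extension_of_mem φ hx, ← hF]
        by_cases hxl : x ∈ innerLayer c a (β i)
        · rw [Set.indicator_of_mem hxl, hψmem i x hx, Real.norm_eq_abs]
          have e : φ x + cutoff c a (β i) x * (F x - φ x) - F x =
              -((1 - cutoff c a (β i) x) * (F x - φ x)) := by ring
          rw [e, abs_neg, abs_mul, abs_of_nonneg (sub_nonneg.2 cutoff_le_one)]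
          have h1 : 1 - cutoff c a (β i) x ≤ 1 := by
            linarith [cutoff_nonneg (c := c) (a := a) (b := β i) (x := x)]
          have h2 : depth c a x ≤ b := by linarith [hdepth i x hxl, hβb i, hβ i]
          calc _ ≤ 1 * (K * b) := mul_le_mul h1 ((hclose i x hxl).trans (by gcongr))
                (abs_nonneg _) zero_le_one
            _ = _ := one_mul _
        · rw [Set.indicator_of_notMem hxl, (hψdeep i x hx hxl).self_of_nhds]
          simp
      · rw [extension_of_notMem φ hx, (hψnear i x hx).self_of_nhds,
          Set.indicator_of_notMem fun hxl => hx hxl.1]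
        simp
  -- The gradients of `φ` and `F` contribute `L` and `M`. In the term with the cutoff, `|F - φ| ≤ K
  -- * β i` cancels the factor `S / β i`, so the error stays bounded as the layer shrinks.
  · refine tendsto_eLpNorm_of_le_indicator (K := L + M + K * S) hq0 hqt
      (fun i => measurableSet_innerLayer (c := c) (a := a) (b := β i)) ?_ fun i x => ?_
    · refine tendsto_of_tendsto_of_tendsto_of_le_of_le tendsto_const_nhds
        (tendsto_measure_innerLayer (c := c) hn0 ha hd b) (fun _ => zero_le) fun i => ?_
      exact Measure.restrict_apply_le _ _
    · by_cases hx : x ∈ cube c (2 * a)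
      · rw [extensionGradient_of_mem φ hx, ← hF, gradient_sub_gradient]
        by_cases hxl : x ∈ innerLayer c a (β i)
        · have hnhds := (isOpen_cube c (2 * a)).mem_nhds hx
          have hτd : DifferentiableAt ℝ (cutoff c a (β i)) x :=
            ((contDiffOn_cutoff hn0).contDiffAt hnhds).differentiableAt (by simp)
          have hFd : DifferentiableAt ℝ F x := (hFs.contDiffAt hnhds).differentiableAt (by simp)
          have hφd : DifferentiableAt ℝ φ x := hφ.contDiffAt.differentiableAt (by simp)
          have hfd : fderiv ℝ (ψ i) x - fderiv ℝ F x =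
              (1 - cutoff c a (β i) x) • (fderiv ℝ φ x - fderiv ℝ F x) +
                (F x - φ x) • fderiv ℝ (cutoff c a (β i)) x := by
            have h1 := hφd.hasFDerivAt.add
              (hτd.hasFDerivAt.mul (hFd.hasFDerivAt.sub hφd.hasFDerivAt))
            have h2 : fderiv ℝ (fun x => φ x + cutoff c a (β i) x * (F x - φ x)) x = _ := h1.fderiv
            rw [(hψmemnear i x hx).fderiv_eq, h2, Pi.sub_apply]
            module
          have hφL : ‖fderiv ℝ φ x‖ ≤ L := norm_fderiv_le_of_lipschitz ℝ hL
          have hFM := hM x hx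
          rw [Set.indicator_of_mem hxl, hfd]
          refine (norm_add_le _ _).trans (add_le_add ?_ ?_)
          · rw [norm_smul, Real.norm_of_nonneg (sub_nonneg.2 cutoff_le_one)]
            have h1 : 1 - cutoff c a (β i) x ≤ 1 := by
              linarith [cutoff_nonneg (c := c) (a := a) (b := β i) (x := x)]
            refine (mul_le_of_le_one_left (norm_nonneg _) h1).trans ?_
            exact (norm_sub_le _ _).trans (add_le_add hφL hFM)
          · rw [norm_smul, Real.norm_eq_abs]
            have h1 := hS hn0 (hβ i) hx
            calc |F x - φ x| * ‖fderiv ℝ (cutoff c a (β i)) x‖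
                ≤ (K * β i) * (S / β i) := by
                  gcongr
                  · exact (hclose i x hxl).trans (by gcongr; exact hdepth i x hxl)
              _ = K * S := by have := (hβ i).ne'; field_simp
        · rw [Set.indicator_of_notMem hxl, (hψdeep i x hx hxl).fderiv_eq, sub_self, norm_zero]
      · rw [extensionGradient_of_notMem φ hx, gradient_sub_gradient, (hψnear i x hx).fderiv_eq,
          Set.indicator_of_notMem fun hxl => hx hxl.1, sub_self, norm_zero]

end TestFunctions

/-! ### Completeness and limits of `L^p` estimates. -/

theorem exists_tendsto_eLpNorm_of_le {X F : Type*} [MeasurableSpace X] [NormedAddCommGroup F]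
    [CompleteSpace F] {μ : Measure X} {q : ℝ≥0∞} (hq : 1 ≤ q) {f : ℕ → X → F}
    (hf : ∀ i, MemLp (f i) q μ) {e : ℕ → ℝ≥0∞} (he : Tendsto e atTop (𝓝 0))
    (h : ∀ i k, eLpNorm (fun x => f i x - f k x) q μ ≤ e i + e k) :
    ∃ g, MemLp g q μ ∧ Tendsto (fun i => eLpNorm (fun x => f i x - g x) q μ) atTop (𝓝 0) := by
  have : Fact (1 ≤ q) := ⟨hq⟩
  have hcau : CauchySeq fun i => (hf i).toLp (f i) := by
    refine EMetric.cauchySeq_iff.2 fun ε hε => ?_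
    obtain ⟨N, hN⟩ := eventually_atTop.1 (he.eventually (gt_mem_nhds (ENNReal.half_pos hε.ne')))
    refine ⟨N, fun i hi k hk => ?_⟩
    rw [Lp.edist_toLp_toLp]
    refine (h i k).trans_lt ?_
    rw [← ENNReal.add_halves ε]
    exact ENNReal.add_lt_add (hN i hi) (hN k hk)
  obtain ⟨g, hg⟩ := cauchySeq_tendsto_of_complete hcau
  refine ⟨g, Lp.memLp g, ?_⟩
  rw [← Lp.toLp_coeFn g (Lp.memLp g)] at hg
  exact (Lp.tendsto_Lp_iff_tendsto_eLpNorm'' _ hf _ _).1 hg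

/-- The triangle inequality on both sides. Two measures are allowed because the bound compares
gradients on the cube with gradients on the ring. -/
theorem le_of_tendsto_eLpNorm_sub {X F Y G : Type*} [MeasurableSpace X] [NormedAddCommGroup F]
    [MeasurableSpace Y] [NormedAddCommGroup G] {μ : Measure X} {ν : Measure Y} {q : ℝ≥0∞}
    (hq : 1 ≤ q) {f : ℕ → X → F} {f' : X → F} {g : ℕ → Y → G} {g' : Y → G} {K : ℝ≥0}
    (hf : ∀ i, AEStronglyMeasurable (f i) μ) (hf' : AEStronglyMeasurable f' μ)
    (hg : ∀ i, AEStronglyMeasurable (g i) ν) (hg' : AEStronglyMeasurable g' ν)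
    (hfg : ∀ i, eLpNorm (f i) q μ ≤ K * eLpNorm (g i) q ν)
    (h : Tendsto (fun i => eLpNorm (fun x => f i x - f' x) q μ) atTop (𝓝 0))
    (h' : Tendsto (fun i => eLpNorm (fun x => g i x - g' x) q ν) atTop (𝓝 0)) :
    eLpNorm f' q μ ≤ K * eLpNorm g' q ν := by
  have hlim : Tendsto (fun i => eLpNorm (fun x => f i x - f' x) q μ +
      K * (eLpNorm (fun x => g i x - g' x) q ν + eLpNorm g' q ν)) atTop
      (𝓝 (0 + K * (0 + eLpNorm g' q ν))) :=
    h.add (ENNReal.Tendsto.const_mul (h'.add tendsto_const_nhds) (Or.inr ENNReal.coe_ne_top))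
  rw [zero_add, zero_add] at hlim
  refine ge_of_tendsto' hlim fun i => ?_
  have h1 : eLpNorm f' q μ ≤ eLpNorm (fun x => f i x - f' x) q μ + eLpNorm (f i) q μ := by
    have e : f' = f i - fun x => f i x - f' x := by ext x; simp
    calc eLpNorm f' q μ = eLpNorm (f i - fun x => f i x - f' x) q μ := by rw [← e]
      _ ≤ eLpNorm (f i) q μ + eLpNorm (fun x => f i x - f' x) q μ :=
          eLpNorm_sub_le (hf i) ((hf i).sub hf') hq
      _ = _ := add_comm _ _
  have h2 : eLpNorm (g i) q ν ≤ eLpNorm (fun x => g i x - g' x) q ν + eLpNorm g' q ν := by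
    have e : g i = (fun x => g i x - g' x) + g' := by ext x; simp
    calc eLpNorm (g i) q ν = eLpNorm ((fun x => g i x - g' x) + g') q ν := by rw [← e]
      _ ≤ _ := eLpNorm_add_le ((hg i).sub hg') hg' hq
  refine h1.trans (add_le_add le_rfl ((hfg i).trans ?_))
  gcongr

/-! ### From test functions to Sobolev functions. -/

section Operator

variable {n : ℕ} {c x : Eucl n} {a b : ℝ} {μ : Measure (Eucl n)} {A B : ℝ≥0}
  {φ ψ : Eucl n → ℝ} {p : ℝ} {j : ℕ} {R Q Ω : Set (Eucl n)}

/-- Linearity lets the gradient bound act on differences of test functions, which makes the extended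
gradients Cauchy. -/
theorem IsCollar.extensionGradient_sub (h : IsCollar μ c a b R Q) (hd : IsDoubling μ A)
    (hn : 0 < n) (hφ : ContDiff ℝ ∞ φ) (hc : HasCompactSupport φ) (hψ : ContDiff ℝ ∞ ψ)
    (hc' : HasCompactSupport ψ) :
    extensionGradient μ c a b R (fun x => φ x - ψ x) =
      fun x => extensionGradient μ c a b R φ x - extensionGradient μ c a b R ψ x := by
  have hi := h.integrable_indicator_test hd hφ hc
  have hi' := h.integrable_indicator_test hd hψ hc'
  have hext := h.extension_sub hd hn hi hi'
  ext1 x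
  by_cases hx : x ∈ cube c (2 * a)
  · have hnhds := (isOpen_cube c (2 * a)).mem_nhds hx
    have hD : ∀ {f : Eucl n → ℝ}, Integrable (R.indicator f) μ →
        DifferentiableAt ℝ (fill μ c a b (R.indicator f)) x := fun hf =>
      ((hd.contDiffOn_fill (b := b) hn hf.locallyIntegrable).contDiffAt hnhds).differentiableAt
        (by simp)
    have heq : fill μ c a b (R.indicator fun x => φ x - ψ x) =ᶠ[𝓝 x]
        fun y => fill μ c a b (R.indicator φ) y - fill μ c a b (R.indicator ψ) y := by
      filter_upwards [hnhds] with y hy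
      have := congrFun hext y
      rwa [extension_of_mem _ hy, extension_of_mem _ hy, extension_of_mem _ hy] at this
    rw [extensionGradient_of_mem _ hx, extensionGradient_of_mem _ hx,
      extensionGradient_of_mem _ hx, gradient, gradient, gradient, heq.fderiv_eq,
      fderiv_fun_sub (hD hi) (hD hi'), map_sub]
  · rw [extensionGradient_of_notMem _ hx, extensionGradient_of_notMem _ hx,
      extensionGradient_of_notMem _ hx, gradient, gradient, gradient,
      fderiv_fun_sub (hφ.contDiffAt.differentiableAt (by simp))
        (hψ.contDiffAt.differentiableAt (by simp)), map_sub]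

/-- The extension of a Sobolev function is a Sobolev function. -/
theorem exists_hasSobolevGradient_extension (hn : 2 ≤ n) (A B : ℝ≥0) :
    ∃ C : ℝ≥0, ∀ {p : ℝ} {μ : Measure (Eucl n)}, 1 ≤ p → IsDoubling μ A →
      SatisfiesPoincare p μ B → ∀ {c : Eucl n} {a b : ℝ} {R Q : Set (Eucl n)} {j : ℕ},
      IsCollar μ c a b R Q → Bornology.IsBounded R → a ≤ 2 ^ j * b →
      ∀ {Ω : Set (Eucl n)} {u : Eucl n → ℝ} {v : Eucl n → Eucl n}, IsOpen Ω → closure R ⊆ Ω →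
      HasSobolevGradient p μ Ω u v →
      ∃ v' : Eucl n → Eucl n, HasSobolevGradient p μ Q (extension μ c a b R u) v' ∧
        eLpNorm v' (ENNReal.ofReal p) (μ.restrict Q) ≤
          ((C * (2 * A) ^ j + 1 : ℝ≥0) : ℝ≥0∞) *
            eLpNorm v (ENNReal.ofReal p) (μ.restrict R) := by
  obtain ⟨C, hC⟩ := exists_eLpNorm_extensionGradient_le hn A B
  refine ⟨C, fun {p μ} hp hd hP {c a b R Q j} h hRb hj {Ω u v} hΩ hRΩ hu => ?_⟩
  have hn0 : 0 < n := by omega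
  have hp' : (1 : ℝ≥0∞) ≤ ENNReal.ofReal p := by simpa using hp
  have := hd.isLocallyFiniteMeasure
  obtain ⟨ψ, hψ, hψc, ht, hg⟩ := hu.exists_test_functions h.isOpen_collar hRb hΩ hRΩ
  have huR := hu.mono (subset_closure.trans hRΩ)
  set K : ℝ≥0 := C * (2 * A) ^ j + 1 with hK
  have hψR : ∀ i, MemLp (ψ i) (ENNReal.ofReal p) (μ.restrict R) := fun i =>
    (hψ i).continuous.memLp_of_hasCompactSupport (hψc i)
  have hgR : ∀ i, MemLp (gradient (ψ i)) (ENNReal.ofReal p) (μ.restrict R) := fun i =>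
    (continuous_gradient (hψ i)).memLp_of_hasCompactSupport (hasCompactSupport_gradient (hψc i))
  have hS := fun i => h.hasSobolevGradient_extension hd hP hn hp (hψ i) (hψc i)
  have hsub : ∀ i k, eLpNorm (fun x => extensionGradient μ c a b R (ψ i) x -
      extensionGradient μ c a b R (ψ k) x) (ENNReal.ofReal p) (μ.restrict Q) ≤
      K * eLpNorm (fun x => gradient (ψ i) x - v x) (ENNReal.ofReal p) (μ.restrict R) +
      K * eLpNorm (fun x => gradient (ψ k) x - v x) (ENNReal.ofReal p) (μ.restrict R) := by
    intro i k
    rw [← h.extensionGradient_sub hd hn0 (hψ i) (hψc i) (hψ k) (hψc k), ← mul_add]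
    refine (hC hp hd hP h hj ((hψ i).sub (hψ k)) ((hψc i).sub (hψc k))).trans ?_
    gcongr 1
    refine le_trans (le_of_eq (congrArg (eLpNorm · _ _) ?_))
      (eLpNorm_sub_le ((hgR i).1.sub huR.2.1.1) ((hgR k).1.sub huR.2.1.1) hp')
    ext1 x
    simp only [Pi.sub_apply, sub_sub_sub_cancel_right]
    rw [gradient, gradient, gradient, ← map_sub]
    congr 1
    exact fderiv_fun_sub ((hψ i).contDiffAt.differentiableAt (by simp))
        ((hψ k).contDiffAt.differentiableAt (by simp))
  have he : Tendsto (fun i => (K : ℝ≥0∞) * eLpNorm (fun x => gradient (ψ i) x - v x)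
      (ENNReal.ofReal p) (μ.restrict R)) atTop (𝓝 0) := by
    simpa using ENNReal.Tendsto.const_mul hg (Or.inr (ENNReal.coe_ne_top (r := K)))
  obtain ⟨v', hv', hlim⟩ := exists_tendsto_eLpNorm_of_le hp' (fun i => (hS i).2.1) he hsub
  -- The limit function is the extension of `u` itself, by the `L^p` bound applied to `ψ i - u`;
  -- only the limit of the gradients comes from completeness.
  refine ⟨v', hasSobolevGradient_of_tendsto hp h.isOpen_total hS (h.memLp_extension hd hn hp huR.1)
    hv' ?_ hlim, le_of_tendsto_eLpNorm_sub hp' (fun i => (hS i).2.1.1) hv'.1 (fun i => (hgR i).1)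
    huR.2.1.1 (fun i => hC hp hd hP h hj (hψ i) (hψc i)) hlim hg⟩
  have he' : Tendsto (fun i => ((4 * A ^ (2 * n + 8) * A ^ j + 1 : ℝ≥0) : ℝ≥0∞) *
      eLpNorm (fun x => ψ i x - u x) (ENNReal.ofReal p) (μ.restrict R)) atTop (𝓝 0) := by
    simpa using ENNReal.Tendsto.const_mul ht
      (Or.inr (ENNReal.coe_ne_top (r := 4 * A ^ (2 * n + 8) * A ^ j + 1)))
  refine tendsto_of_tendsto_of_tendsto_of_le_of_le tendsto_const_nhds he' (fun _ => zero_le)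
    fun i => ?_
  have h1 := h.extension_sub hd hn0 (h.integrable_indicator hp (hψR i))
    (h.integrable_indicator hp huR.1)
  rw [← h1]
  exact h.eLpNorm_extension_le hd hn hp hj ((hψR i).sub huR.1)

end Operator


/-! ### The operator and the collar of a cubical ring. -/

section Operator

variable {n : ℕ} {c x : Eucl n} {a b : ℝ} {μ : Measure (Eucl n)} {A B : ℝ≥0}
  {p : ℝ} {j : ℕ} {R Q : Set (Eucl n)}

/-- The extension operator on Sobolev functions in a neighbourhood of the collar. -/
theorem exists_extension_operator (hn : 2 ≤ n) (A B : ℝ≥0) :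
    ∃ C : ℝ≥0, ∀ {p : ℝ} {μ : Measure (Eucl n)} (hp : 1 ≤ p), IsDoubling μ A →
      SatisfiesPoincare p μ B → ∀ {c : Eucl n} {a b : ℝ} {R Q : Set (Eucl n)} {j : ℕ}
      (hR : IsOpen R) (hQ : IsOpen Q), IsCollar μ c a b R Q → Bornology.IsBounded R →
      a ≤ 2 ^ j * b → ∃ E : H1pClosure p hp μ R hR →ₗ[ℝ] H1p p hp μ Q hQ,
        ∀ u : H1pClosure p hp μ R hR,
          (∀ᵐ x ∂μ.restrict R, (E u).1 x = u.1 x) ∧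
          eLpNorm (E u).1 (ENNReal.ofReal p) (μ.restrict Q) ≤
            ((4 * A ^ (2 * n + 8) * A ^ j + 1 : ℝ≥0) : ℝ≥0∞) *
              eLpNorm u.1 (ENNReal.ofReal p) (μ.restrict R) ∧
          ∀ v v' : Eucl n → Eucl n, HasSobolevGradient p μ R u.1 v →
            HasSobolevGradient p μ Q (E u).1 v' →
            eLpNorm v' (ENNReal.ofReal p) (μ.restrict Q) ≤
              ((C * (2 * A) ^ j + 1 : ℝ≥0) : ℝ≥0∞) *
                eLpNorm v (ENNReal.ofReal p) (μ.restrict R) := by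
  obtain ⟨C, hC⟩ := exists_hasSobolevGradient_extension hn A B
  refine ⟨C, fun {p μ} hp hd hP {c a b R Q j} hR hQ h hRb hj => ?_⟩
  have hn0 : 0 < n := by omega
  have hgrad : ∀ u : H1pClosure p hp μ R hR, ∃ v v' : Eucl n → Eucl n,
      HasSobolevGradient p μ R u.1 v ∧ HasSobolevGradient p μ Q (extension μ c a b R u.1) v' ∧
      eLpNorm v' (ENNReal.ofReal p) (μ.restrict Q) ≤
        ((C * (2 * A) ^ j + 1 : ℝ≥0) : ℝ≥0∞) *
          eLpNorm v (ENNReal.ofReal p) (μ.restrict R) := by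
    rintro ⟨u, -, Ω, hΩ, hRΩ, u', ⟨v, hv⟩, hu⟩
    obtain ⟨v', hv', hle⟩ := hC hp hd hP h hRb hj hΩ hRΩ hv
    exact ⟨v, v', (hv.mono (subset_closure.trans hRΩ)).congr hu.symm,
      hv'.congr (h.extension_congr hu.symm), hle⟩
  have hmem : ∀ u : H1pClosure p hp μ R hR,
      MemLp (extension μ c a b R u.1) (ENNReal.ofReal p) (μ.restrict Q) := fun u =>
    h.memLp_extension hd hn hp (Lp.memLp u.1)
  have hint : ∀ u : H1pClosure p hp μ R hR, Integrable (R.indicator u.1) μ := fun u =>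
    h.integrable_indicator hp (Lp.memLp u.1)
  let E : H1pClosure p hp μ R hR →ₗ[ℝ] H1p p hp μ Q hQ :=
    { toFun := fun u => ⟨(hmem u).toLp _, by
        obtain ⟨v, v', -, hv', -⟩ := hgrad u
        exact ⟨v', hv'.congr (hmem u).coeFn_toLp.symm⟩⟩
      map_add' := fun u₁ u₂ => by
        refine Subtype.ext ?_
        change (hmem (u₁ + u₂)).toLp _ = (hmem u₁).toLp _ + (hmem u₂).toLp _
        rw [← MemLp.toLp_add]
        refine MemLp.toLp_congr _ _ ((h.extension_congr (Lp.coeFn_add u₁.1 u₂.1)).trans ?_)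
        exact EventuallyEq.of_eq (h.extension_add hd hn0 (hint u₁) (hint u₂))
      map_smul' := fun t u => by
        refine Subtype.ext ?_
        change (hmem (t • u)).toLp _ = t • (hmem u).toLp _
        rw [← MemLp.toLp_const_smul]
        refine MemLp.toLp_congr _ _ ((h.extension_congr (Lp.coeFn_smul t u.1)).trans ?_)
        exact EventuallyEq.of_eq (extension_const_mul t _) }
  have hE : ∀ u, ((E u).1 : Eucl n → ℝ) =ᵐ[μ.restrict Q] extension μ c a b R u.1 := fun u =>
    (hmem u).coeFn_toLp
  refine ⟨E, fun u => ⟨?_, ?_, fun v v' hv hv' => ?_⟩⟩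
  · filter_upwards [(hE u).filter_mono (ae_mono (Measure.restrict_mono_set μ h.collar_subset)),
      ae_restrict_mem hR.measurableSet] with x hx hxR
    rw [hx, h.extension_of_mem_collar _ hxR]
  · rw [eLpNorm_congr_ae (hE u)]
    exact h.eLpNorm_extension_le hd hn hp hj (Lp.memLp u.1)
  · obtain ⟨w, w', hw, hw', hle⟩ := hgrad u
    -- Uniqueness replaces the arbitrary gradients by the particular pair for which the bound was
    -- proved.
    rw [eLpNorm_congr_ae (hv.ae_eq hn0 hp hd hP hR hw),
      eLpNorm_congr_ae ((hv'.congr (hE u)).ae_eq hn0 hp hd hP hQ hw')]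
    exact hle

/-- Such a point is approached from within along the segment from the centre. -/
theorem mem_frontier_cube {ℓ : ℝ} (hℓ : 0 < ℓ) (hx : supNorm (x - c) = ℓ / 2) :
    x ∈ frontier (cube c ℓ) := by
  rw [(isOpen_cube c ℓ).frontier_eq]
  refine ⟨?_, fun h => ((mem_cube_iff hℓ).1 h).ne hx⟩
  have hcont : Tendsto (fun t : ℝ => c + t • (x - c)) (𝓝[<] 1) (𝓝 (c + (1 : ℝ) • (x - c))) :=
    (Continuous.tendsto (by fun_prop) _).mono_left nhdsWithin_le_nhds
  rw [one_smul, add_sub_cancel] at hcont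
  refine mem_closure_of_tendsto hcont ?_
  filter_upwards [Ioo_mem_nhdsLT (show (0 : ℝ) < 1 from one_pos)] with t ht
  rw [mem_cube_iff hℓ, add_sub_cancel_left]
  have : supNorm (t • (x - c)) = t * supNorm (x - c) := by
    rw [supNorm, WithLp.ofLp_smul, norm_smul, Real.norm_of_nonneg ht.1.le]
    rfl
  rw [this, hx]
  nlinarith [ht.2]

/-- The minimum is needed because for `α > 1 / 2` the ring is thicker than the half side of the
hole, whereas the construction assumes `b ≤ a`. -/
theorem isCollar_cubeRing {w : Eucl n → ℝ} (hd : IsDoubling (weightMeasure w) A) (c : Eucl n)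
    {ℓ α : ℝ} (hℓ : 0 < ℓ) (hα : 0 < α) (hα1 : α < 1) :
    IsCollar (weightMeasure w) c ((1 - α) * ℓ / 2) (min ((1 - α) * ℓ / 2) (α * ℓ / 2))
      (cubeRing c ℓ α) (cube c ℓ) where
  a_pos := by have := sub_pos.2 hα1; positivity
  b_pos := by have := sub_pos.2 hα1; exact lt_min (by positivity) (by positivity)
  b_le := min_le_left _ _
  isOpen_collar := isOpen_cubeRing c ℓ α
  isOpen_total := isOpen_cube c ℓ
  shell_subset := fun x hx => by
    have := min_le_right ((1 - α) * ℓ / 2) (α * ℓ / 2)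
    rw [mem_cubeRing_iff hℓ hα1]
    exact ⟨by linarith [hx.2], hx.1⟩
  disjoint := by
    have := sub_pos.2 hα1
    rw [Set.disjoint_left]
    intro x hx hx'
    rw [mem_cube_two_mul_iff (by positivity)] at hx
    exact absurd hx (not_lt.2 ((mem_cubeRing_iff hℓ hα1).1 hx').2.le)
  collar_subset := fun x hx => hx.1
  ae_eq := by
    have h1 := sub_pos.2 hα1
    filter_upwards [compl_mem_ae_iff.2
      (weightMeasure_frontier_cube w c (2 * ((1 - α) * ℓ / 2)))] with x hx
    refine propext ⟨fun hxQ => ?_, ?_⟩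
    · rcases lt_trichotomy (supNorm (x - c)) ((1 - α) * ℓ / 2) with h | h | h
      · exact Or.inl ((mem_cube_two_mul_iff (by positivity)).2 h)
      · exact absurd (mem_frontier_cube (by positivity) (by rw [h]; ring)) hx
      · exact Or.inr ((mem_cubeRing_iff hℓ hα1).2 ⟨(mem_cube_iff hℓ).1 hxQ, h⟩)
    · rintro (h | h)
      · have h2 := (mem_cube_two_mul_iff (by positivity)).1 h
        refine (mem_cube_iff hℓ).2 ?_
        nlinarith
      · exact h.1
  measure_ne_top := hd.measure_ne_top c hℓ

end Operator

/-! ### Dyadic size of the relative thickness, and the theorem. -/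

theorem exists_two_pow_mul_lt_le {α : ℝ} (hα : 0 < α) (hα1 : α < 1) :
    ∃ m : ℕ, 2 ^ m < α⁻¹ ∧ α⁻¹ ≤ 2 ^ (m + 1) := by
  have h1 := (one_lt_inv₀ hα).2 hα1
  obtain ⟨k, hk, hk'⟩ := exists_mem_Ioc_zpow (inv_pos.2 hα) (one_lt_two (α := ℝ))
  have hk0 : 0 ≤ k := by
    by_contra hneg
    have : (2 : ℝ) ^ (k + 1) ≤ 1 := zpow_le_one_of_nonpos₀ one_le_two (by omega)
    linarith
  lift k to ℕ using hk0
  exact ⟨k, by exact_mod_cast hk, by exact_mod_cast hk'⟩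

/-- With this, the comparison of `C₁ ^ m` and a power of `α` is `2 ^ m < α⁻¹ ≤ 2 ^ (m + 1)` raised
to the power `Real.logb 2 C₁`. -/
theorem two_pow_rpow_logb {C : ℝ} (hC : 0 < C) (m : ℕ) :
    ((2 : ℝ) ^ m) ^ Real.logb 2 C = C ^ m := by
  rw [← Real.rpow_natCast, ← Real.rpow_mul zero_le_two, mul_comm, Real.rpow_mul zero_le_two,
    Real.rpow_logb two_pos (by norm_num) hC, Real.rpow_natCast]

end WeightedSobolev

theorem mainTheorem4 (n : ℕ) (hn : 2 ≤ n) (p : ℝ) (hp : 1 ≤ p) (A B : ℝ≥0) :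
    ∃ C₀ C₁ : ℝ, 0 < C₀ ∧ 2 ≤ C₁ ∧
      ∀ w : Eucl n → ℝ, IsAdmissibleWeight p w A B →
      ∀ (c : Eucl n) (ℓ α : ℝ), 0 < ℓ → 0 < α → α < 1 →
      ∃ m : ℕ, 2 ^ m * (α * ℓ) < ℓ ∧ ℓ ≤ 2 ^ (m + 1) * (α * ℓ) ∧
        (∃ E : H1pClosure p hp (weightMeasure w) (cubeRing c ℓ α) (isOpen_cubeRing c ℓ α)
              →ₗ[ℝ] H1p p hp (weightMeasure w) (cube c ℓ) (isOpen_cube c ℓ),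
          ∀ u : H1pClosure p hp (weightMeasure w) (cubeRing c ℓ α)
              (isOpen_cubeRing c ℓ α),
            (∀ᵐ x ∂((weightMeasure w).restrict (cubeRing c ℓ α)),
              (E u).1 x = u.1 x) ∧
            eLpNorm (E u).1 (ENNReal.ofReal p) ((weightMeasure w).restrict (cube c ℓ)) ≤
              ENNReal.ofReal (C₀ * C₁ ^ m) *
                eLpNorm u.1 (ENNReal.ofReal p)
                  ((weightMeasure w).restrict (cubeRing c ℓ α)) ∧
            ∀ v v' : Eucl n → Eucl n,
              HasSobolevGradient p (weightMeasure w) (cubeRing c ℓ α) u.1 v →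
              HasSobolevGradient p (weightMeasure w) (cube c ℓ) (E u).1 v' →
              eLpNorm v' (ENNReal.ofReal p) ((weightMeasure w).restrict (cube c ℓ)) ≤
                ENNReal.ofReal (C₀ * C₁ ^ m) *
                  eLpNorm v (ENNReal.ofReal p)
                    ((weightMeasure w).restrict (cubeRing c ℓ α))) ∧
        C₁ ^ m < α ^ (-Real.logb 2 C₁) ∧ α ^ (-Real.logb 2 C₁) ≤ C₁ ^ (m + 1) := by
  obtain ⟨C, hC⟩ := exists_extension_operator hn A B
  -- The base must dominate `A` and `2 * A`. The summand `2` secures `N ≥ 2` before any admissible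
  -- weight is given.
  set N : ℝ≥0 := 2 * A + 2 with hN
  set M : ℝ≥0 := 4 * A ^ (2 * n + 8) + C + 1 with hM
  have hN1 : 1 ≤ N := by
    rw [hN, show (2 : ℝ≥0) = 1 + 1 by norm_num, ← add_assoc]
    exact le_add_self
  have hN2 : (2 : ℝ) ≤ N := by rw [hN]; push_cast; linarith [A.coe_nonneg]
  have hM0 : 0 < M := by positivity
  -- The extra factor `N` in `C₀` absorbs the shift from exponent `m` to `j = m + 1`.
  refine ⟨(M * N : ℝ≥0), N, ?_, hN2, fun w hw c ℓ α hℓ hα hα1 => ?_⟩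
  · have : 0 < N := by positivity
    exact NNReal.coe_pos.2 (by positivity)
  obtain ⟨m, hm, hm'⟩ := exists_two_pow_mul_lt_le hα hα1
  have hcol := isCollar_cubeRing hw.doubling c hℓ hα hα1
  have hm1 : ℓ ≤ 2 ^ (m + 1) * (α * ℓ) := by
    rw [inv_le_iff_one_le_mul₀ hα] at hm'
    nlinarith
  -- If the minimum is the half side of the hole this is trivial; otherwise it follows from `ℓ ≤ 2 ^
  -- (m + 1) * (α * ℓ)`.
  have hj : (1 - α) * ℓ / 2 ≤ 2 ^ (m + 1) * min ((1 - α) * ℓ / 2) (α * ℓ / 2) := by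
    have h1 := sub_pos.2 hα1
    rw [mul_min_of_nonneg _ _ (by positivity)]
    refine le_min (le_mul_of_one_le_left (by positivity) (one_le_pow₀ one_le_two)) ?_
    nlinarith
  obtain ⟨E, hE⟩ := hC hp hw.doubling hw.poincare (isOpen_cubeRing c ℓ α) (isOpen_cube c ℓ) hcol
    ((isBounded_cube c hℓ).subset hcol.collar_subset) hj
  have hcoe : ENNReal.ofReal (((M * N : ℝ≥0) : ℝ) * (N : ℝ) ^ m) =
      ((M * N ^ (m + 1) : ℝ≥0) : ℝ≥0∞) := by
    rw [← NNReal.coe_pow, ← NNReal.coe_mul, ENNReal.ofReal_coe_nnreal, pow_succ', mul_assoc]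
  have hNm : 1 ≤ N ^ (m + 1) := one_le_pow₀ hN1
  have hAN : (A : ℝ≥0) ^ (m + 1) ≤ N ^ (m + 1) := by
    gcongr
    rw [hN, two_mul, add_assoc]
    exact le_self_add
  have hAN' : (2 * A : ℝ≥0) ^ (m + 1) ≤ N ^ (m + 1) := by
    gcongr
    exact le_self_add
  refine ⟨m, ?_, hm1, ⟨E, fun u => ⟨(hE u).1, (hE u).2.1.trans ?_, fun v v' hv hv' =>
    ((hE u).2.2 v v' hv hv').trans ?_⟩⟩, ?_, ?_⟩
  · rw [lt_inv_comm₀ (by positivity) hα, ← one_div, lt_div_iff₀ (by positivity)] at hm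
    nlinarith
  · rw [hcoe]
    gcongr
    calc 4 * A ^ (2 * n + 8) * A ^ (m + 1) + 1
        ≤ 4 * A ^ (2 * n + 8) * N ^ (m + 1) + N ^ (m + 1) := by gcongr
      _ ≤ 4 * A ^ (2 * n + 8) * N ^ (m + 1) + N ^ (m + 1) + C * N ^ (m + 1) := le_self_add
      _ = M * N ^ (m + 1) := by rw [hM]; ring
  · rw [hcoe]
    gcongr
    calc C * (2 * A) ^ (m + 1) + 1
        ≤ C * N ^ (m + 1) + N ^ (m + 1) := by gcongr
      _ ≤ C * N ^ (m + 1) + N ^ (m + 1) + 4 * A ^ (2 * n + 8) * N ^ (m + 1) := le_self_add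
      _ = M * N ^ (m + 1) := by rw [hM]; ring
  · have hL : 0 < Real.logb 2 N := Real.logb_pos one_lt_two (by linarith)
    rw [← two_pow_rpow_logb (by positivity), Real.rpow_neg hα.le, ← Real.inv_rpow hα.le]
    exact Real.rpow_lt_rpow (by positivity) hm hL
  · have hL : 0 < Real.logb 2 N := Real.logb_pos one_lt_two (by linarith)
    rw [← two_pow_rpow_logb (by positivity), Real.rpow_neg hα.le, ← Real.inv_rpow hα.le]
    exact Real.rpow_le_rpow (by positivity) hm' hL.le
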